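/- Let $\gamma:[0,\infty)\to\mathbb R$ be Lipschitz continuous and strictly increasing, with values in $[\varepsilon,1-\varepsilon]$ for some $\varepsilon>0$. On a probability space let $(Y_n)_{n\ge1}$ be independent exponential random variables with parameter $1$ and let $(T_n)_{n\ge1}$ be independent random variables uniformly distributed on $[0,1]$, the two sequences being independent of each other. Put $Z_n=Y_1+\dots+Y_n$ and $N(dt,dz)=\sum_{n\ge1}\delta_{(T_n,Z_n)}(dt,dz)$ (the standard representation of a Poisson measure on $[0,1]\times[0,\infty)$ with intensity $dt\,dz$), and let $\mathcal F_t=\sigma\big(N(A):A\in\mathcal B([0,t]\times[0,\infty))\big)$ for $t\in[0,1]$. Then there is a process $M=(M_t)_{t\in[0,1]}$ with values in $[0,\infty)$ that is $(\mathcal F_t)_{t\in[0,1]}$-adapted, has a.s. càdlàg paths and satisfies a.s., for all $t\in[0,1]$, $$M_t=\int_{(0,t]}\int_{[0,\infty)}(1+z)^{-1/\gamma(M_{s-})}\,N(ds,dz),$$ and it is unique: any process with a.s. càdlàg paths that a.s. satisfies this equation for all $t\in[0,1]$ is indistinguishable from $M$. Furthermore: 1. $M$ is a strong Markov process with generator $\mathcal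 L$, where for Lipschitz $\varphi:[0,\infty)\to\mathbb R$ and $y\ge 0$ $$\mathcal L\varphi(y)=\int_0^1[\varphi(y+u)-\varphi(y)]\,\gamma(y)u^{-1-\gamma(y)}\,du .$$ That is, there is a Markov transition semigroup $(\kappa_t)_{t\ge0}$ on $[0,\infty)$ such that, for every Lipschitz $\varphi$, $\varphi$ is $\kappa_t(y,\cdot)$-integrable for all $t,y\ge 0$ and $(\kappa_t\varphi-\varphi)/t\to\mathcal L\varphi$ uniformly on $[0,\infty)$ as $t\downarrow0$; and for every $(\mathcal F_t)$-stopping time $\tau\le 1$, every $t\ge0$ and every Borel set $B\subset[0,\infty)$, $\mathbb P(M_{\tau+t}\in B\mid\mathcal F_\tau)=\kappa_t(M_\tau,B)$ a.s. on $\{\tau+t\le1\}$. 2. Almost surely, $t\mapsto M_t$ is (strictly) increasing on $[0,1]$. 3. Almost surely, the set of jump times $\{t\in[0,1]:M_t\ne M_{t-}\}$ equals $\{T_n:n\ge1\}$, and it is countable and dense in $[0,1]$. -/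

import Mathlib

open MeasureTheory ProbabilityTheory Filter Set
open scoped NNReal ENNReal Topology unitInterval

noncomputable section

namespace PoissonSDE

/-- The standing assumption on `γ : [0,∞) → ℝ`: for some `ε > 0` it takes its values in
`[ε, 1 - ε]`, and it is Lipschitz continuous and strictly increasing. -/
structure Hyp (γ : ℝ≥0 → ℝ) : Prop where
  bounds : ∃ ε : ℝ, 0 < ε ∧ ∀ y, γ y ∈ Icc ε (1 - ε)
  lipschitz : ∃ K : ℝ≥0, LipschitzWith K γ
  strictMono : StrictMono γ

/-- The jump size `G(β, z) = (1 + z)^(-1/β)`. -/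
def G (β z : ℝ) : ℝ := (1 + z) ^ (-1 / β)

/-- The operator `ℒφ(y) = ∫₀¹ [φ(y + u) - φ(y)] γ(y) u^(-1-γ(y)) du`. -/
def gen (γ : ℝ≥0 → ℝ) (φ : ℝ≥0 → ℝ) (y : ℝ≥0) : ℝ :=
  ∫ u in (0 : ℝ)..1, (φ (y + u.toNNReal) - φ y) * (γ y * u ^ (-1 - γ y))

section Noise

variable {Ω : Type*}

/-- Partial sums `Y₀ + ⋯ + Yₙ` (the sequences are indexed from `0`). -/
def Z (Y : ℕ → Ω → ℝ) (n : ℕ) (ω : Ω) : ℝ := ∑ i ∈ Finset.range (n + 1), Y i ω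

/-- The random point measure `N = ∑ₙ δ_(Tₙ, Zₙ)`. The second coordinate ranges over `ℝ`;
only its restriction to `[0,1] × [0,∞)` is used, and it is almost surely carried by that set. -/
def N (T : ℕ → Ω → I) (Y : ℕ → Ω → ℝ) (ω : Ω) : Measure (I × ℝ) :=
  Measure.sum fun n => Measure.dirac (T n ω, Z Y n ω)

variable [mΩ : MeasurableSpace Ω]

/-- The assumptions on the driving sequences: the `Yₙ` are independent exponential variables of
parameter `1`, the `Tₙ` are independent and uniform on `[0,1]`, and the two sequences are
independent of each other. -/
structure IsDriving (P : Measure Ω) (T : ℕ → Ω → I) (Y : ℕ → Ω → ℝ) : Prop where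
  measurable_T : ∀ n, Measurable (T n)
  measurable_Y : ∀ n, Measurable (Y n)
  law_T : ∀ n, P.map (T n) = volume
  law_Y : ∀ n, P.map (Y n) = expMeasure 1
  indep_T : iIndepFun T P
  indep_Y : iIndepFun Y P
  indep : IndepFun (fun ω n => T n ω) (fun ω n => Y n ω) P

theorem measurable_N_apply {T : ℕ → Ω → I} {Y : ℕ → Ω → ℝ} (hT : ∀ n, Measurable (T n))
    (hY : ∀ n, Measurable (Y n)) {A : Set (I × ℝ)} (hA : MeasurableSet A) :
    Measurable fun ω => N T Y ω A := by
  have h : ∀ n, Measurable fun ω => (T n ω, Z Y n ω) := fun n =>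
    (hT n).prodMk (Finset.measurable_sum _ fun i _ => hY i)
  simp only [N, Measure.sum_apply _ hA, Measure.dirac_apply' _ hA]
  exact Measurable.tsum fun n => (measurable_one.indicator hA).comp (h n)

/-- The filtration `ℱ_t = σ(N(A) : A ∈ ℬ([0,t] × [0,∞)))`, `t ∈ [0,1]` (not augmented). -/
def filt (T : ℕ → Ω → I) (Y : ℕ → Ω → ℝ) (hT : ∀ n, Measurable (T n))
    (hY : ∀ n, Measurable (Y n)) : Filtration I mΩ where
  seq t := ⨆ (A : Set (I × ℝ)) (_ : MeasurableSet A ∧ A ⊆ Iic t ×ˢ Ici 0),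
    MeasurableSpace.comap (fun ω => N T Y ω A) inferInstance
  mono' _ _ hst := iSup₂_le fun A hA => le_iSup₂_of_le A
    ⟨hA.1, hA.2.trans (prod_mono (Iic_subset_Iic.2 hst) le_rfl)⟩ le_rfl
  le' _ := iSup₂_le fun _ hA => (measurable_N_apply hT hY hA.1).comap_le

end Noise

/-- A path on `[0,1]` is càdlàg: right continuous with left limits. -/
def IsCadlag (f : I → ℝ≥0) : Prop :=
  ∀ t, ContinuousWithinAt f (Ici t) t ∧ ∃ l, Tendsto f (𝓝[<] t) (𝓝 l)

/-- The set of jump times `{t ∈ [0,1] : f(t) ≠ f(t-)}` (the time `0` never belongs to it). -/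
def jumpTimes (f : I → ℝ≥0) : Set I := {t | f t ≠ Function.leftLim f t}

/-- `f(t) = ∫_(0,t] ∫_[0,∞) G(γ(f(s-)), z) μ(ds, dz)` for all `t ∈ [0,1]`; the integral of the
nonnegative integrand is taken in `[0,∞]`, so that its finiteness is part of the equation. -/
def SolvesPath (γ : ℝ≥0 → ℝ) (μ : Measure (I × ℝ)) (f : I → ℝ≥0) : Prop :=
  ∀ t : I, (f t : ℝ≥0∞) =
    ∫⁻ p in Ioc 0 t ×ˢ Ici 0, ENNReal.ofReal (G (γ (Function.leftLim f p.1)) p.2) ∂μ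

/-- Almost every path of `M` is càdlàg and solves the equation driven by `N`. -/
def IsCadlagSolution {Ω : Type*} [MeasurableSpace Ω] (γ : ℝ≥0 → ℝ) (P : Measure Ω)
    (T : ℕ → Ω → I) (Y : ℕ → Ω → ℝ) (M : I → Ω → ℝ≥0) : Prop :=
  ∀ᵐ ω ∂P, IsCadlag (fun t => M t ω) ∧ SolvesPath γ (N T Y ω) (fun t => M t ω)

/-- `κ` is a (conservative) Markov transition semigroup on `[0,∞)`. -/
structure IsMarkovSemigroup (κ : ℝ≥0 → Kernel ℝ≥0 ℝ≥0) : Prop where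
  markov : ∀ t, IsMarkovKernel (κ t)
  zero : κ 0 = Kernel.id
  add : ∀ s t, κ (s + t) = κ t ∘ₖ κ s

/-- On Lipschitz functions, the infinitesimal generator of the semigroup `κ` is `L`:
`(κ_t φ - φ) / t → Lφ` as `t ↓ 0`, uniformly on `[0,∞)`. -/
def HasGeneratorOnLipschitz (κ : ℝ≥0 → Kernel ℝ≥0 ℝ≥0) (L : (ℝ≥0 → ℝ) → ℝ≥0 → ℝ) : Prop :=
  ∀ φ : ℝ≥0 → ℝ, (∃ K : ℝ≥0, LipschitzWith K φ) →
    (∀ t y, Integrable φ (κ t y)) ∧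
    TendstoUniformly (fun (t : ℝ≥0) y => ((∫ x, φ x ∂(κ t y)) - φ y) / (t : ℝ)) (L φ) (𝓝[>] 0)

/-- Strong Markov property on the time interval `[0,1]`, relative to the filtration `ℱ`, with
transition semigroup `κ`: for every `ℱ`-stopping time `τ`, every `t ≥ 0` and every Borel set `B`,
`P(M_{τ+t} ∈ B | ℱ_τ) = κ_t(M_τ, B)` almost surely on `{τ + t ≤ 1}`. (On that event the
projection to `[0,1]` is the identity.) -/
def IsStrongMarkov {Ω : Type*} [mΩ : MeasurableSpace Ω] (P : Measure Ω) (ℱ : Filtration I mΩ)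
    (M : I → Ω → ℝ≥0) (κ : ℝ≥0 → Kernel ℝ≥0 ℝ≥0) : Prop :=
  ∀ (τ : Ω → I) (hτ : IsStoppingTime ℱ (fun ω => (τ ω : WithTop I))) (t : ℝ≥0) (A : Set Ω),
    MeasurableSet[hτ.measurableSpace] A → (∀ ω ∈ A, (τ ω : ℝ) + t ≤ 1) →
    ∀ B : Set ℝ≥0, MeasurableSet B →
      P (A ∩ {ω | M (projIcc 0 1 zero_le_one ((τ ω : ℝ) + t)) ω ∈ B}) =
        ∫⁻ ω in A, κ t (M (τ ω) ω) B ∂P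

end PoissonSDE

end

/-! Pathwise solution. The laws of the `Z n` add up to Lebesgue measure on `(0, ∞)`, so almost
surely `∑ (1 + Z n)^(-(1 + ε/2))` is finite. Since `γ ≤ 1 - ε`, a jump with mark `z` has size at
most `(1 + z)^(-(1 + ε))`. On such a path the equation is a deterministic jump equation whose
coefficients are increasing, summable, and Lipschitz with summable constants. Its unknowns are the
left limits at the jump times. They form a fixed point of a monotone map on a complete lattice,
hence exist by Knaster-Tarski (`exists_isLeftSol`). The jump times are dense, so uniqueness cannot
go by induction in time; it rests on a weighted Gronwall inequality (`gronwall_jump`). Strict growth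
and the set of jump times follow because every jump is positive and the times are dense.

Measurability. The solution is the limit of Euler schemes (`tendsto_eulerReal`), and each scheme is
a measurable functional of the starting point and of the noise restricted to a time slab. `flow` is
that limit, defined for every measure; it is therefore adapted to the raw filtration and jointly
measurable, and on good paths it has the flow property.

Markov property. The restrictions of `N` to disjoint sets are independent
(`IsDriving.indepFun_restrict`), and the law of `N` is invariant under rotation of the time interval
(`IsDriving.law_flow_shift`). Independence comes from the characteristic functional
(`IsDriving.charFunctional`): `tailExp (charKernel f)` is preserved by one exponential step, so
`exp(i ∑ f)` over the first points, times `tailExp (charKernel f)` at the current arrival time, has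
constant mean. With the flow property this gives the Markov property at fixed times and kernels for
durations at most `1`, which extend to all times by powers. Stopping times are approximated from the
right by dyadic times; the limit uses right continuity of the paths and the Feller property, that
is, continuity of the flow in its starting point.

Generator. On `(0, t]` the solution is compared with the sum of the increments that the points would
produce separately from the starting value. The point of smallest index is treated exactly, up to
the influence of the others. Times are independent of marks, so the `n`-th point shares the window
with a point of smaller index with probability at most `t * min 1 (n * t)`, and the total error is
`o(t)` uniformly in the starting point. The sum of increments has mean `t` times an integral over
the marks, which the substitution `z = u^(-γ(y)) - 1` turns into `t * ℒφ(y)`. -/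

namespace PoissonSDE

/-! ### Sums over index sets -/

section IndexSums

/-- The sum of `u` over the index set `A`. -/
noncomputable def isum (u : ℕ → ℝ) (A : Set ℕ) : ℝ := ∑' n, A.indicator u n

variable {u v w : ℕ → ℝ} {A B : Set ℕ}

lemma isum_empty : isum u ∅ = 0 := by simp [isum]

lemma isum_congr (h : ∀ n ∈ A, u n = v n) : isum u A = isum v A := by
  unfold isum
  congr 1
  exact Set.indicator_congr h

lemma isum_nonneg (h : ∀ n ∈ A, 0 ≤ u n) : 0 ≤ isum u A :=
  tsum_nonneg fun n => Set.indicator_nonneg h n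

lemma isum_union (hu : Summable u) (h : Disjoint A B) :
    isum u (A ∪ B) = isum u A + isum u B := by
  unfold isum
  rw [Set.indicator_union_of_disjoint h]
  exact (hu.indicator A).tsum_add (hu.indicator B)

lemma isum_mono_set (hu : Summable u) (h0 : ∀ n, 0 ≤ u n) (h : A ⊆ B) : isum u A ≤ isum u B :=
  (hu.indicator A).tsum_le_tsum
    (fun n => Set.indicator_le_indicator_of_subset h h0 n) (hu.indicator B)

lemma isum_le_tsum (hu : Summable u) (h0 : ∀ n, 0 ≤ u n) : isum u A ≤ ∑' n, u n := by
  have := isum_mono_set hu h0 (Set.subset_univ A)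
  simpa [isum] using this

lemma isum_le_isum (hu : Summable u) (hv : Summable v) (h : ∀ n ∈ A, u n ≤ v n) :
    isum u A ≤ isum v A :=
  (hu.indicator A).tsum_le_tsum (fun n => Set.indicator_le_indicator' (h n)) (hv.indicator A)

lemma isum_add (hu : Summable u) (hv : Summable v) :
    isum (fun n => u n + v n) A = isum u A + isum v A := by
  unfold isum
  rw [← (hu.indicator A).tsum_add (hv.indicator A), ← Set.indicator_add]

lemma isum_mul_left (c : ℝ) : isum (fun n => c * u n) A = c * isum u A := by
  unfold isum
  rw [← tsum_mul_left]
  congr 1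
  ext n
  by_cases hn : n ∈ A <;> simp [hn]

lemma abs_isum_sub_le (hu : Summable u) (hv : Summable v) (hw : Summable w)
    (h : ∀ n ∈ A, |u n - v n| ≤ w n) : |isum u A - isum v A| ≤ isum w A := by
  have h1 : isum u A - isum v A = ∑' n, A.indicator (fun n => u n - v n) n := by
    unfold isum
    rw [← (hu.indicator A).tsum_sub (hv.indicator A)]
    congr 1
    ext n
    by_cases hn : n ∈ A <;> simp [hn]
  have h2 : ∀ n, ‖A.indicator (fun n => u n - v n) n‖ ≤ A.indicator w n := by
    intro n
    by_cases hn : n ∈ A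
    · simpa [hn] using h n hn
    · simp [hn]
  rw [h1, ← Real.norm_eq_abs]
  exact tsum_of_norm_bounded (hw.indicator A).hasSum h2

lemma single_le_isum (hu : Summable u) (h0 : ∀ n, 0 ≤ u n) {n : ℕ} (hn : n ∈ A) :
    u n ≤ isum u A := by
  have := (hu.indicator A).le_tsum n fun m _ => Set.indicator_nonneg (fun n _ => h0 n) m
  simpa [hn, isum] using this

/-- Dominated convergence with `u` itself as dominating sequence: it suffices that membership of
each single index stabilises. One-sided limits of paths and the vanishing of the Euler error both
reduce to this. -/
lemma tendsto_isum {α : Type*} {l : Filter α} (hu : Summable u) (h0 : ∀ n, 0 ≤ u n)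
    {S : α → Set ℕ} (h : ∀ n, ∀ᶠ k in l, (n ∈ S k ↔ n ∈ A)) :
    Tendsto (fun k => isum u (S k)) l (𝓝 (isum u A)) := by
  refine tendsto_tsum_of_dominated_convergence hu (fun n => ?_) (Eventually.of_forall fun k n => ?_)
  · refine tendsto_const_nhds.congr' ?_
    filter_upwards [h n] with k hk
    by_cases hn : n ∈ A
    · simp [hn, hk.2 hn]
    · simp [hn, mt hk.1 hn]
  · by_cases hn : n ∈ S k
    · simp [hn, abs_of_nonneg (h0 n)]
    · simp [hn, h0 n]

end IndexSums

/-! ### Pathwise jump equations -/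

section Pathwise

/-- Indices of the points in the time window `(s, t]`. -/
def win (τ : ℕ → ℝ) (s t : ℝ) : Set ℕ := {n | s < τ n ∧ τ n ≤ t}

/-- Indices of the points in the time window `(s, t)`. -/
def winLeft (τ : ℕ → ℝ) (s t : ℝ) : Set ℕ := {n | s < τ n ∧ τ n < t}

/-- A family of jump coefficients that are nonnegative, increasing, dominated by the summable
sequence `h`, and Lipschitz with constants `L * h n`. -/
structure IsJumpField (b : ℕ → ℝ → ℝ) (h : ℕ → ℝ) (L : ℝ) : Prop where
  summable : Summable h
  const_nonneg : 0 ≤ L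
  nonneg : ∀ n x, 0 ≤ b n x
  le : ∀ n x, b n x ≤ h n
  mono : ∀ n, Monotone (b n)
  lip : ∀ n x y, |b n x - b n y| ≤ L * h n * |x - y|

/-- `a n` is the left limit at the time `τ n` of the solution started from `x` at time `s`. -/
def IsLeftSol (τ : ℕ → ℝ) (b : ℕ → ℝ → ℝ) (s x : ℝ) (a : ℕ → ℝ) : Prop :=
  ∀ n, a n = x + isum (fun m => b m (a m)) (winLeft τ s (τ n))

variable {τ : ℕ → ℝ} {b : ℕ → ℝ → ℝ} {h : ℕ → ℝ} {L : ℝ}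

lemma winLeft_subset_win {s t : ℝ} : winLeft τ s t ⊆ win τ s t := fun _ hn => ⟨hn.1, hn.2.le⟩

lemma win_union {s t u : ℝ} (hst : s ≤ t) (htu : t ≤ u) :
    win τ s u = win τ s t ∪ win τ t u := by
  ext n
  simp only [win, mem_ofPred_eq, mem_union]
  constructor
  · rintro ⟨h1, h2⟩
    rcases le_or_gt (τ n) t with h3 | h3
    · exact Or.inl ⟨h1, h3⟩
    · exact Or.inr ⟨h3, h2⟩
  · rintro (⟨h1, h2⟩ | ⟨h1, h2⟩)
    · exact ⟨h1, h2.trans htu⟩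
    · exact ⟨hst.trans_lt h1, h2⟩

lemma disjoint_win {s t u : ℝ} : Disjoint (win τ s t) (win τ t u) :=
  Set.disjoint_left.2 fun _ h1 h2 => absurd h2.1 (not_lt.2 h1.2)

lemma winLeft_union {s t u : ℝ} (hst : s ≤ t) (htu : t < u) :
    winLeft τ s u = win τ s t ∪ winLeft τ t u := by
  ext n
  simp only [win, winLeft, mem_ofPred_eq, mem_union]
  constructor
  · rintro ⟨h1, h2⟩
    rcases le_or_gt (τ n) t with h3 | h3
    · exact Or.inl ⟨h1, h3⟩
    · exact Or.inr ⟨h3, h2⟩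
  · rintro (⟨h1, h2⟩ | ⟨h1, h2⟩)
    · exact ⟨h1, h2.trans_lt htu⟩
    · exact ⟨hst.trans_lt h1, h2⟩

lemma disjoint_win_winLeft {s t u : ℝ} : Disjoint (win τ s t) (winLeft τ t u) :=
  disjoint_win.mono_right winLeft_subset_win

/-- Weighted discrete exponential inequality. -/
lemma sum_mul_exp_le {q : ℕ → ℝ} (hq : Summable q) (hq0 : ∀ n, 0 ≤ q n) (s : ℝ) (F : Finset ℕ) :
    ∀ A : Set ℕ, (∀ k ∈ F, k ∈ A ∧ winLeft τ s (τ k) ⊆ A) →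
      ∑ k ∈ F, q k * Real.exp (isum q (winLeft τ s (τ k))) ≤ Real.exp (isum q A) := by
  -- Remove a point `m` of latest time. It lies in none of the left windows involved, its own
  -- included, so all of them sit in `A \ {m}`. The sum is then at most `(1 + q m) * exp (isum q (A
  -- \ {m}))`, and `1 + q m ≤ exp (q m)`.
  induction F using Finset.induction_on_max_value τ with
  | empty => intro A _; simp [Real.exp_nonneg]
  | insert m F hm hmax ih =>
    intro A hA
    have hmA := hA m (Finset.mem_insert_self m F)
    have hm' : m ∉ winLeft τ s (τ m) := fun h => lt_irrefl _ h.2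
    have h1 : ∑ k ∈ F, q k * Real.exp (isum q (winLeft τ s (τ k)))
        ≤ Real.exp (isum q (A \ {m})) := by
      refine ih _ fun k hk => ?_
      have hkA := hA k (Finset.mem_insert_of_mem hk)
      refine ⟨⟨hkA.1, fun h => hm (h ▸ hk)⟩, fun j hj => ⟨hkA.2 hj, fun h => ?_⟩⟩
      have : j = m := h
      subst this
      exact absurd hj.2 (not_lt.2 (hmax k hk))
    have h2 : isum q (winLeft τ s (τ m)) ≤ isum q (A \ {m}) :=
      isum_mono_set hq hq0 fun j hj => ⟨hmA.2 hj, fun h => hm' (h ▸ hj)⟩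
    have h3 : isum q A = isum q (A \ {m}) + q m := by
      conv_lhs => rw [← Set.sdiff_union_of_subset (Set.singleton_subset_iff.2 hmA.1)]
      rw [isum_union hq Set.disjoint_sdiff_left]
      congr 1
      unfold isum
      rw [tsum_eq_single m]
      · simp
      · intro j hj
        simp [hj]
    rw [Finset.sum_insert hm, h3, Real.exp_add]
    have h4 : Real.exp (isum q (winLeft τ s (τ m))) ≤ Real.exp (isum q (A \ {m})) :=
      Real.exp_le_exp.2 h2
    have h5 := Real.add_one_le_exp (q m)
    have h6 := Real.exp_pos (isum q (A \ {m}))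
    nlinarith [mul_le_mul_of_nonneg_left h4 (hq0 m), mul_le_mul_of_nonneg_left h5 h6.le]

lemma isum_mul_exp_le {q : ℕ → ℝ} (hq : Summable q) (hq0 : ∀ n, 0 ≤ q n) (s t : ℝ) :
    isum (fun k => q k * Real.exp (isum q (winLeft τ s (τ k)))) (winLeft τ s t) ≤
      Real.exp (isum q (winLeft τ s t)) := by
  classical
  refine Real.tsum_le_of_sum_le (fun n => Set.indicator_nonneg (fun k _ => by
    have := hq0 k; positivity) n) fun F => ?_
  rw [Finset.sum_indicator_eq_sum_filter]
  refine sum_mul_exp_le hq hq0 s _ _ fun k hk => ?_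
  have hmem := (Finset.mem_filter.1 hk).2
  exact ⟨hmem, fun j hj => ⟨hj.1, hj.2.trans hmem.2⟩⟩

/-- A Gronwall inequality for jump equations. -/
lemma gronwall_jump (hh : Summable h) (hh0 : ∀ n, 0 ≤ h n) (hL : 0 ≤ L) {s δ D : ℝ} {d : ℕ → ℝ}
    (hδ : 0 ≤ δ) (hd0 : ∀ n, 0 ≤ d n) (hdD : ∀ n, d n ≤ D)
    (hd : ∀ n, d n ≤ δ + isum (fun m => L * h m * d m) (winLeft τ s (τ n))) (n : ℕ) :
    d n ≤ 2 * δ * Real.exp (2 * L * ∑' k, h k) := by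
  -- With `q = 2 L h` the weight `W` satisfies `∑ q W ≤ W` over each left window. Hence the map `d ↦
  -- ∑ L h d` turns a bound `c * W` into `c / 2 * W`. No ordering of the jump times is needed.
  set q : ℕ → ℝ := fun k => 2 * L * h k with hq_def
  have hq : Summable q := hh.mul_left _
  have hq0 : ∀ k, 0 ≤ q k := fun k => mul_nonneg (by linarith) (hh0 k)
  set W : ℕ → ℝ := fun k => Real.exp (isum q (winLeft τ s (τ k))) with hW_def
  have hW1 : ∀ k, 1 ≤ W k := fun k => Real.one_le_exp (isum_nonneg fun j _ => hq0 j)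
  have hWle : ∀ k, W k ≤ Real.exp (2 * L * ∑' j, h j) := fun k => by
    refine Real.exp_le_exp.2 ((isum_le_tsum hq hq0).trans ?_)
    rw [hq_def, tsum_mul_left]
  have hD : 0 ≤ D := (hd0 0).trans (hdD 0)
  have hqW : Summable fun k => q k * W k :=
    Summable.of_nonneg_of_le (fun k => mul_nonneg (hq0 k) (by linarith [hW1 k]))
      (fun k => mul_le_mul_of_nonneg_left (hWle k) (hq0 k)) (hq.mul_right _)
  have hLd : Summable fun m => L * h m * d m :=
    Summable.of_nonneg_of_le (fun k => mul_nonneg (mul_nonneg hL (hh0 k)) (hd0 k))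
      (fun k => mul_le_mul_of_nonneg_left (hdD k) (mul_nonneg hL (hh0 k)))
      ((hh.mul_left L).mul_right D)
  -- Each use of the hypothesis improves the constant `c` to `δ + c / 2`, whose fixed point is `2 *
  -- δ`; the start is the crude bound `D`.
  have key : ∀ k : ℕ, ∀ n, d n ≤ (2 * δ + D * (1 / 2) ^ k) * W n := by
    intro k
    induction k with
    | zero =>
      intro n
      have := hW1 n
      have := hdD n
      simp only [pow_zero, mul_one]
      nlinarith
    | succ k ih =>
      intro n
      set c := 2 * δ + D * (1 / 2) ^ k with hc
      have hc0 : 0 ≤ c := by positivity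
      have h1 : isum (fun m => L * h m * d m) (winLeft τ s (τ n)) ≤
          isum (fun m => c / 2 * (q m * W m)) (winLeft τ s (τ n)) := by
        refine isum_le_isum hLd (hqW.mul_left _) fun m _ => ?_
        calc L * h m * d m ≤ L * h m * (c * W m) :=
              mul_le_mul_of_nonneg_left (ih m) (mul_nonneg hL (hh0 m))
          _ = c / 2 * (q m * W m) := by simp only [hq_def]; ring
      rw [isum_mul_left] at h1
      have h2 := mul_le_mul_of_nonneg_left
        (isum_mul_exp_le (τ := τ) hq hq0 s (τ n)) (by positivity : 0 ≤ c / 2)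
      have h3 := hW1 n
      have h4 : (2 * δ + D * (1 / 2) ^ (k + 1)) * W n = δ * W n + c / 2 * W n := by
        rw [hc, pow_succ]; ring
      rw [h4]
      have h5 : δ ≤ δ * W n := le_mul_of_one_le_right hδ h3
      linarith [hd n]
  have hlim : Tendsto (fun k : ℕ => (2 * δ + D * (1 / 2) ^ k) * W n) atTop
      (𝓝 ((2 * δ + D * 0) * W n)) :=
    ((tendsto_pow_atTop_nhds_zero_of_lt_one (by norm_num) (by norm_num)).const_mul D
      |>.const_add _).mul_const _
  have h1 := ge_of_tendsto' hlim fun k => key k n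
  rw [mul_zero, add_zero] at h1
  exact h1.trans (mul_le_mul_of_nonneg_left (hWle n) (by linarith))

namespace IsJumpField

variable (hb : IsJumpField b h L)
include hb

lemma h_nonneg (n : ℕ) : 0 ≤ h n := (hb.nonneg n 0).trans (hb.le n 0)

lemma summable_apply (a : ℕ → ℝ) : Summable fun n => b n (a n) :=
  Summable.of_nonneg_of_le (fun n => hb.nonneg n _) (fun n => hb.le n _) hb.summable

lemma isum_apply_le (a : ℕ → ℝ) (A : Set ℕ) : isum (fun n => b n (a n)) A ≤ isum h A :=
  isum_le_isum (hb.summable_apply a) hb.summable fun n _ => hb.le n _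

lemma isum_apply_nonneg (a : ℕ → ℝ) (A : Set ℕ) : 0 ≤ isum (fun n => b n (a n)) A :=
  isum_nonneg fun n _ => hb.nonneg n _

/-- Increasing coefficients make the right-hand side of the equation a monotone self-map of the
sequences with values in `[x, x + ∑ h]`. This is a complete lattice, so Knaster-Tarski provides a
fixed point without any contraction argument. -/
lemma exists_isLeftSol (τ : ℕ → ℝ) (s x : ℝ) : ∃ a, IsLeftSol τ b s x a := by
  have hH : 0 ≤ ∑' n, h n := tsum_nonneg hb.h_nonneg
  have : Fact (x ≤ x + ∑' n, h n) := ⟨by linarith⟩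
  have hmem : ∀ (a : ℕ → ℝ) (n : ℕ), x + isum (fun m => b m (a m)) (winLeft τ s (τ n)) ∈
      Icc x (x + ∑' n, h n) := fun a n =>
    ⟨by linarith [hb.isum_apply_nonneg a (winLeft τ s (τ n))], by
      linarith [hb.isum_apply_le a (winLeft τ s (τ n)),
        isum_le_tsum (A := winLeft τ s (τ n)) hb.summable hb.h_nonneg]⟩
  let Φ : (ℕ → Icc x (x + ∑' n, h n)) →o (ℕ → Icc x (x + ∑' n, h n)) :=
    { toFun := fun a n => ⟨_, hmem (fun m => (a m : ℝ)) n⟩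
      monotone' := fun a a' haa' n => by
        refine Subtype.mk_le_mk.2 (add_le_add_right (isum_le_isum (hb.summable_apply _)
          (hb.summable_apply _) fun m _ => hb.mono m (haa' m)) x) }
  refine ⟨fun n => (OrderHom.lfp Φ n : ℝ), fun n => ?_⟩
  conv_lhs => rw [← OrderHom.map_lfp Φ]
  rfl

/-- The Lipschitz bounds put the difference of two solutions under `gronwall_jump` with `δ = |x -
y|`. The case `x = y` is uniqueness; the general case gives continuity in the starting point, hence
the Feller property. -/
lemma isLeftSol_dist {s x y : ℝ} {a a' : ℕ → ℝ} (ha : IsLeftSol τ b s x a)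
    (ha' : IsLeftSol τ b s y a') (n : ℕ) :
    |a n - a' n| ≤ 2 * |x - y| * Real.exp (2 * L * ∑' k, h k) := by
  have hbd : ∀ n, |a n - a' n| ≤ |x - y| + ∑' k, h k := fun n => by
    rw [ha n, ha' n]
    have h1 := hb.isum_apply_nonneg a (winLeft τ s (τ n))
    have h2 := hb.isum_apply_nonneg a' (winLeft τ s (τ n))
    have h3 := hb.isum_apply_le a (winLeft τ s (τ n))
    have h4 := hb.isum_apply_le a' (winLeft τ s (τ n))
    have h5 := isum_le_tsum (A := winLeft τ s (τ n)) hb.summable hb.h_nonneg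
    rw [abs_le]
    constructor <;> linarith [neg_abs_le (x - y), le_abs_self (x - y)]
  refine gronwall_jump (τ := τ) (s := s) (d := fun n => |a n - a' n|) hb.summable hb.h_nonneg
    hb.const_nonneg (abs_nonneg _) (fun n => abs_nonneg _) hbd (fun n => ?_) n
  have hs : Summable fun m => L * h m * |a m - a' m| :=
    Summable.of_nonneg_of_le
      (fun k => mul_nonneg (mul_nonneg hb.const_nonneg (hb.h_nonneg k)) (abs_nonneg _))
      (fun k => mul_le_mul_of_nonneg_left (hbd k) (mul_nonneg hb.const_nonneg (hb.h_nonneg k)))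
      ((hb.summable.mul_left L).mul_right _)
  have h1 := abs_isum_sub_le (A := winLeft τ s (τ n)) (hb.summable_apply a) (hb.summable_apply a')
    hs fun m _ => hb.lip m (a m) (a' m)
  have h2 : a n - a' n = (x - y) + (isum (fun m => b m (a m)) (winLeft τ s (τ n)) -
      isum (fun m => b m (a' m)) (winLeft τ s (τ n))) := by
    rw [ha n, ha' n]; ring
  rw [h2]
  exact (abs_add_le _ _).trans (by linarith)

lemma isLeftSol_unique {s x : ℝ} {a a' : ℕ → ℝ} (ha : IsLeftSol τ b s x a)
    (ha' : IsLeftSol τ b s x a') : a = a' := by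
  ext n
  have := hb.isLeftSol_dist ha ha' n
  simp only [sub_self, abs_zero, mul_zero, zero_mul] at this
  exact sub_eq_zero.1 (abs_nonpos_iff.1 this)

end IsJumpField

open Classical in
/-- The left limits at the jump times of the solution started from `x` at time `s`. -/
noncomputable def leftSol (τ : ℕ → ℝ) (b : ℕ → ℝ → ℝ) (s x : ℝ) : ℕ → ℝ :=
  if h : ∃ a, IsLeftSol τ b s x a then h.choose else 0

/-- The value at time `t` of the solution started from `x` at time `s`. -/
noncomputable def value (τ : ℕ → ℝ) (b : ℕ → ℝ → ℝ) (s x t : ℝ) : ℝ :=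
  x + isum (fun m => b m (leftSol τ b s x m)) (win τ s t)

namespace IsJumpField

variable (hb : IsJumpField b h L)
include hb

lemma isLeftSol_leftSol (τ : ℕ → ℝ) (s x : ℝ) : IsLeftSol τ b s x (leftSol τ b s x) := by
  have hex := hb.exists_isLeftSol τ s x
  rw [leftSol, dif_pos hex]
  exact hex.choose_spec

lemma leftSol_eq {s x : ℝ} {a : ℕ → ℝ} (ha : IsLeftSol τ b s x a) : leftSol τ b s x = a :=
  hb.isLeftSol_unique (hb.isLeftSol_leftSol τ s x) ha

lemma value_lipschitz (τ : ℕ → ℝ) (s x y t : ℝ) :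
    |value τ b s x t - value τ b s y t| ≤
      (1 + L * (∑' k, h k) * (2 * Real.exp (2 * L * ∑' k, h k))) * |x - y| := by
  set C := 2 * |x - y| * Real.exp (2 * L * ∑' k, h k) with hC
  have hC0 : 0 ≤ C := by positivity
  have h1 := abs_isum_sub_le (A := win τ s t) (hb.summable_apply (leftSol τ b s x))
    (hb.summable_apply (leftSol τ b s y)) (w := fun n => L * h n * C)
    ((hb.summable.mul_left L).mul_right C) fun m _ => (hb.lip m _ _).trans
      (mul_le_mul_of_nonneg_left (hb.isLeftSol_dist (hb.isLeftSol_leftSol τ s x)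
        (hb.isLeftSol_leftSol τ s y) m) (mul_nonneg hb.const_nonneg (hb.h_nonneg m)))
  have h2 : isum (fun n => L * h n * C) (win τ s t) ≤ ∑' n, L * h n * C :=
    isum_le_tsum ((hb.summable.mul_left L).mul_right C)
      fun n => mul_nonneg (mul_nonneg hb.const_nonneg (hb.h_nonneg n)) hC0
  rw [tsum_mul_right, tsum_mul_left] at h2
  have h3 : value τ b s x t - value τ b s y t = (x - y) +
      (isum (fun m => b m (leftSol τ b s x m)) (win τ s t) -
        isum (fun m => b m (leftSol τ b s y m)) (win τ s t)) := by
    unfold value; ring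
  rw [h3]
  refine (abs_add_le _ _).trans ?_
  have h4 : (1 + L * (∑' k, h k) * (2 * Real.exp (2 * L * ∑' k, h k))) * |x - y| =
      |x - y| + L * (∑' k, h k) * C := by rw [hC]; ring
  rw [h4]
  linarith

lemma le_value (τ : ℕ → ℝ) (s x t : ℝ) : x ≤ value τ b s x t :=
  le_add_of_nonneg_right (hb.isum_apply_nonneg _ _)

lemma value_le (τ : ℕ → ℝ) (s x t : ℝ) : value τ b s x t ≤ x + isum h (win τ s t) :=
  add_le_add_right (hb.isum_apply_le _ _) x

lemma value_flow (τ : ℕ → ℝ) {s t u : ℝ} (x : ℝ) (hst : s ≤ t) (htu : t ≤ u) :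
    value τ b t (value τ b s x t) u = value τ b s x u := by
  classical
  set y := value τ b s x t with hy
  -- The old left limits are kept after `t`. A point at or before `t` has an empty left window when
  -- started from `t`, which forces the value `y` there.
  set a : ℕ → ℝ := fun n => if t < τ n then leftSol τ b s x n else y with ha
  have hcongr : ∀ A : Set ℕ, A ⊆ {n | t < τ n} →
      isum (fun m => b m (a m)) A = isum (fun m => b m (leftSol τ b s x m)) A := fun A hA =>
    isum_congr fun n hn => by
      have : t < τ n := hA hn
      simp [ha, this]
  have hsol : IsLeftSol τ b t y a := by
    intro n
    rw [hcongr _ fun m hm => hm.1]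
    by_cases hn : t < τ n
    · simp only [ha, hn, if_true]
      rw [hb.isLeftSol_leftSol τ s x n, winLeft_union hst hn,
        isum_union (hb.summable_apply _) disjoint_win_winLeft, hy, value, add_assoc]
    · have h0 : winLeft τ t (τ n) = ∅ := by
        ext m
        simp only [winLeft, mem_ofPred_eq, mem_empty_iff_false, iff_false, not_and, not_lt]
        intro hm
        linarith [not_lt.1 hn]
      simp [ha, hn, h0, isum_empty]
  rw [value, hb.leftSol_eq hsol, hcongr _ fun m hm => hm.1, hy, value, value, win_union hst htu,
    isum_union (hb.summable_apply _) disjoint_win, add_assoc]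

end IsJumpField

/-! ### The Euler scheme -/

/-- The Euler scheme with step `δ` for the jump equation started from `x` at time `s`. -/
noncomputable def eulerReal (τ : ℕ → ℝ) (b : ℕ → ℝ → ℝ) (s δ x : ℝ) : ℕ → ℝ
  | 0 => x
  | j + 1 => eulerReal τ b s δ x j +
      isum (fun n => b n (eulerReal τ b s δ x j)) (win τ (s + j * δ) (s + (j + 1) * δ))

namespace IsJumpField

variable (hb : IsJumpField b h L)
include hb

/-- At a point inside a step, the frozen value misses the true left limit by at most the error at
the start of the step plus the mass of `h` since then. That mass is dominated by the mass on the
window of length `δ` before the point, which no longer refers to the grid. The factors `1 + L * H₂`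
accumulate into the exponential. -/
lemma abs_eulerReal_sub_value_le (τ : ℕ → ℝ) (s x : ℝ) {δ : ℝ} (hδ : 0 ≤ δ) (j : ℕ) :
    |eulerReal τ b s δ x j - value τ b s x (s + j * δ)| ≤
      Real.exp (L * isum h (win τ s (s + j * δ))) *
        isum (fun n => L * h n * isum h (winLeft τ (τ n - δ) (τ n))) (win τ s (s + j * δ)) := by
  set w : ℕ → ℝ := fun n => isum h (winLeft τ (τ n - δ) (τ n)) with hw
  have hw0 : ∀ n, 0 ≤ w n := fun n => isum_nonneg fun m _ => hb.h_nonneg m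
  have hLh : ∀ n, 0 ≤ L * h n := fun n => mul_nonneg hb.const_nonneg (hb.h_nonneg n)
  have hws : Summable fun n => L * h n * w n :=
    Summable.of_nonneg_of_le (fun n => mul_nonneg (hLh n) (hw0 n))
      (fun n => mul_le_mul_of_nonneg_left (isum_le_tsum hb.summable hb.h_nonneg) (hLh n))
      ((hb.summable.mul_left L).mul_right _)
  induction j with
  | zero =>
    have : win τ s s = ∅ := by
      ext n
      simp only [win, mem_ofPred_eq, mem_empty_iff_false, iff_false, not_and, not_le]
      exact id
    simp [eulerReal, value, this, isum_empty]
  | succ j ih =>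
    push_cast
    set t := s + j * δ with ht
    set t' := s + (j + 1) * δ with ht'
    have hst : s ≤ t := by have : 0 ≤ j * δ := by positivity
                           linarith
    have htt' : t ≤ t' := by rw [ht, ht']; linarith
    set e := eulerReal τ b s δ x j with he
    set V := value τ b s x t with hV
    set a := leftSol τ b s x with ha
    have hval : value τ b s x t' = V + isum (fun m => b m (a m)) (win τ t t') := by
      rw [hV, value, value, win_union hst htt', isum_union (hb.summable_apply _) disjoint_win,
        add_assoc]
    have heul : eulerReal τ b s δ x (j + 1) = e + isum (fun n => b n e) (win τ t t') := rfl
    have hleft : ∀ n ∈ win τ t t', |e - a n| ≤ |e - V| + w n := by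
      intro n hn
      have h1 : a n = V + isum (fun m => b m (a m)) (winLeft τ t (τ n)) := by
        rw [ha, hb.isLeftSol_leftSol τ s x n, winLeft_union hst hn.1,
          isum_union (hb.summable_apply _) disjoint_win_winLeft, hV, value, add_assoc]
      have h2 : isum (fun m => b m (a m)) (winLeft τ t (τ n)) ≤ w n := by
        refine (hb.isum_apply_le _ _).trans (isum_mono_set hb.summable hb.h_nonneg ?_)
        intro m hm
        have h3 := hn.2
        have h4 := hm.1
        have : t' = t + δ := by rw [ht, ht']; ring
        exact ⟨by linarith, hm.2⟩
      have h3 := hb.isum_apply_nonneg a (winLeft τ t (τ n))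
      have h4 : e - a n = (e - V) - isum (fun m => b m (a m)) (winLeft τ t (τ n)) := by
        rw [h1]; ring
      rw [h4]
      refine (abs_sub _ _).trans ?_
      rw [abs_of_nonneg h3]
      linarith
    have hsum : Summable fun n => L * h n * |e - V| + L * h n * w n :=
      ((hb.summable.mul_left L).mul_right _).add hws
    have hdiff : |isum (fun n => b n e) (win τ t t') - isum (fun m => b m (a m)) (win τ t t')| ≤
        L * isum h (win τ t t') * |e - V| + isum (fun n => L * h n * w n) (win τ t t') := by
      refine (abs_isum_sub_le (hb.summable_apply fun _ => e) (hb.summable_apply a) hsum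
        fun n hn => (hb.lip n e (a n)).trans ?_).trans (le_of_eq ?_)
      · rw [← mul_add]
        exact mul_le_mul_of_nonneg_left (hleft n hn) (hLh n)
      · rw [isum_add ((hb.summable.mul_left L).mul_right _) hws]
        congr 1
        rw [← isum_mul_left, mul_comm, ← isum_mul_left]
        exact isum_congr fun n _ => by ring
    have hH : isum h (win τ s t') = isum h (win τ s t) + isum h (win τ t t') := by
      rw [win_union hst htt', isum_union hb.summable disjoint_win]
    have hR : isum (fun n => L * h n * w n) (win τ s t') =
        isum (fun n => L * h n * w n) (win τ s t) + isum (fun n => L * h n * w n) (win τ t t') := by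
      rw [win_union hst htt', isum_union hws disjoint_win]
    set H₁ := isum h (win τ s t)
    set H₂ := isum h (win τ t t')
    set R₁ := isum (fun n => L * h n * w n) (win τ s t)
    set R₂ := isum (fun n => L * h n * w n) (win τ t t')
    have hH1 : 0 ≤ L * H₁ := mul_nonneg hb.const_nonneg (isum_nonneg fun m _ => hb.h_nonneg m)
    have hH2 : 0 ≤ L * H₂ := mul_nonneg hb.const_nonneg (isum_nonneg fun m _ => hb.h_nonneg m)
    have hR2 : 0 ≤ R₂ := isum_nonneg fun n _ => mul_nonneg (hLh n) (hw0 n)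
    have hR1 : 0 ≤ R₁ := isum_nonneg fun n _ => mul_nonneg (hLh n) (hw0 n)
    rw [heul, hval, hH, hR, mul_add L, Real.exp_add]
    have h0 : |e + isum (fun n => b n e) (win τ t t') -
        (V + isum (fun m => b m (a m)) (win τ t t'))| ≤
        |e - V| + (L * H₂ * |e - V| + R₂) := by
      have : e + isum (fun n => b n e) (win τ t t') - (V + isum (fun m => b m (a m)) (win τ t t'))
        = (e - V) + (isum (fun n => b n e) (win τ t t') -
            isum (fun m => b m (a m)) (win τ t t')) := by ring
      rw [this]
      exact (abs_add_le _ _).trans (add_le_add_right hdiff _)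
    refine h0.trans ?_
    have e1 := Real.add_one_le_exp (L * H₂)
    have e2 : 1 ≤ Real.exp (L * H₁) := Real.one_le_exp hH1
    have e3 : 1 ≤ Real.exp (L * H₁) * Real.exp (L * H₂) :=
      one_le_mul_of_one_le_of_one_le e2 (Real.one_le_exp hH2)
    calc |e - V| + (L * H₂ * |e - V| + R₂) = (L * H₂ + 1) * |e - V| + R₂ := by ring
      _ ≤ Real.exp (L * H₂) * (Real.exp (L * H₁) * R₁) +
          Real.exp (L * H₁) * Real.exp (L * H₂) * R₂ :=
        add_le_add (mul_le_mul e1 ih (abs_nonneg _) (Real.exp_nonneg _))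
          (le_mul_of_one_le_left hR2 e3)
      _ = Real.exp (L * H₁) * Real.exp (L * H₂) * (R₁ + R₂) := by ring

/-- The windows `(τ n - δ, τ n)` in the error bound shrink to the empty set as `δ → 0`, for each
`n`. Dominated convergence, applied to the inner and then to the outer sum, does the rest, even with
dense jump times. -/
lemma tendsto_eulerReal (τ : ℕ → ℝ) {s t : ℝ} (x : ℝ) (hst : s ≤ t) :
    Tendsto (fun m : ℕ => eulerReal τ b s ((t - s) / (m + 1)) x (m + 1)) atTop
      (𝓝 (value τ b s x t)) := by
  have hLh : ∀ n, 0 ≤ L * h n := fun n => mul_nonneg hb.const_nonneg (hb.h_nonneg n)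
  set w : ℝ → ℕ → ℝ := fun δ n => isum h (winLeft τ (τ n - δ) (τ n)) with hw
  have hw0 : ∀ δ n, 0 ≤ w δ n := fun δ n => isum_nonneg fun m _ => hb.h_nonneg m
  have hwle : ∀ δ n, L * h n * w δ n ≤ L * h n * ∑' k, h k := fun δ n =>
    mul_le_mul_of_nonneg_left (isum_le_tsum hb.summable hb.h_nonneg) (hLh n)
  have hws : ∀ δ, Summable fun n => L * h n * w δ n := fun δ =>
    Summable.of_nonneg_of_le (fun n => mul_nonneg (hLh n) (hw0 δ n)) (hwle δ)
      ((hb.summable.mul_left L).mul_right _)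
  set δ : ℕ → ℝ := fun m => (t - s) / (m + 1) with hδ
  have hδ0 : ∀ m, 0 ≤ δ m := fun m => div_nonneg (by linarith) (by positivity)
  have hδlim : Tendsto δ atTop (𝓝 0) := by
    have := tendsto_one_div_add_atTop_nhds_zero_nat (𝕜 := ℝ) |>.const_mul (t - s)
    simpa [hδ, div_eq_mul_inv] using this
  have hlim : Tendsto (fun m => ∑' n, L * h n * w (δ m) n) atTop (𝓝 (∑' n, L * h n * 0)) := by
    refine tendsto_tsum_of_dominated_convergence ((hb.summable.mul_left L).mul_right (∑' k, h k))
      (fun n => Tendsto.const_mul _ ?_) (Eventually.of_forall fun m n => ?_)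
    · have h1 : Tendsto (fun m => w (δ m) n) atTop (𝓝 (isum h ∅)) := by
        refine tendsto_isum hb.summable hb.h_nonneg fun k => ?_
        by_cases hk : τ k < τ n
        · have h2 : ∀ᶠ m in atTop, δ m < τ n - τ k :=
            hδlim.eventually (gt_mem_nhds (by linarith))
          filter_upwards [h2] with m hm
          simp only [winLeft, mem_ofPred_eq, mem_empty_iff_false, iff_false, not_and, not_lt]
          intro h3
          linarith
        · refine Eventually.of_forall fun m => ?_
          simp [winLeft, not_lt.1 hk]
      rwa [isum_empty] at h1
    · rw [Real.norm_of_nonneg (mul_nonneg (hLh n) (hw0 _ n))]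
      exact hwle _ n
  simp only [mul_zero, tsum_zero] at hlim
  rw [tendsto_iff_dist_tendsto_zero]
  refine squeeze_zero (fun _ => dist_nonneg) (fun m => ?_)
    (by simpa using hlim.const_mul (Real.exp (L * ∑' k, h k)))
  have h1 := hb.abs_eulerReal_sub_value_le τ s x (hδ0 m) (m + 1)
  have h2 : s + ((m + 1 : ℕ) : ℝ) * δ m = t := by
    rw [hδ]
    push_cast
    field_simp
    ring
  rw [h2] at h1
  rw [Real.dist_eq]
  refine h1.trans (mul_le_mul (Real.exp_le_exp.2 (mul_le_mul_of_nonneg_left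
    (isum_le_tsum hb.summable hb.h_nonneg) hb.const_nonneg))
    (isum_le_tsum (hws _) fun n => mul_nonneg (hLh n) (hw0 _ n))
    (isum_nonneg fun n _ => mul_nonneg (hLh n) (hw0 _ n)) (Real.exp_nonneg _))

end IsJumpField

/-! ### One-sided limits of jump sums -/

section OneSided

variable {u : ℕ → ℝ} (hu : Summable u) (h0 : ∀ n, 0 ≤ u n)
include hu h0

lemma tendsto_isum_win_right (τ : ℕ → ℝ) (s t : ℝ) :
    Tendsto (fun r => isum u (win τ s r)) (𝓝[≥] t) (𝓝 (isum u (win τ s t))) := by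
  refine tendsto_isum hu h0 fun n => ?_
  by_cases hn : τ n ≤ t
  · filter_upwards [self_mem_nhdsWithin] with r hr
    simp [win, hn, hn.trans hr]
  · have : ∀ᶠ r in 𝓝[≥] t, r < τ n :=
      mem_nhdsWithin_of_mem_nhds (gt_mem_nhds (not_le.1 hn))
    filter_upwards [this] with r hr
    simp [win, hn, not_le.2 hr]

lemma tendsto_isum_win_left (τ : ℕ → ℝ) (s t : ℝ) :
    Tendsto (fun r => isum u (win τ s r)) (𝓝[<] t) (𝓝 (isum u (winLeft τ s t))) := by
  refine tendsto_isum hu h0 fun n => ?_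
  by_cases hn : τ n < t
  · have : ∀ᶠ r in 𝓝[<] t, τ n < r := mem_nhdsWithin_of_mem_nhds (lt_mem_nhds hn)
    filter_upwards [this] with r hr
    simp [win, winLeft, hn, hr.le]
  · filter_upwards [self_mem_nhdsWithin] with r hr
    have : r < τ n := lt_of_lt_of_le hr (not_lt.1 hn)
    simp [win, winLeft, hn, not_le.2 this]

end OneSided

end Pathwise

/-! ### Estimates for the jump size -/

section JumpSize

/-- The function dominating all jump sizes and their Lipschitz constants. -/
noncomputable def wt (ε z : ℝ) : ℝ := (1 + z) ^ (-(1 + ε / 2))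

variable {ε : ℝ}

lemma wt_pos {z : ℝ} (hz : 0 ≤ z) : 0 < wt ε z := Real.rpow_pos_of_pos (by linarith) _

lemma wt_nonneg {z : ℝ} (hz : 0 ≤ z) : 0 ≤ wt ε z := (wt_pos hz).le

lemma wt_le_one (hε : 0 < ε) {z : ℝ} (hz : 0 ≤ z) : wt ε z ≤ 1 :=
  Real.rpow_le_one_of_one_le_of_nonpos (by linarith) (by linarith)

@[fun_prop]
lemma measurable_wt : Measurable (wt ε) := by unfold wt; fun_prop

lemma G_pos {β z : ℝ} (hz : 0 ≤ z) : 0 < G β z := Real.rpow_pos_of_pos (by linarith) _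

/-- Because `(1 + ε) * (1 - ε) ≤ 1`. Keeping `γ` away from `1` is what makes the jumps summable. -/
lemma neg_one_div_le (hε : 0 < ε) {β : ℝ} (hβ : β ∈ Icc ε (1 - ε)) : -1 / β ≤ -(1 + ε) := by
  have hβ0 : 0 < β := hε.trans_le hβ.1
  rw [div_le_iff₀ hβ0]
  have := hβ.2
  nlinarith

lemma G_le_wt (hε : 0 < ε) {β z : ℝ} (hβ : β ∈ Icc ε (1 - ε)) (hz : 0 ≤ z) : G β z ≤ wt ε z :=
  Real.rpow_le_rpow_of_exponent_le (by linarith) (by linarith [neg_one_div_le hε hβ])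

lemma G_mono {β β' z : ℝ} (hβ : 0 < β) (h : β ≤ β') (hz : 0 ≤ z) : G β z ≤ G β' z := by
  refine Real.rpow_le_rpow_of_exponent_le (by linarith) ?_
  rw [neg_div, neg_div]
  exact neg_le_neg (one_div_le_one_div_of_le hβ h)

/-- Varying the exponent of `1 + z` costs a factor `log (1 + z)`. Half of the spare decay `ε`
absorbs this logarithm, through `l * exp (-l * ε / 2) ≤ 2 / ε`, and the other half remains in `wt`.
The further `ε⁻²` comes from the difference of `1 / β` and `1 / β'`. -/
lemma G_sub_le_of_le (hε : 0 < ε) {β β' z : ℝ} (hβ : β ∈ Icc ε (1 - ε)) (hβ' : β' ∈ Icc ε (1 - ε))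
    (h : β ≤ β') (hz : 0 ≤ z) : G β' z - G β z ≤ 2 / ε ^ 3 * wt ε z * (β' - β) := by
  have hβ0 : 0 < β := hε.trans_le hβ.1
  have hβ0' : 0 < β' := hε.trans_le hβ'.1
  set l := Real.log (1 + z) with hl
  have hl0 : 0 ≤ l := Real.log_nonneg (by linarith)
  have hexp : ∀ p : ℝ, (1 + z) ^ p = Real.exp (l * p) := fun p =>
    Real.rpow_def_of_pos (by linarith) p
  set p := -1 / β' with hp
  set p' := -1 / β with hp'
  have hpp : p - p' = (β' - β) / (β * β') := by rw [hp, hp']; field_simp; ring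
  have hpp1 : p - p' ≤ (β' - β) / ε ^ 2 := by
    rw [hpp, sq]
    exact div_le_div_of_nonneg_left (by linarith) (by positivity)
      (mul_le_mul hβ.1 hβ'.1 hε.le hβ0.le)
  have hpp0 : 0 ≤ p - p' := by
    rw [hpp]; exact div_nonneg (by linarith) (by positivity)
  have hG : G β' z - G β z ≤ Real.exp (l * p) * (l * (p - p')) := by
    unfold G
    rw [hexp, hexp]
    have h1 : Real.exp (l * p') = Real.exp (l * p) * Real.exp (-(l * (p - p'))) := by
      rw [← Real.exp_add]; congr 1; ring
    have h2 := Real.one_sub_le_exp_neg (l * (p - p'))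
    have h3 := Real.exp_pos (l * p)
    rw [h1]
    nlinarith
  have h4 : Real.exp (l * p) ≤ Real.exp (l * (-(1 + ε))) :=
    Real.exp_le_exp.2 (mul_le_mul_of_nonneg_left (neg_one_div_le hε hβ') hl0)
  have h5 : l * Real.exp (l * (-(1 + ε))) ≤ 2 / ε * wt ε z := by
    have h6 : l * (ε / 2) ≤ Real.exp (l * (ε / 2)) := by
      linarith [Real.add_one_le_exp (l * (ε / 2))]
    have h7 : Real.exp (l * (-(1 + ε))) = Real.exp (-(l * (ε / 2))) * wt ε z := by
      unfold wt
      rw [hexp, ← Real.exp_add]; congr 1; ring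
    have h8 : Real.exp (l * (ε / 2)) * Real.exp (-(l * (ε / 2))) = 1 := by
      rw [← Real.exp_add]; simp
    have h9 : l * Real.exp (-(l * (ε / 2))) ≤ 2 / ε := by
      rw [le_div_iff₀ hε]
      nlinarith [mul_le_mul_of_nonneg_right h6 (Real.exp_pos (-(l * (ε / 2)))).le]
    rw [h7, ← mul_assoc]
    exact mul_le_mul_of_nonneg_right h9 (wt_nonneg hz)
  calc G β' z - G β z ≤ Real.exp (l * p) * (l * (p - p')) := hG
    _ ≤ Real.exp (l * (-(1 + ε))) * (l * (p - p')) :=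
      mul_le_mul_of_nonneg_right h4 (mul_nonneg hl0 hpp0)
    _ = (l * Real.exp (l * (-(1 + ε)))) * (p - p') := by ring
    _ ≤ (2 / ε * wt ε z) * ((β' - β) / ε ^ 2) :=
      mul_le_mul h5 hpp1 hpp0 (mul_nonneg (by positivity) (wt_nonneg hz))
    _ = 2 / ε ^ 3 * wt ε z * (β' - β) := by field_simp

lemma abs_G_sub_le (hε : 0 < ε) {β β' z : ℝ} (hβ : β ∈ Icc ε (1 - ε)) (hβ' : β' ∈ Icc ε (1 - ε))
    (hz : 0 ≤ z) : |G β z - G β' z| ≤ 2 / ε ^ 3 * wt ε z * |β - β'| := by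
  rcases le_total β β' with h | h
  · rw [abs_sub_comm, abs_sub_comm β,
      abs_of_nonneg (by linarith [G_mono (hε.trans_le hβ.1) h hz]),
      abs_of_nonneg (sub_nonneg.2 h)]
    exact G_sub_le_of_le hε hβ hβ' h hz
  · rw [abs_of_nonneg (by linarith [G_mono (hε.trans_le hβ'.1) h hz]),
      abs_of_nonneg (sub_nonneg.2 h)]
    exact G_sub_le_of_le hε hβ' hβ h hz

/-- The jump coefficients attached to the marks `z n`. -/
noncomputable def coeff (γ : ℝ≥0 → ℝ) (z : ℕ → ℝ) (n : ℕ) (x : ℝ) : ℝ := G (γ x.toNNReal) (z n)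

/-- Quantitative form of the standing assumption on `γ`. -/
structure HypWith (γ : ℝ≥0 → ℝ) (ε : ℝ) (K : ℝ≥0) : Prop where
  pos : 0 < ε
  bounds : ∀ y, γ y ∈ Icc ε (1 - ε)
  lipschitz : LipschitzWith K γ
  mono : Monotone γ

variable {γ : ℝ≥0 → ℝ} {K : ℝ≥0}

lemma HypWith.abs_sub_le (hγ : HypWith γ ε K) {z : ℝ} (hz : 0 ≤ z) (x y : ℝ) :
    |G (γ x.toNNReal) z - G (γ y.toNNReal) z| ≤ 2 / ε ^ 3 * K * wt ε z * |x - y| := by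
  refine (abs_G_sub_le hγ.pos (hγ.bounds _) (hγ.bounds _) hz).trans ?_
  have h1 : |γ x.toNNReal - γ y.toNNReal| ≤ K * |x - y| := by
    have := hγ.lipschitz.dist_le_mul x.toNNReal y.toNNReal
    rw [Real.dist_eq, NNReal.dist_eq] at this
    refine this.trans (mul_le_mul_of_nonneg_left ?_ K.2)
    simp only [Real.coe_toNNReal']
    exact abs_max_sub_max_le_abs x y 0
  have h2 : 0 ≤ 2 / ε ^ 3 * wt ε z := by
    have := hγ.pos
    have := wt_nonneg (ε := ε) hz
    positivity
  calc _ ≤ 2 / ε ^ 3 * wt ε z * (K * |x - y|) := mul_le_mul_of_nonneg_left h1 h2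
    _ = _ := by ring

lemma HypWith.isJumpField (hγ : HypWith γ ε K) {z : ℕ → ℝ} (hz : ∀ n, 0 ≤ z n)
    (hs : Summable fun n => wt ε (z n)) :
    IsJumpField (coeff γ z) (fun n => wt ε (z n)) (2 / ε ^ 3 * K) where
  summable := hs
  const_nonneg := by have := hγ.pos; positivity
  nonneg n x := (G_pos (hz n)).le
  le n x := G_le_wt hγ.pos (hγ.bounds _) (hz n)
  mono n x y hxy := G_mono (hγ.pos.trans_le (hγ.bounds _).1)
    (hγ.mono (Real.toNNReal_le_toNNReal hxy)) (hz n)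
  lip n x y := hγ.abs_sub_le (hz n) x y

end JumpSize

/-! ### The flow driven by a point measure -/

section Flow

/-- Time-mark slab `(a, b] × [0, ∞)`. -/
def slab (a b : ℝ) : Set (I × ℝ) := {p | (a < p.1 ∧ (p.1 : ℝ) ≤ b) ∧ 0 ≤ p.2}

lemma measurableSet_slab (a b : ℝ) : MeasurableSet (slab a b) := by
  have h1 : Measurable fun p : I × ℝ => (p.1 : ℝ) := measurable_subtype_coe.comp measurable_fst
  exact ((measurableSet_lt measurable_const h1).inter
    (measurableSet_le h1 measurable_const)).inter (measurableSet_le measurable_const measurable_snd)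

/-- Increment over `(a, b]` of the Euler scheme frozen at `x`. -/
noncomputable def jumpIncr (γ : ℝ≥0 → ℝ) (ν : Measure (I × ℝ)) (a b : ℝ) (x : ℝ≥0) : ℝ≥0 :=
  (∫⁻ p in slab a b, ENNReal.ofReal (G (γ x) p.2) ∂ν).toNNReal

/-- The Euler scheme driven by the measure `ν`. -/
noncomputable def euler (γ : ℝ≥0 → ℝ) (ν : Measure (I × ℝ)) (s δ : ℝ) (x : ℝ≥0) : ℕ → ℝ≥0
  | 0 => x
  | j + 1 => euler γ ν s δ x j +
      jumpIncr γ ν (s + j * δ) (s + (j + 1) * δ) (euler γ ν s δ x j)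

/-- The flow of the jump equation driven by the measure `ν`: the limit of Euler schemes. -/
noncomputable def flow (γ : ℝ≥0 → ℝ) (ν : Measure (I × ℝ)) (s t : ℝ) (x : ℝ≥0) : ℝ≥0 :=
  -- A limsup in `[0, ∞]` makes sense and is measurable for arbitrary `ν`; on good paths it is a
  -- finite limit. There are `m + 1` steps, so the step size never divides by zero.
  (limsup (fun m : ℕ => (euler γ ν s ((t - s) / (m + 1)) x (m + 1) : ℝ≥0∞)) atTop).toNNReal

lemma euler_congr {γ : ℝ≥0 → ℝ} {ν ν' : Measure (I × ℝ)} {s δ : ℝ} {x : ℝ≥0} {m : ℕ}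
    (h : ∀ j < m, ν.restrict (slab (s + j * δ) (s + (j + 1) * δ)) =
      ν'.restrict (slab (s + j * δ) (s + (j + 1) * δ))) :
    euler γ ν s δ x m = euler γ ν' s δ x m := by
  induction m with
  | zero => rfl
  | succ m ih =>
    rw [euler, euler, ih fun j hj => h j (hj.trans (Nat.lt_succ_self m)), jumpIncr, jumpIncr,
      h m (Nat.lt_succ_self m)]

lemma slab_step_subset {s t : ℝ} (hst : s ≤ t) {m j : ℕ} (hj : j < m + 1) :
    slab (s + j * ((t - s) / (m + 1))) (s + (j + 1) * ((t - s) / (m + 1))) ⊆ slab s t := by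
  intro p hp
  have hd : 0 ≤ (t - s) / (m + 1 : ℝ) := div_nonneg (by linarith) (by positivity)
  have h1 : 0 ≤ j * ((t - s) / (m + 1 : ℝ)) := by positivity
  have h2 : ((j : ℝ) + 1) * ((t - s) / (m + 1)) ≤ (m + 1) * ((t - s) / (m + 1)) :=
    mul_le_mul_of_nonneg_right (by exact_mod_cast hj) hd
  have h3 : ((m : ℝ) + 1) * ((t - s) / (m + 1)) = t - s := by field_simp
  exact ⟨⟨by linarith [hp.1.1], by linarith [hp.1.2]⟩, hp.2⟩

/-- This locality in time is the source of adaptedness to the unaugmented filtration and of the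
independence of the future flow from the past. -/
lemma flow_congr {γ : ℝ≥0 → ℝ} {ν ν' : Measure (I × ℝ)} {s t : ℝ} (hst : s ≤ t) (x : ℝ≥0)
    (h : ν.restrict (slab s t) = ν'.restrict (slab s t)) : flow γ ν s t x = flow γ ν' s t x := by
  unfold flow
  congr 2
  ext m
  congr 1
  refine euler_congr fun j hj => ?_
  have hsub := slab_step_subset hst hj
  rw [← Measure.restrict_restrict_of_subset hsub, h, Measure.restrict_restrict_of_subset hsub]

lemma flow_restrict {γ : ℝ≥0 → ℝ} {ν : Measure (I × ℝ)} {s t : ℝ} (hst : s ≤ t) (x : ℝ≥0)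
    {C : Set (I × ℝ)} (hC : slab s t ⊆ C) : flow γ (ν.restrict C) s t x = flow γ ν s t x :=
  flow_congr hst x (Measure.restrict_restrict_of_subset hC)

variable {Ω : Type*} {T : ℕ → Ω → I} {Y : ℕ → Ω → ℝ}

lemma setLIntegral_N (ω : Ω) {C : Set (I × ℝ)} (hC : MeasurableSet C) (F : I × ℝ → ℝ≥0∞) :
    ∫⁻ p in C, F p ∂N T Y ω = ∑' n, C.indicator F (T n ω, Z Y n ω) := by
  rw [← lintegral_indicator hC, N, lintegral_sum_measure]
  simp only [lintegral_dirac]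

/-- The properties of the driving sequences that hold almost surely and make the equation
solvable path by path. -/
structure GoodPath (ε : ℝ) (T : ℕ → I) (z : ℕ → ℝ) : Prop where
  nonneg : ∀ n, 0 ≤ z n
  summable : Summable fun n => wt ε (z n)
  pos : ∀ n, 0 < T n
  dense : Dense (range T)

variable {γ : ℝ≥0 → ℝ} {ε : ℝ} {K : ℝ≥0} {ω : Ω}

lemma setLIntegral_slab_N (hz : ∀ n, 0 ≤ Z Y n ω) {F : I × ℝ → ℝ} {u : ℕ → ℝ}
    (hF : ∀ n, F (T n ω, Z Y n ω) = u n) (hu0 : ∀ n, 0 ≤ u n) (hu : Summable u) (a b : ℝ) :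
    ∫⁻ p in slab a b, ENNReal.ofReal (F p) ∂N T Y ω =
      ENNReal.ofReal (isum u (win (fun n => (T n ω : ℝ)) a b)) := by
  classical
  rw [setLIntegral_N ω (measurableSet_slab a b), isum,
    ENNReal.ofReal_tsum_of_nonneg (fun n => Set.indicator_nonneg (fun m _ => hu0 m) n)
      (hu.indicator _)]
  congr 1
  ext n
  by_cases hn : n ∈ win (fun n => (T n ω : ℝ)) a b
  · have : (T n ω, Z Y n ω) ∈ slab a b := ⟨hn, hz n⟩
    rw [Set.indicator_of_mem hn, Set.indicator_of_mem this, hF]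
  · have : (T n ω, Z Y n ω) ∉ slab a b := fun h => hn h.1
    rw [Set.indicator_of_notMem hn, Set.indicator_of_notMem this, ENNReal.ofReal_zero]

/-- The times of the points of a path, as real numbers. -/
def times (T : ℕ → Ω → I) (ω : Ω) (n : ℕ) : ℝ := T n ω

/-- The marks of a path. -/
noncomputable def marks (Y : ℕ → Ω → ℝ) (ω : Ω) (n : ℕ) : ℝ := Z Y n ω

section

variable (hγ : HypWith γ ε K) (hω : GoodPath ε (fun n => T n ω) (marks Y ω))
include hγ hω

lemma field_of_good : IsJumpField (coeff γ (marks Y ω)) (fun n => wt ε (marks Y ω n))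
    (2 / ε ^ 3 * K) := hγ.isJumpField hω.nonneg hω.summable

lemma coe_jumpIncr (a b : ℝ) (x : ℝ≥0) :
    (jumpIncr γ (N T Y ω) a b x : ℝ) =
      isum (fun n => coeff γ (marks Y ω) n x) (win (times T ω) a b) := by
  have hb := field_of_good hγ hω
  have hnn : 0 ≤ isum (fun n => coeff γ (marks Y ω) n x) (win (times T ω) a b) :=
    hb.isum_apply_nonneg (fun _ => (x : ℝ)) _
  rw [jumpIncr, setLIntegral_slab_N (F := fun p => G (γ x) p.2) hω.nonneg
    (u := fun n => coeff γ (marks Y ω) n x) (fun n => by simp [coeff, marks])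
    (fun n => hb.nonneg n _) (hb.summable_apply fun _ => (x : ℝ))]
  exact ENNReal.toReal_ofReal hnn

lemma coe_euler (s δ : ℝ) (x : ℝ≥0) (j : ℕ) :
    (euler γ (N T Y ω) s δ x j : ℝ) =
      eulerReal (times T ω) (coeff γ (marks Y ω)) s δ x j := by
  induction j with
  | zero => rfl
  | succ j ih => rw [euler, eulerReal, NNReal.coe_add, coe_jumpIncr hγ hω, ih]

/-- Bridge between the two descriptions: the measurable functional `flow` agrees on good paths with
the fixed-point solution, since the Euler schemes converge to the latter. -/
lemma coe_flow {s t : ℝ} (hst : s ≤ t) (x : ℝ≥0) :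
    (flow γ (N T Y ω) s t x : ℝ) = value (times T ω) (coeff γ (marks Y ω)) s x t := by
  have hb := field_of_good hγ hω
  have h1 := hb.tendsto_eulerReal (times T ω) (x : ℝ) hst
  simp only [← coe_euler hγ hω] at h1
  have h0 : 0 ≤ value (times T ω) (coeff γ (marks Y ω)) s x t :=
    x.2.trans (hb.le_value _ _ _ _)
  lift value (times T ω) (coeff γ (marks Y ω)) s x t to ℝ≥0 using h0 with v
  rw [NNReal.tendsto_coe, ← ENNReal.tendsto_coe] at h1
  rw [flow, h1.limsup_eq, ENNReal.toNNReal_coe]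

lemma flow_flow {s t u : ℝ} (x : ℝ≥0) (hst : s ≤ t) (htu : t ≤ u) :
    flow γ (N T Y ω) t u (flow γ (N T Y ω) s t x) = flow γ (N T Y ω) s u x := by
  apply NNReal.coe_injective
  rw [coe_flow hγ hω htu, coe_flow hγ hω hst, coe_flow hγ hω (hst.trans htu)]
  exact (field_of_good hγ hω).value_flow _ _ hst htu

lemma continuous_flow {s t : ℝ} (hst : s ≤ t) : Continuous (flow γ (N T Y ω) s t) := by
  have hb := field_of_good hγ hω
  have h1 : ∀ x y, dist (flow γ (N T Y ω) s t x) (flow γ (N T Y ω) s t y) ≤ _ * dist x y :=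
    fun x y => by
      rw [NNReal.dist_eq, NNReal.dist_eq, coe_flow hγ hω hst, coe_flow hγ hω hst]
      exact hb.value_lipschitz _ _ _ _ _
  exact (LipschitzWith.of_dist_le' h1).continuous

lemma flow_le {s t : ℝ} (hst : s ≤ t) (x : ℝ≥0) :
    (flow γ (N T Y ω) s t x : ℝ) ≤ x + isum (fun n => wt ε (marks Y ω n)) (win (times T ω) s t) := by
  rw [coe_flow hγ hω hst]
  exact (field_of_good hγ hω).value_le _ _ _ _

lemma continuousWithinAt_flow {s t : ℝ} (hst : s ≤ t) (x : ℝ≥0) :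
    Tendsto (fun r => flow γ (N T Y ω) s r x) (𝓝[≥] t) (𝓝 (flow γ (N T Y ω) s t x)) := by
  have hb := field_of_good hγ hω
  rw [← NNReal.tendsto_coe, coe_flow hγ hω hst]
  have h1 := (tendsto_isum_win_right (hb.summable_apply
    (leftSol (times T ω) (coeff γ (marks Y ω)) s x)) (fun n => hb.nonneg n _)
    (times T ω) s t).const_add (x : ℝ)
  refine h1.congr' ?_
  filter_upwards [self_mem_nhdsWithin] with r hr
  rw [coe_flow hγ hω (hst.trans hr), value]

end

end Flow

/-! ### Properties of the solution along a good path -/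

section GoodSolution

variable {Ω : Type*} {T : ℕ → Ω → I} {Y : ℕ → Ω → ℝ}
variable {γ : ℝ≥0 → ℝ} {ε : ℝ} {K : ℝ≥0} {ω : Ω}

lemma tendsto_coe_nhdsLT (t : I) : Tendsto ((↑) : I → ℝ) (𝓝[<] t) (𝓝[<] (t : ℝ)) :=
  continuous_subtype_val.continuousWithinAt.tendsto_nhdsWithin fun _ h => h

lemma tendsto_coe_nhdsGE (t : I) : Tendsto ((↑) : I → ℝ) (𝓝[≥] t) (𝓝[≥] (t : ℝ)) :=
  continuous_subtype_val.continuousWithinAt.tendsto_nhdsWithin fun _ h => h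

lemma leftLim_of_jumpSum {u : ℕ → ℝ} (hu : Summable u) (h0 : ∀ n, 0 ≤ u n) (τ : ℕ → ℝ)
    {f : I → ℝ≥0} (hf : ∀ t : I, (f t : ℝ) = isum u (win τ 0 t)) (t : I) :
    Tendsto f (𝓝[<] t) (𝓝 (Function.leftLim f t)) ∧
      ((Function.leftLim f t : ℝ≥0) : ℝ) = isum u (winLeft τ 0 t) := by
  have hnn : 0 ≤ isum u (winLeft τ 0 t) := isum_nonneg fun n _ => h0 n
  have h1 : Tendsto f (𝓝[<] t) (𝓝 (isum u (winLeft τ 0 t)).toNNReal) := by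
    rw [← NNReal.tendsto_coe, Real.coe_toNNReal _ hnn]
    simp only [hf]
    exact (tendsto_isum_win_left hu h0 τ 0 t).comp (tendsto_coe_nhdsLT t)
  -- In `I` only `t = 0` has nothing to its left. There `Function.leftLim` is `f 0` by convention,
  -- and the windows `(0, 0]` and `(0, 0)` are both empty.
  by_cases hbot : 𝓝[<] t = ⊥
  · have ht : t = 0 := by
      by_contra hne
      have hpos : 0 < t := unitInterval.pos_iff_ne_zero.2 hne
      have : (𝓝[<] t).NeBot := nhdsLT_neBot_of_exists_lt ⟨0, hpos⟩
      exact this.ne hbot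
    refine ⟨by simp [hbot], ?_⟩
    rw [leftLim_eq_of_eq_bot f hbot, hf, ht]
    congr 1
    ext n
    simp only [win, winLeft, mem_ofPred_eq, Icc.coe_zero]
    constructor
    · rintro ⟨h2, h3⟩; linarith
    · rintro ⟨h2, h3⟩; linarith
  · have : (𝓝[<] t).NeBot := ⟨hbot⟩
    rw [leftLim_eq_of_tendsto h1]
    exact ⟨h1, Real.coe_toNNReal _ hnn⟩

variable (hγ : HypWith γ ε K) (hω : GoodPath ε (fun n => T n ω) (marks Y ω))
include hγ hω

lemma coe_flow_zero (t : I) : (flow γ (N T Y ω) 0 t 0 : ℝ) =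
    isum (fun n => coeff γ (marks Y ω) n (leftSol (times T ω) (coeff γ (marks Y ω)) 0 0 n))
      (win (times T ω) 0 t) := by
  rw [coe_flow hγ hω t.2.1, value]
  simp

omit hγ hω in
lemma Ioc_prod_Ici (t : I) : Ioc 0 t ×ˢ Ici (0 : ℝ) = slab 0 t := by
  ext p
  simp [slab]

lemma isCadlag_flow : IsCadlag fun t : I => flow γ (N T Y ω) 0 t 0 := by
  have hb := field_of_good hγ hω
  intro t
  refine ⟨(continuousWithinAt_flow hγ hω t.2.1 0).comp (tendsto_coe_nhdsGE t), _,
    (leftLim_of_jumpSum (hb.summable_apply _) (fun n => hb.nonneg n _) (times T ω)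
      (coe_flow_zero hγ hω) t).1⟩

lemma solvesPath_flow : SolvesPath γ (N T Y ω) fun t : I => flow γ (N T Y ω) 0 t 0 := by
  have hb := field_of_good hγ hω
  intro t
  set a := leftSol (times T ω) (coeff γ (marks Y ω)) 0 0 with ha
  rw [Ioc_prod_Ici, setLIntegral_slab_N hω.nonneg (u := fun n => coeff γ (marks Y ω) n (a n)) _
    (fun n => hb.nonneg n _) (hb.summable_apply _)]
  · rw [show (fun n => (T n ω : ℝ)) = times T ω from rfl, ← coe_flow_zero hγ hω t,
      ENNReal.ofReal_coe_nnreal]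
  · intro n
    have h1 := (leftLim_of_jumpSum (hb.summable_apply a) (fun n => hb.nonneg n _) (times T ω)
      (coe_flow_zero hγ hω) (T n ω)).2
    have h2 : a n = (Function.leftLim (fun t : I => flow γ (N T Y ω) 0 t 0) (T n ω) : ℝ≥0) := by
      rw [h1, ha, hb.isLeftSol_leftSol (times T ω) 0 0 n, zero_add]
      rfl
    simp only [coeff, h2, Real.toNNReal_coe, marks]

/-- The equation exhibits `f` as a sum of jumps, so its left limits at the times `T n` are the sums
over left windows. They thus form a left solution from `0`, and that is unique. -/
lemma eq_flow_of_solvesPath {f : I → ℝ≥0} (hf : SolvesPath γ (N T Y ω) f) (t : I) :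
    f t = flow γ (N T Y ω) 0 t 0 := by
  have hb := field_of_good hγ hω
  set a : ℕ → ℝ := fun n => (Function.leftLim f (T n ω) : ℝ≥0) with ha
  have h1 : ∀ t : I, (f t : ℝ) =
      isum (fun n => coeff γ (marks Y ω) n (a n)) (win (times T ω) 0 t) := by
    intro t
    have h2 := hf t
    rw [Ioc_prod_Ici, setLIntegral_slab_N hω.nonneg (u := fun n => coeff γ (marks Y ω) n (a n))
      (fun n => by simp [coeff, ha, marks]) (fun n => hb.nonneg n _) (hb.summable_apply _)] at h2
    have h3 := congrArg ENNReal.toReal h2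
    rwa [ENNReal.coe_toReal, ENNReal.toReal_ofReal (hb.isum_apply_nonneg _ _)] at h3
  have h4 : IsLeftSol (times T ω) (coeff γ (marks Y ω)) 0 0 a := by
    intro n
    rw [zero_add]
    exact (leftLim_of_jumpSum (hb.summable_apply a) (fun n => hb.nonneg n _) (times T ω)
      h1 (T n ω)).2
  apply NNReal.coe_injective
  rw [h1, coe_flow_zero hγ hω, hb.leftSol_eq h4]

lemma strictMono_flow : StrictMono fun t : I => flow γ (N T Y ω) 0 t 0 := by
  have hb := field_of_good hγ hω
  intro s t hst
  rw [← NNReal.coe_lt_coe, coe_flow_zero hγ hω, coe_flow_zero hγ hω,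
    win_union (t := s) s.2.1 hst.le, isum_union (hb.summable_apply _) disjoint_win]
  obtain ⟨-, ⟨n, rfl⟩, hmem⟩ := hω.dense.exists_mem_open isOpen_Ioo (nonempty_Ioo.2 hst)
  have hn : n ∈ win (times T ω) s t := ⟨hmem.1, (show (T n ω : ℝ) < t from hmem.2).le⟩
  have := single_le_isum (hb.summable_apply _) (fun n => hb.nonneg n _) hn
    (u := fun n => coeff γ (marks Y ω) n (leftSol (times T ω) (coeff γ (marks Y ω)) 0 0 n))
  have hpos : 0 < coeff γ (marks Y ω) n (leftSol (times T ω) (coeff γ (marks Y ω)) 0 0 n) :=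
    G_pos (hω.nonneg n)
  linarith

/-- The jump at `t` is the sum of the strictly positive coefficients of all points located at `t`,
so ties among the times do no harm. Positivity of the times puts every point inside the window `(0,
t]` of its own time. -/
lemma jumpTimes_flow :
    jumpTimes (fun t : I => flow γ (N T Y ω) 0 t 0) = range fun n => T n ω := by
  have hb := field_of_good hγ hω
  ext t
  set u := fun n => coeff γ (marks Y ω) n (leftSol (times T ω) (coeff γ (marks Y ω)) 0 0 n) with hu
  have hus : Summable u := hb.summable_apply _
  have hu0 : ∀ n, 0 ≤ u n := fun n => hb.nonneg n _
  have h1 := (leftLim_of_jumpSum hus hu0 (times T ω) (coe_flow_zero hγ hω) t).2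
  have hsplit : win (times T ω) 0 t = winLeft (times T ω) 0 t ∪ {n | T n ω = t} := by
    ext n
    have hpos : (0 : ℝ) < T n ω := hω.pos n
    simp only [win, winLeft, times, mem_ofPred_eq, mem_union, hpos, true_and, le_iff_lt_or_eq,
      Subtype.ext_iff]
  have hdisj : Disjoint (winLeft (times T ω) 0 t) {n | T n ω = t} := by
    refine Set.disjoint_left.2 fun n hn hn' => ?_
    have h2 : (T n ω : ℝ) < t := hn.2
    have h3 : T n ω = t := hn'
    rw [h3] at h2
    exact lt_irrefl _ h2
  have h2 : (flow γ (N T Y ω) 0 t 0 : ℝ) =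
      (Function.leftLim (fun t : I => flow γ (N T Y ω) 0 t 0) t : ℝ≥0) + isum u {n | T n ω = t} := by
    rw [h1, coe_flow_zero hγ hω, hsplit, isum_union hus hdisj]
  simp only [jumpTimes, mem_ofPred_eq, ne_eq, mem_range]
  constructor
  · intro h3
    by_contra h4
    push Not at h4
    have h5 : {n | T n ω = t} = ∅ := by
      ext n; simp [h4 n]
    rw [h5, isum_empty, add_zero] at h2
    exact h3 (NNReal.coe_injective h2)
  · rintro ⟨n, hn⟩ h3
    have h4 := single_le_isum hus hu0 (A := {n | T n ω = t}) hn
    have hpos : 0 < u n := G_pos (hω.nonneg n)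
    have h5 : (flow γ (N T Y ω) 0 t 0 : ℝ) =
      (Function.leftLim (fun t : I => flow γ (N T Y ω) 0 t 0) t : ℝ≥0) := congrArg _ h3
    linarith

end GoodSolution

/-! ### Independence of composite variables -/

section Indep

variable {Ω α β α' β' : Type*} {mΩ : MeasurableSpace Ω} [MeasurableSpace α] [MeasurableSpace β]
  [MeasurableSpace α'] [MeasurableSpace β'] {P : Measure Ω}

/-- Rectangles generate both product σ-algebras, and on them the probabilities factor completely. It
serves to combine independence within the times, within the waiting times, and between the two
families. -/
lemma indepFun_prodMk_of_indepFun [IsProbabilityMeasure P] {A : Ω → α} {B : Ω → β} {C : Ω → α'}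
    {D : Ω → β'} (hA : Measurable A) (hB : Measurable B) (hC : Measurable C) (hD : Measurable D)
    (hAB : IndepFun A B P) (hCD : IndepFun C D P)
    (h : IndepFun (fun ω => (A ω, B ω)) (fun ω => (C ω, D ω)) P) :
    IndepFun (fun ω => (A ω, C ω)) (fun ω => (B ω, D ω)) P := by
  have hAC : IndepFun A C P := h.comp measurable_fst measurable_fst
  have hBD : IndepFun B D P := h.comp measurable_snd measurable_snd
  refine (IndepFun_iff_Indep _ _ _).2 (IndepSets.indep (hA.prodMk hC).comap_le
    (hB.prodMk hD).comap_le (isPiSystem_prod.comap fun ω => (A ω, C ω))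
    (isPiSystem_prod.comap fun ω => (B ω, D ω)) ?_ ?_ ?_)
  · rw [← generateFrom_prod, MeasurableSpace.comap_generateFrom]; rfl
  · rw [← generateFrom_prod, MeasurableSpace.comap_generateFrom]; rfl
  · rw [IndepSets_iff]
    rintro _ _ ⟨_, ⟨S, hS, U, hU, rfl⟩, rfl⟩ ⟨_, ⟨V, hV, W, hW, rfl⟩, rfl⟩
    have e1 : (fun ω => (A ω, C ω)) ⁻¹' S ×ˢ U = A ⁻¹' S ∩ C ⁻¹' U := rfl
    have e2 : (fun ω => (B ω, D ω)) ⁻¹' V ×ˢ W = B ⁻¹' V ∩ D ⁻¹' W := rfl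
    have e3 : A ⁻¹' S ∩ C ⁻¹' U ∩ (B ⁻¹' V ∩ D ⁻¹' W) =
        (fun ω => (A ω, B ω)) ⁻¹' S ×ˢ V ∩ (fun ω => (C ω, D ω)) ⁻¹' U ×ˢ W := by
      ext ω; simp only [mem_inter_iff, mem_preimage, mem_prod]; tauto
    have e4 : (fun ω => (A ω, B ω)) ⁻¹' S ×ˢ V = A ⁻¹' S ∩ B ⁻¹' V := rfl
    have e5 : (fun ω => (C ω, D ω)) ⁻¹' U ×ˢ W = C ⁻¹' U ∩ D ⁻¹' W := rfl
    rw [e1, e2, e3, h.measure_inter_preimage_eq_mul _ _ (hS.prod hV) (hU.prod hW), e4, e5,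
      hAB.measure_inter_preimage_eq_mul _ _ hS hV, hCD.measure_inter_preimage_eq_mul _ _ hU hW,
      hAC.measure_inter_preimage_eq_mul _ _ hS hU, hBD.measure_inter_preimage_eq_mul _ _ hV hW]
    ring

end Indep

/-! ### Exponential waiting times -/

section Exponential

lemma expMeasure_one_eq :
    expMeasure 1 = (volume.restrict (Ioi (0 : ℝ))).withDensity
      fun y => ENNReal.ofReal (Real.exp (-y)) := by
  have h : expMeasure 1 = volume.withDensity (exponentialPDF 1) := rfl
  rw [h, ← withDensity_indicator measurableSet_Ioi]
  refine withDensity_congr_ae ?_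
  have h0 : ∀ᵐ y : ℝ, y ≠ 0 := by simp [ae_iff]
  filter_upwards [h0] with y hy
  rcases lt_or_gt_of_ne hy with h | h
  · rw [exponentialPDF_of_neg h, indicator_of_notMem (by simp [h.le])]
  · rw [exponentialPDF_of_nonneg h.le, indicator_of_mem (by exact h)]
    simp

lemma lintegral_expMeasure_one {f : ℝ → ℝ≥0∞} (hf : Measurable f) :
    ∫⁻ y, f y ∂expMeasure 1 = ∫⁻ y in Ioi 0, ENNReal.ofReal (Real.exp (-y)) * f y := by
  rw [expMeasure_one_eq, lintegral_withDensity_eq_lintegral_mul _ (by fun_prop) hf]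
  rfl

instance : IsProbabilityMeasure (expMeasure 1) := isProbabilityMeasure_expMeasure one_pos

lemma lintegral_shift_Ioi (f : ℝ → ℝ≥0∞) (x : ℝ) :
    ∫⁻ y in Ioi 0, f (x + y) = ∫⁻ z in Ioi x, f z := by
  rw [← lintegral_indicator measurableSet_Ioi, ← lintegral_indicator measurableSet_Ioi,
    ← lintegral_add_left_eq_self ((Ioi x).indicator fun z => f z) x]
  congr 1
  ext y
  simp [indicator]

lemma lintegral_pow_Ioo (n : ℕ) {z : ℝ} (hz : 0 ≤ z) :
    ∫⁻ x in Ioo 0 z, ENNReal.ofReal (x ^ n / n.factorial) =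
      ENNReal.ofReal (z ^ (n + 1) / (n + 1).factorial) := by
  rw [setLIntegral_congr Ioo_ae_eq_Ioc, ← ofReal_integral_eq_lintegral_ofReal]
  · rw [← intervalIntegral.integral_of_le hz, intervalIntegral.integral_div, integral_pow]
    congr 1
    rw [Nat.factorial_succ]
    push_cast
    field_simp
    ring
  · exact ((by fun_prop : Continuous fun x : ℝ => x ^ n / n.factorial).integrableOn_Icc).mono_set
      Ioc_subset_Icc_self
  · filter_upwards [ae_restrict_mem measurableSet_Ioc] with x hx
    have := hx.1.le
    simp only [Pi.zero_apply]
    positivity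

end Exponential

/-! ### Laws and almost sure properties of the driving sequences. -/

section Driving

variable {Ω : Type*} [mΩ : MeasurableSpace Ω] {P : Measure Ω}
  {T : ℕ → Ω → I} {Y : ℕ → Ω → ℝ}

omit mΩ in
lemma Z_succ (Y : ℕ → Ω → ℝ) (n : ℕ) (ω : Ω) : Z Y (n + 1) ω = Z Y n ω + Y (n + 1) ω := by
  rw [Z, Finset.sum_range_succ]; rfl

namespace IsDriving

variable (hTY : IsDriving P T Y)
include hTY

lemma measurable_Z (n : ℕ) : Measurable (Z Y n) :=
  Finset.measurable_sum _ fun i _ => hTY.measurable_Y i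

lemma lintegral_Y {f : ℝ → ℝ≥0∞} (hf : Measurable f) (n : ℕ) :
    ∫⁻ ω, f (Y n ω) ∂P = ∫⁻ y in Ioi 0, ENNReal.ofReal (Real.exp (-y)) * f y := by
  rw [← lintegral_map hf (hTY.measurable_Y n), hTY.law_Y, lintegral_expMeasure_one hf]

variable [IsProbabilityMeasure P]

/-- The Gamma densities, by induction: the product of the exponential factors depends only on the
sum `z = x + y`, so after exchanging integrals only `∫ x^n / n!` over `(0, z)` is left. -/
lemma lintegral_Z {f : ℝ → ℝ≥0∞} (hf : Measurable f) (n : ℕ) :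
    ∫⁻ ω, f (Z Y n ω) ∂P =
      ∫⁻ z in Ioi 0, ENNReal.ofReal (z ^ n / n.factorial) *
        (ENNReal.ofReal (Real.exp (-z)) * f z) := by
  induction n generalizing f with
  | zero =>
    have : ∀ ω, Z Y 0 ω = Y 0 ω := fun ω => by simp [Z]
    simp only [this]
    rw [hTY.lintegral_Y hf]
    simp
  | succ n ih =>
    have hind : IndepFun (Z Y n) (Y (n + 1)) P := by
      have := hTY.indep_Y.indepFun_finsetSum_of_notMem hTY.measurable_Y
        (s := Finset.range (n + 1)) (i := n + 1) (by simp)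
      convert this using 1
      ext ω
      simp [Z]
    have hmZ := hTY.measurable_Z n
    have hmY := hTY.measurable_Y (n + 1)
    have hlaw := (indepFun_iff_map_prod_eq_prod_map_map hmZ.aemeasurable hmY.aemeasurable).1 hind
    have hf2 : Measurable fun p : ℝ × ℝ => f (p.1 + p.2) :=
      hf.comp (measurable_fst.add measurable_snd)
    have hg : Measurable fun x : ℝ => ∫⁻ y, f (x + y) ∂expMeasure 1 :=
      Measurable.lintegral_prod_right' hf2
    have h1 : ∫⁻ ω, f (Z Y (n + 1) ω) ∂P = ∫⁻ ω, ∫⁻ y, f (Z Y n ω + y) ∂expMeasure 1 ∂P := by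
      simp only [Z_succ]
      rw [← lintegral_map (f := fun p : ℝ × ℝ => f (p.1 + p.2)) hf2 (hmZ.prodMk hmY), hlaw,
        lintegral_prod _ hf2.aemeasurable, hTY.law_Y, lintegral_map hg hmZ]
    rw [h1, ih hg]
    have h2 : ∀ x : ℝ, ENNReal.ofReal (Real.exp (-x)) * ∫⁻ y, f (x + y) ∂expMeasure 1 =
        ∫⁻ z in Ioi x, ENNReal.ofReal (Real.exp (-z)) * f z := by
      intro x
      have hfx : Measurable fun y => f (x + y) := hf.comp (measurable_const_add x)
      rw [lintegral_expMeasure_one hfx, ← lintegral_const_mul _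
        (by fun_prop), ← lintegral_shift_Ioi (fun z => ENNReal.ofReal (Real.exp (-z)) * f z)]
      congr 1
      ext y
      rw [← mul_assoc, ← ENNReal.ofReal_mul (Real.exp_nonneg _), ← Real.exp_add, neg_add]
    simp only [h2]
    have h3 : ∀ x : ℝ, ENNReal.ofReal (x ^ n / n.factorial) *
        ∫⁻ z in Ioi x, ENNReal.ofReal (Real.exp (-z)) * f z =
        ∫⁻ z, (Ioi x).indicator (fun z => ENNReal.ofReal (x ^ n / n.factorial) *
          (ENNReal.ofReal (Real.exp (-z)) * f z)) z := by
      intro x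
      rw [lintegral_indicator measurableSet_Ioi, lintegral_const_mul _ (by fun_prop)]
    simp only [h3]
    rw [lintegral_lintegral_swap]
    · rw [← lintegral_indicator measurableSet_Ioi]
      congr 1
      ext z
      by_cases hz : 0 < z
      · rw [indicator_of_mem (by exact hz), ← lintegral_pow_Ioo n hz.le,
          ← lintegral_mul_const _ (by fun_prop), ← lintegral_indicator measurableSet_Ioi,
          ← lintegral_indicator measurableSet_Ioo]
        congr 1
        ext x
        by_cases hx : 0 < x <;> by_cases hxz : x < z <;> simp [indicator, hx, hxz]
      · rw [indicator_of_notMem (by exact hz), ← lintegral_indicator measurableSet_Ioi]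
        rw [lintegral_eq_zero_of_ae_eq_zero]
        refine Eventually.of_forall fun x => ?_
        by_cases hx : 0 < x
        · have : ¬ x < z := fun h => hz (hx.trans h)
          simp [indicator, this]
        · simp [indicator, hx]
    · have hset : MeasurableSet {p : ℝ × ℝ | p.1 < p.2} :=
        measurableSet_lt measurable_fst measurable_snd
      have : (Function.uncurry fun x z : ℝ => (Ioi x).indicator (fun z =>
          ENNReal.ofReal (x ^ n / n.factorial) * (ENNReal.ofReal (Real.exp (-z)) * f z)) z) =
        {p : ℝ × ℝ | p.1 < p.2}.indicator fun p => ENNReal.ofReal (p.1 ^ n / n.factorial) *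
          (ENNReal.ofReal (Real.exp (-p.2)) * f p.2) := by
        ext ⟨x, z⟩
        simp [indicator]
      rw [this]
      exact (Measurable.indicator (by fun_prop) hset).aemeasurable

/-- The superposition of the laws of the arrival times is Lebesgue measure on `(0, ∞)`. -/
lemma tsum_lintegral_Z {f : ℝ → ℝ≥0∞} (hf : Measurable f) :
    ∑' n, ∫⁻ ω, f (Z Y n ω) ∂P = ∫⁻ z in Ioi 0, f z := by
  simp only [hTY.lintegral_Z hf]
  rw [← lintegral_tsum fun n => by fun_prop]
  refine setLIntegral_congr_fun measurableSet_Ioi fun z hz => ?_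
  have hz : 0 < z := hz
  -- The Gamma densities add up to `1`, as `∑ z^n / n! = exp z`.
  rw [ENNReal.tsum_mul_right, ← ENNReal.ofReal_tsum_of_nonneg (fun n => by positivity)
    (NormedSpace.expSeries_div_hasSum_exp z).summable,
    (NormedSpace.expSeries_div_hasSum_exp z).tsum_eq, ← Real.exp_eq_exp_ℝ, ← mul_assoc,
    ← ENNReal.ofReal_mul (Real.exp_nonneg _), ← Real.exp_add]
  simp

lemma sum_law_Z : Measure.sum (fun n => P.map (Z Y n)) = volume.restrict (Ioi 0) := by
  refine Measure.ext_of_lintegral _ fun f hf => ?_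
  rw [lintegral_sum_measure, ← hTY.tsum_lintegral_Z hf]
  congr 1
  ext n
  rw [lintegral_map hf (hTY.measurable_Z n)]

omit [IsProbabilityMeasure P] in
lemma ae_Y_pos (n : ℕ) : ∀ᵐ ω ∂P, 0 < Y n ω := by
  have h : ∀ᵐ y ∂(P.map (Y n)), 0 < y := by
    rw [hTY.law_Y, expMeasure_one_eq]
    exact (withDensity_absolutelyContinuous _ _).ae_le (ae_restrict_mem measurableSet_Ioi)
  exact ae_of_ae_map (hTY.measurable_Y n).aemeasurable h

omit [IsProbabilityMeasure P] in
lemma ae_Z_nonneg : ∀ᵐ ω ∂P, ∀ n, 0 ≤ Z Y n ω := by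
  filter_upwards [ae_all_iff.2 hTY.ae_Y_pos] with ω hω n
  exact Finset.sum_nonneg fun i _ => (hω i).le

omit hTY [IsProbabilityMeasure P] mΩ in
lemma _root_.PoissonSDE.lintegral_wt_lt_top {ε : ℝ} (hε : 0 < ε) :
    ∫⁻ z in Ioi 0, ENNReal.ofReal (wt ε z) < ∞ := by
  have h := lintegral_shift_Ioi (fun z => ENNReal.ofReal (z ^ (-(1 + ε / 2)))) 1
  have h1 := (integrableOn_Ioi_rpow_of_lt (a := -(1 + ε / 2)) (by linarith) one_pos)
  unfold wt
  rw [h]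
  exact h1.lintegral_lt_top

lemma tsum_lintegral_wt_lt_top {ε : ℝ} (hε : 0 < ε) :
    ∑' n, ∫⁻ ω, ENNReal.ofReal (wt ε (Z Y n ω)) ∂P < ∞ := by
  rw [hTY.tsum_lintegral_Z (f := fun z => ENNReal.ofReal (wt ε z)) (by fun_prop)]
  exact lintegral_wt_lt_top hε

lemma ae_summable_wt {ε : ℝ} (hε : 0 < ε) : ∀ᵐ ω ∂P, Summable fun n => wt ε (Z Y n ω) := by
  have hm : ∀ n, AEMeasurable (fun ω => ENNReal.ofReal (wt ε (Z Y n ω))) P := fun n =>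
    ((measurable_wt.comp (hTY.measurable_Z n)).ennreal_ofReal).aemeasurable
  have h1 : ∫⁻ ω, ∑' n, ENNReal.ofReal (wt ε (Z Y n ω)) ∂P < ∞ := by
    rw [lintegral_tsum hm]
    exact hTY.tsum_lintegral_wt_lt_top hε
  have h2 := ae_lt_top' (AEMeasurable.tsum hm) h1.ne
  filter_upwards [h2, hTY.ae_Z_nonneg] with ω hω hz
  have h3 := ENNReal.summable_toReal hω.ne
  refine h3.congr fun n => ENNReal.toReal_ofReal (wt_nonneg (hz n))

omit [IsProbabilityMeasure P] in
lemma measure_T_preimage (n : ℕ) {s : Set I} (hs : MeasurableSet s) :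
    P (T n ⁻¹' s) = volume s := by
  rw [← hTY.law_T n, Measure.map_apply (hTY.measurable_T n) hs]

omit [IsProbabilityMeasure P] in
lemma ae_T_pos : ∀ᵐ ω ∂P, ∀ n, 0 < T n ω := by
  rw [ae_all_iff]
  intro n
  have h1 : P (T n ⁻¹' {0}) = 0 := by
    rw [hTY.measure_T_preimage n (measurableSet_singleton 0)]
    simp
  have h2 : ∀ᵐ ω ∂P, ω ∉ T n ⁻¹' {0} := measure_eq_zero_iff_ae_notMem.1 h1
  filter_upwards [h2] with ω hω
  exact unitInterval.pos_iff_ne_zero.2 hω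

omit [IsProbabilityMeasure P] in
lemma measure_forall_T_notMem_eq_zero {U : Set I} (hU : MeasurableSet U) (hU0 : volume U ≠ 0) :
    P {ω | ∀ n, T n ω ∉ U} = 0 := by
  have h1 : ∀ m : ℕ, P {ω | ∀ n, T n ω ∉ U} ≤ volume Uᶜ ^ m := by
    intro m
    have h2 := hTY.indep_T.measure_inter_preimage_eq_mul (Finset.range m) (sets := fun _ => Uᶜ)
      fun _ _ => hU.compl
    simp only [hTY.measure_T_preimage _ hU.compl, Finset.prod_const, Finset.card_range] at h2
    rw [← h2]
    refine measure_mono fun ω hω => ?_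
    simp only [mem_iInter]
    exact fun n _ => hω n
  have h3 : volume Uᶜ < 1 := by
    rw [prob_compl_eq_one_sub hU]
    exact ENNReal.sub_lt_self ENNReal.one_ne_top one_ne_zero hU0
  exact le_antisymm (ge_of_tendsto' (ENNReal.tendsto_pow_atTop_nhds_zero_of_lt_one h3) h1)
    zero_le

omit [IsProbabilityMeasure P] in
lemma ae_dense_T : ∀ᵐ ω ∂P, Dense (range fun n => T n ω) := by
  have hB := TopologicalSpace.isBasis_countableBasis I
  have h1 : ∀ᵐ ω ∂P, ∀ U ∈ TopologicalSpace.countableBasis I, U.Nonempty → ∃ n, T n ω ∈ U := by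
    rw [ae_ball_iff (TopologicalSpace.countable_countableBasis I)]
    intro U hU
    by_cases hne : U.Nonempty
    · have hUo : IsOpen U := TopologicalSpace.isOpen_of_mem_countableBasis hU
      have h0 : volume U ≠ 0 := by
        obtain ⟨a, b, hab, hsub⟩ := hUo.exists_Ioo_subset hne
        intro h
        have h2 := measure_mono_null hsub h
        rw [unitInterval.volume_Ioo] at h2
        have : (b : ℝ) - a ≤ 0 := by simpa using h2
        have : (a : ℝ) < b := hab
        linarith
      have h2 := measure_eq_zero_iff_ae_notMem.1
        (hTY.measure_forall_T_notMem_eq_zero hUo.measurableSet h0)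
      filter_upwards [h2] with ω hω _
      simpa using hω
    · exact Eventually.of_forall fun ω h => absurd h hne
  filter_upwards [h1] with ω hω
  rw [hB.dense_iff]
  intro U hU hne
  obtain ⟨n, hn⟩ := hω U hU hne
  exact ⟨T n ω, hn, n, rfl⟩

lemma ae_goodPath {ε : ℝ} (hε : 0 < ε) :
    ∀ᵐ ω ∂P, GoodPath ε (fun n => T n ω) (marks Y ω) := by
  filter_upwards [hTY.ae_Z_nonneg, hTY.ae_summable_wt hε, hTY.ae_T_pos, hTY.ae_dense_T]
    with ω h1 h2 h3 h4
  exact ⟨h1, h2, h3, h4⟩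

/-- Summability of the decreasing function `wt 1` along the arrival times already forces them to
infinity, so no law of large numbers is needed. -/
lemma ae_tendsto_Z : ∀ᵐ ω ∂P, Tendsto (fun n => Z Y n ω) atTop atTop := by
  filter_upwards [hTY.ae_Z_nonneg, hTY.ae_summable_wt one_pos] with ω h1 h2
  rw [tendsto_atTop]
  intro R
  have hR : 0 < wt 1 (max R 0) := wt_pos (le_max_right _ _)
  filter_upwards [h2.tendsto_atTop_zero.eventually (gt_mem_nhds hR)] with n hn
  by_contra h3
  have h4 : Z Y n ω ≤ max R 0 := (not_le.1 h3).le.trans (le_max_left _ _)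
  refine absurd hn (not_lt.2 ?_)
  exact Real.rpow_le_rpow_of_nonpos (by linarith [h1 n]) (by linarith) (by norm_num)

/-- The next point is independent of the past. -/
lemma indepFun_past (n : ℕ) :
    IndepFun (fun ω => ((fun k : Finset.range n => T k ω), (fun k : Finset.range n => Y k ω)))
      (fun ω => (T n ω, Y n ω)) P := by
  have hT := hTY.indep_T.indepFun_finset (Finset.range n) {n} (by simp) hTY.measurable_T
  have hY := hTY.indep_Y.indepFun_finset (Finset.range n) {n} (by simp) hTY.measurable_Y
  have hn : n ∈ ({n} : Finset ℕ) := Finset.mem_singleton_self n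
  have hT' : IndepFun (fun ω (k : Finset.range n) => T k ω) (T n) P :=
    hT.comp measurable_id (measurable_pi_apply (⟨n, hn⟩ : ({n} : Finset ℕ)))
  have hY' : IndepFun (fun ω (k : Finset.range n) => Y k ω) (Y n) P :=
    hY.comp measurable_id (measurable_pi_apply (⟨n, hn⟩ : ({n} : Finset ℕ)))
  have hmT : Measurable fun ω (k : Finset.range n) => T k ω :=
    measurable_pi_lambda _ fun k => hTY.measurable_T k
  have hmY : Measurable fun ω (k : Finset.range n) => Y k ω :=
    measurable_pi_lambda _ fun k => hTY.measurable_Y k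
  refine indepFun_prodMk_of_indepFun hmT (hTY.measurable_T n) hmY (hTY.measurable_Y n) hT' hY' ?_
  refine hTY.indep.comp (φ := fun f : ℕ → I => ((fun k : Finset.range n => f k), f n))
    (ψ := fun f : ℕ → ℝ => ((fun k : Finset.range n => f k), f n)) ?_ ?_
  · exact (measurable_pi_lambda _ fun k => measurable_pi_apply _).prodMk (measurable_pi_apply _)
  · exact (measurable_pi_lambda _ fun k => measurable_pi_apply _).prodMk (measurable_pi_apply _)

lemma law_prod (n : ℕ) : P.map (fun ω => (T n ω, Y n ω)) = volume.prod (expMeasure 1) := by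
  have h : IndepFun (T n) (Y n) P :=
    hTY.indep.comp (measurable_pi_apply n) (measurable_pi_apply n)
  rw [(indepFun_iff_map_prod_eq_prod_map_map (hTY.measurable_T n).aemeasurable
    (hTY.measurable_Y n).aemeasurable).1 h, hTY.law_T, hTY.law_Y]

end IsDriving

end Driving

/-! ### An integral equation for exponentials of tail integrals -/

section TailExp

/-- The exponential of the tail integral of `k`. -/
noncomputable def tailExp (k : ℝ → ℂ) (x : ℝ) : ℂ := Complex.exp (∫ u in Ioi x, k u)

variable {k : ℝ → ℂ}

lemma tailIntegral_eq (hk : Integrable k) (x : ℝ) :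
    ∫ u in Ioi x, k u = (∫ u in Ioi 0, k u) - ∫ u in (0 : ℝ)..x, k u := by
  rw [← intervalIntegral.integral_Ioi_sub_Ioi' hk.integrableOn hk.integrableOn]
  ring

lemma continuous_tailIntegral (hk : Integrable k) : Continuous fun x => ∫ u in Ioi x, k u := by
  rw [show (fun x => ∫ u in Ioi x, k u) = _ from funext (tailIntegral_eq hk)]
  exact continuous_const.sub
    (intervalIntegral.continuous_primitive (fun a b => hk.intervalIntegrable) 0)

lemma continuous_tailExp (hk : Integrable k) : Continuous (tailExp k) :=
  Complex.continuous_exp.comp (continuous_tailIntegral hk)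

lemma norm_tailIntegral_le (hk : Integrable k) (x : ℝ) :
    ‖∫ u in Ioi x, k u‖ ≤ ∫ u, ‖k u‖ :=
  (norm_integral_le_integral_norm _).trans
    (setIntegral_le_integral hk.norm (Eventually.of_forall fun _ => norm_nonneg _))

lemma norm_tailExp_le (hk : Integrable k) (x : ℝ) : ‖tailExp k x‖ ≤ Real.exp (∫ u, ‖k u‖) := by
  rw [tailExp, Complex.norm_exp]
  exact Real.exp_le_exp.2 ((Complex.re_le_norm _).trans (norm_tailIntegral_le hk x))

lemma integrable_exp_sub_Ioi (z : ℝ) : IntegrableOn (fun x => Real.exp (z - x)) (Ioi z) := by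
  have h : IntegrableOn (fun x => Real.exp z * Real.exp (-x)) (Ioi z) :=
    (integrableOn_exp_neg_Ioi z).const_mul (Real.exp z)
  refine h.congr_fun (fun x _ => ?_) measurableSet_Ioi
  simp only
  rw [← Real.exp_add]
  rfl

lemma exp_sub_le_one {z x : ℝ} (hx : x ∈ Ioi z) : Real.exp (z - x) ≤ 1 :=
  Real.exp_le_one_iff.2 (by have : z < x := hx
                            linarith)

lemma integrableOn_tail_integrand {k k' : ℝ → ℂ} (hk : Integrable k) (hk' : Integrable k') (z : ℝ) :
    IntegrableOn (fun x => (Real.exp (z - x) : ℂ) * (1 + k x) * tailExp k' x) (Ioi z) := by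
  have hc := continuous_tailExp hk'
  have h1 : IntegrableOn (fun x => (Real.exp (z - x) : ℂ) * (1 + k x)) (Ioi z) := by
    have h2 : IntegrableOn (fun x => (Real.exp (z - x) : ℂ)) (Ioi z) :=
      (integrable_exp_sub_Ioi z).ofReal
    have h3 : IntegrableOn (fun x => (Real.exp (z - x) : ℂ) * k x) (Ioi z) := by
      refine Integrable.bdd_mul (c := 1) hk.integrableOn (by fun_prop) ?_
      filter_upwards [ae_restrict_mem measurableSet_Ioi] with x hx
      rw [Complex.norm_real, Real.norm_of_nonneg (Real.exp_nonneg _)]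
      exact exp_sub_le_one hx
    refine (h2.add h3).congr (Eventually.of_forall fun x => ?_)
    simp only [Pi.add_apply]
    ring
  exact h1.mul_bdd (c := Real.exp (∫ u, ‖k' u‖)) hc.aestronglyMeasurable
    (Eventually.of_forall fun x => norm_tailExp_le hk' x)

/-- The integrand is the derivative of `-exp (z - x) * tailExp k x`, which vanishes at infinity. -/
lemma integral_tailExp_of_continuous (hk : Integrable k) (hc : Continuous k) (z : ℝ) :
    ∫ x in Ioi z, (Real.exp (z - x) : ℂ) * (1 + k x) * tailExp k x = tailExp k z := by
  have hder : ∀ x : ℝ, HasDerivAt (fun x => ∫ u in Ioi x, k u) (-k x) x := by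
    intro x
    rw [show (fun x => ∫ u in Ioi x, k u) = _ from funext (tailIntegral_eq hk)]
    exact (intervalIntegral.integral_hasDerivAt_right hk.intervalIntegrable
      hc.stronglyMeasurable.stronglyMeasurableAtFilter hc.continuousAt).const_sub _
  have hder2 : ∀ x : ℝ, HasDerivAt (fun x => -((Real.exp (z - x) : ℂ) * tailExp k x))
      ((Real.exp (z - x) : ℂ) * (1 + k x) * tailExp k x) x := by
    intro x
    have h1 : HasDerivAt (fun x : ℝ => (Real.exp (z - x) : ℂ)) (-(Real.exp (z - x) : ℂ)) x := by
      have := (((hasDerivAt_id x).const_sub z).exp).ofReal_comp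
      simpa using this
    have h2 : HasDerivAt (tailExp k) (tailExp k x * (-k x)) x := (hder x).cexp
    refine (h1.mul h2).neg.congr_deriv ?_
    ring
  have hlim : Tendsto (fun x => -((Real.exp (z - x) : ℂ) * tailExp k x)) atTop (𝓝 0) := by
    rw [← neg_zero]
    refine Tendsto.neg ?_
    rw [tendsto_zero_iff_norm_tendsto_zero]
    have h3 : Tendsto (fun x : ℝ => Real.exp (z - x) * Real.exp (∫ u, ‖k u‖)) atTop (𝓝 0) := by
      have : Tendsto (fun x : ℝ => Real.exp (z - x)) atTop (𝓝 0) :=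
        Real.tendsto_exp_atBot.comp (tendsto_atBot_add_const_left _ z tendsto_neg_atTop_atBot)
      simpa using this.mul_const (Real.exp (∫ u, ‖k u‖))
    refine squeeze_zero (fun _ => norm_nonneg _) (fun x => ?_) h3
    rw [norm_mul, Complex.norm_real, Real.norm_of_nonneg (Real.exp_nonneg _)]
    exact mul_le_mul_of_nonneg_left (norm_tailExp_le hk x) (Real.exp_nonneg _)
  rw [integral_Ioi_of_hasDerivAt_of_tendsto (hder2 z).continuousAt.continuousWithinAt
    (fun x _ => hder2 x) (integrableOn_tail_integrand hk hk z) hlim]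
  simp

/-- The kernels of test functions are only integrable, so the identity passes to the limit along
continuous approximations in `L¹`. In probabilistic terms, `tailExp k` is preserved by an
exponential step weighted by `1 + k`. -/
lemma integral_tailExp (hk : Integrable k) (z : ℝ) :
    ∫ x in Ioi z, (Real.exp (z - x) : ℂ) * (1 + k x) * tailExp k x = tailExp k z := by
  have happ : ∀ j : ℕ, ∃ g : ℝ → ℂ, HasCompactSupport g ∧ ∫ x, ‖k x - g x‖ ≤ 1 / ((j : ℝ) + 1) ∧
      Continuous g ∧ Integrable g := fun j =>
    hk.exists_hasCompactSupport_integral_sub_le (by positivity)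
  choose g _ hg hgc hgi using happ
  have hlim0 : Tendsto (fun j : ℕ => 1 / ((j : ℝ) + 1)) atTop (𝓝 0) :=
    tendsto_one_div_add_atTop_nhds_zero_nat
  have hA : ∀ x, Tendsto (fun j => tailExp (g j) x) atTop (𝓝 (tailExp k x)) := by
    intro x
    refine (Complex.continuous_exp.tendsto _).comp ?_
    rw [tendsto_iff_norm_sub_tendsto_zero]
    refine squeeze_zero (fun _ => norm_nonneg _) (fun j => ?_) hlim0
    rw [← integral_sub (hgi j).integrableOn hk.integrableOn]
    refine (norm_tailIntegral_le ((hgi j).sub hk) x).trans ?_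
    refine le_trans (le_of_eq ?_) (hg j)
    congr 1
    ext u
    exact norm_sub_rev _ _
  have hAb : ∀ j x, ‖tailExp (g j) x‖ ≤ Real.exp ((∫ u, ‖k u‖) + 1) := by
    intro j x
    refine (norm_tailExp_le (hgi j) x).trans (Real.exp_le_exp.2 ?_)
    have h1 : ∫ u, ‖g j u‖ ≤ ∫ u, (‖k u‖ + ‖k u - g j u‖) :=
      integral_mono (hgi j).norm (hk.norm.add (hk.sub (hgi j)).norm) fun u => by
        have := norm_sub_norm_le (g j u) (k u)
        rw [norm_sub_rev] at this
        simp only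
        linarith
    have h0 : Integrable fun u => ‖k u - g j u‖ := (hk.sub (hgi j)).norm
    rw [integral_add hk.norm h0] at h1
    have h2 : 1 / ((j : ℝ) + 1) ≤ 1 := by
      rw [div_le_one (by positivity)]
      linarith [(Nat.cast_nonneg j : (0 : ℝ) ≤ j)]
    linarith [hg j]
  have h1 : Tendsto (fun j => ∫ x in Ioi z, (Real.exp (z - x) : ℂ) * (1 + k x) * tailExp (g j) x)
      atTop (𝓝 (∫ x in Ioi z, (Real.exp (z - x) : ℂ) * (1 + k x) * tailExp k x)) := by
    -- `tailExp 0` is the constant `1`; writing it lets `integrableOn_tail_integrand` supply the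
    -- integrability of the dominating function.
    refine tendsto_integral_of_dominated_convergence
      (fun x => ‖(Real.exp (z - x) : ℂ) * (1 + k x) * tailExp 0 x‖ *
        Real.exp ((∫ u, ‖k u‖) + 1))
      (fun j => (integrableOn_tail_integrand hk (hgi j) z).aestronglyMeasurable)
      ((integrableOn_tail_integrand hk (integrable_zero _ _ _) z).norm.mul_const _)
      (fun j => Eventually.of_forall fun x => ?_)
      (Eventually.of_forall fun x => (hA x).const_mul _)
    have h0 : tailExp 0 x = 1 := by simp [tailExp]
    rw [h0, mul_one, norm_mul _ (tailExp (g j) x)]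
    exact mul_le_mul_of_nonneg_left (hAb j x) (norm_nonneg _)
  have h2 : Tendsto (fun j => (∫ x in Ioi z, (Real.exp (z - x) : ℂ) * (1 + g j x) * tailExp (g j) x)
      - ∫ x in Ioi z, (Real.exp (z - x) : ℂ) * (1 + k x) * tailExp (g j) x) atTop (𝓝 0) := by
    rw [tendsto_zero_iff_norm_tendsto_zero]
    have h3 : Tendsto (fun j : ℕ => Real.exp ((∫ u, ‖k u‖) + 1) * (1 / ((j : ℝ) + 1))) atTop
        (𝓝 0) := by simpa using hlim0.const_mul (Real.exp ((∫ u, ‖k u‖) + 1))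
    refine squeeze_zero (fun _ => norm_nonneg _) (fun j => ?_) h3
    rw [← integral_sub (integrableOn_tail_integrand (hgi j) (hgi j) z)
      (integrableOn_tail_integrand hk (hgi j) z)]
    have hi : Integrable fun x => Real.exp ((∫ u, ‖k u‖) + 1) * ‖k x - g j x‖ :=
      (hk.sub (hgi j)).norm.const_mul _
    refine (norm_integral_le_of_norm_le (g := fun x =>
      Real.exp ((∫ u, ‖k u‖) + 1) * ‖k x - g j x‖) hi.integrableOn ?_).trans ?_
    · filter_upwards [ae_restrict_mem measurableSet_Ioi] with x hx
      have e : (Real.exp (z - x) : ℂ) * (1 + g j x) * tailExp (g j) x -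
          (Real.exp (z - x) : ℂ) * (1 + k x) * tailExp (g j) x =
          (Real.exp (z - x) : ℂ) * (tailExp (g j) x * (g j x - k x)) := by ring
      rw [e, norm_mul, norm_mul, Complex.norm_real, Real.norm_of_nonneg (Real.exp_nonneg _),
        norm_sub_rev]
      exact (mul_le_of_le_one_left (by positivity) (exp_sub_le_one hx)).trans
        (mul_le_mul_of_nonneg_right (hAb j x) (norm_nonneg _))
    · refine (setIntegral_le_integral hi
        (Eventually.of_forall fun x => by positivity)).trans ?_
      rw [integral_const_mul]
      exact mul_le_mul_of_nonneg_left (hg j) (Real.exp_nonneg _)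
  simp only [integral_tailExp_of_continuous (hgi _) (hgc _)] at h2
  have h3 := (h2.add h1)
  simp only [sub_add_cancel, zero_add] at h3
  exact tendsto_nhds_unique h3 (hA z)

end TailExp

/-! ### The characteristic functional of the point process -/

section CharFunctional

/-- A test function: measurable, with marks in a bounded subset of `[0, ∞)`. -/
structure IsTest (f : I × ℝ → ℝ) : Prop where
  measurable : Measurable f
  bounded_support : ∃ R : ℝ, ∀ p, p.2 ∉ Icc 0 R → f p = 0

/-- `∫ (exp(i f(t,z)) - 1) dt` as a function of the mark `z`. -/
noncomputable def charKernel (f : I × ℝ → ℝ) (z : ℝ) : ℂ :=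
  ∫ t : I, (Complex.exp (f (t, z) * Complex.I) - 1)

variable {f g : I × ℝ → ℝ}

lemma measurable_cexp_test (hf : Measurable f) :
    Measurable fun p => Complex.exp (f p * Complex.I) := by fun_prop

lemma integrable_cexp_section (hf : Measurable f) (z : ℝ) :
    Integrable fun t : I => Complex.exp (f (t, z) * Complex.I) := by
  refine Integrable.of_bound (C := 1) ?_ (Eventually.of_forall fun t => ?_)
  · exact ((measurable_cexp_test hf).comp
      (measurable_id.prodMk measurable_const)).aestronglyMeasurable
  · exact (Complex.norm_exp_ofReal_mul_I _).le

lemma one_add_charKernel (hf : Measurable f) (z : ℝ) :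
    1 + charKernel f z = ∫ t : I, Complex.exp (f (t, z) * Complex.I) := by
  rw [charKernel, integral_sub (integrable_cexp_section hf z) (integrable_const _)]
  simp

lemma IsTest.integrable_charKernel (hf : IsTest f) : Integrable (charKernel f) := by
  obtain ⟨R, hR⟩ := hf.bounded_support
  have hm : StronglyMeasurable (charKernel f) := by
    refine StronglyMeasurable.integral_prod_left
      (f := fun (t : I) (z : ℝ) => Complex.exp (f (t, z) * Complex.I) - 1) ?_
    exact ((measurable_cexp_test hf.measurable).sub_const 1).stronglyMeasurable
  have hb : ∀ z, ‖charKernel f z‖ ≤ 2 := by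
    intro z
    refine (norm_integral_le_of_norm_le_const (C := 2) (Eventually.of_forall fun t => ?_)).trans ?_
    · refine (norm_sub_le _ _).trans ?_
      rw [Complex.norm_exp_ofReal_mul_I]
      norm_num
    · simp
  have h0 : ∀ z, z ∉ Icc 0 R → charKernel f z = 0 := by
    intro z hz
    have : ∀ t : I, f (t, z) = 0 := fun t => hR (t, z) hz
    simp [charKernel, this]
  have h1 : IntegrableOn (charKernel f) (Icc 0 R) :=
    Measure.integrableOn_of_bounded (by simp) hm.aestronglyMeasurable
      (Eventually.of_forall hb)
  rw [← integrable_indicator_iff measurableSet_Icc] at h1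
  refine h1.congr (Eventually.of_forall fun z => ?_)
  by_cases hz : z ∈ Icc 0 R
  · simp [hz]
  · simp [hz, h0 z hz]

/-- Where one of the functions vanishes, `exp(i(f + g)) - 1` is the sum of `exp(i f) - 1` and `exp(i
g) - 1`. This additivity becomes independence over disjoint sets. -/
lemma charKernel_add (hf : IsTest f) (hg : IsTest g) (h : ∀ p, f p = 0 ∨ g p = 0) (z : ℝ) :
    charKernel (fun p => f p + g p) z = charKernel f z + charKernel g z := by
  rw [charKernel, charKernel, charKernel, ← integral_add]
  · congr 1
    ext t
    rcases h (t, z) with h | h <;> simp [h]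
  · exact (integrable_cexp_section hf.measurable z).sub (integrable_const _)
  · exact (integrable_cexp_section hg.measurable z).sub (integrable_const _)

lemma IsTest.add (hf : IsTest f) (hg : IsTest g) : IsTest fun p => f p + g p := by
  obtain ⟨R, hR⟩ := hf.bounded_support
  obtain ⟨R', hR'⟩ := hg.bounded_support
  refine ⟨hf.measurable.add hg.measurable, max R R', fun p hp => ?_⟩
  rw [hR p fun h => hp ⟨h.1, h.2.trans (le_max_left _ _)⟩,
    hR' p fun h => hp ⟨h.1, h.2.trans (le_max_right _ _)⟩, add_zero]

lemma integral_expMeasure_one (F : ℝ → ℂ) :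
    ∫ y, F y ∂expMeasure 1 = ∫ y in Ioi 0, (Real.exp (-y) : ℂ) * F y := by
  rw [expMeasure_one_eq, integral_withDensity_eq_integral_toReal_smul (by fun_prop)
    (Eventually.of_forall fun _ => ENNReal.ofReal_lt_top)]
  congr 1
  ext y
  rw [ENNReal.toReal_ofReal (Real.exp_nonneg _), Complex.real_smul]

lemma integral_shift_Ioi (F : ℝ → ℂ) (x : ℝ) :
    ∫ y in Ioi 0, F (x + y) = ∫ z in Ioi x, F z := by
  rw [← integral_indicator measurableSet_Ioi, ← integral_indicator measurableSet_Ioi,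
    ← integral_add_left_eq_self ((Ioi x).indicator fun z => F z) x]
  congr 1
  ext y
  simp [indicator]

lemma IsTest.integrable_step (hf : IsTest f) (z : ℝ) : Integrable (fun w : I × ℝ =>
    Complex.exp (f (w.1, z + w.2) * Complex.I) * tailExp (charKernel f) (z + w.2))
    (volume.prod (expMeasure 1)) := by
  have hk := hf.integrable_charKernel
  refine Integrable.of_bound (C := Real.exp (∫ u, ‖charKernel f u‖)) ?_
    (Eventually.of_forall fun w => ?_)
  · refine Measurable.aestronglyMeasurable (Measurable.mul ?_ ?_)
    · exact (measurable_cexp_test hf.measurable).comp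
        (measurable_fst.prodMk (measurable_snd.const_add z))
    · exact (continuous_tailExp hk).measurable.comp (measurable_snd.const_add z)
  · rw [norm_mul, Complex.norm_exp_ofReal_mul_I, one_mul]
    exact norm_tailExp_le hk _

/-- Averaging over the uniform time produces `1 + charKernel f`, and averaging over the exponential
waiting time is then the identity `integral_tailExp`. -/
lemma IsTest.integral_step (hf : IsTest f) (z : ℝ) :
    ∫ w : I × ℝ, Complex.exp (f (w.1, z + w.2) * Complex.I) * tailExp (charKernel f) (z + w.2)
      ∂(volume.prod (expMeasure 1)) = tailExp (charKernel f) z := by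
  rw [integral_prod_symm _ (hf.integrable_step z)]
  simp only [integral_mul_const]
  have h1 : ∀ y : ℝ, (∫ t : I, Complex.exp (f (t, z + y) * Complex.I)) =
      1 + charKernel f (z + y) := fun y => (one_add_charKernel hf.measurable _).symm
  simp only [h1]
  rw [integral_expMeasure_one, ← integral_tailExp hf.integrable_charKernel z,
    ← integral_shift_Ioi fun x => (Real.exp (z - x) : ℂ) * (1 + charKernel f x) *
      tailExp (charKernel f) x]
  congr 1
  ext y
  rw [← mul_assoc, sub_add_cancel_left]

variable {Ω : Type*} [mΩ : MeasurableSpace Ω] {P : Measure Ω} [IsProbabilityMeasure P]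
  {T : ℕ → Ω → I} {Y : ℕ → Ω → ℝ}

lemma IsDriving.indepFun_partial (hTY : IsDriving P T Y) (hf : Measurable f) (m : ℕ) :
    IndepFun (fun ω => (∑ n ∈ Finset.range m, f (T n ω, Z Y n ω), ∑ n ∈ Finset.range m, Y n ω))
      (fun ω => (T m ω, Y m ω)) P := by
  classical
  let φ : (Finset.range m → I) × (Finset.range m → ℝ) → ℝ × ℝ := fun p =>
    (∑ n : Finset.range m, f (p.1 n, ∑ j : Finset.range m, if (j : ℕ) ≤ n then p.2 j else 0),
      ∑ n : Finset.range m, p.2 n)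
  have hφ : Measurable φ := by
    refine Measurable.prodMk (Finset.measurable_sum _ fun n _ => hf.comp (Measurable.prodMk
      ((measurable_pi_apply n).comp measurable_fst) (Finset.measurable_sum _ fun j _ => ?_)))
      (Finset.measurable_sum _ fun n _ => (measurable_pi_apply n).comp measurable_snd)
    by_cases h : (j : ℕ) ≤ n
    · simp only [h, if_true]
      exact (measurable_pi_apply j).comp measurable_snd
    · simp [h]
  have h := (hTY.indepFun_past m).comp hφ measurable_id
  convert h using 1
  swap
  · rfl
  ext1 ω
  have hZ : ∀ n ∈ Finset.range m, Z Y n ω =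
      ∑ j : Finset.range m, if (j : ℕ) ≤ n then Y j ω else 0 := by
    intro n hn
    rw [Finset.sum_coe_sort (Finset.range m) fun j => if j ≤ n then Y j ω else 0,
      ← Finset.sum_filter, Z]
    congr 1
    ext j
    simp only [Finset.mem_range, Finset.mem_filter] at hn ⊢
    omega
  simp only [φ, Function.comp_apply, Prod.mk.injEq]
  constructor
  · rw [← Finset.sum_coe_sort (Finset.range m)]
    exact Finset.sum_congr rfl fun n _ => by rw [hZ n n.2]
  · rw [← Finset.sum_coe_sort (Finset.range m)]

/-- A martingale computation: the next point is independent of the past, and `IsTest.integral_step`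
removes it from the expectation. -/
lemma IsDriving.integral_partial (hTY : IsDriving P T Y) (hf : IsTest f) (m : ℕ) :
    ∫ ω, Complex.exp ((∑ n ∈ Finset.range m, f (T n ω, Z Y n ω) : ℝ) * Complex.I) *
      tailExp (charKernel f) (∑ n ∈ Finset.range m, Y n ω) ∂P = tailExp (charKernel f) 0 := by
  have hk := hf.integrable_charKernel
  have hc := continuous_tailExp hk
  have hm := hf.measurable
  induction m with
  | zero => simp
  | succ m ih =>
    set V : Ω → ℝ × ℝ := fun ω =>
      (∑ n ∈ Finset.range m, f (T n ω, Z Y n ω), ∑ n ∈ Finset.range m, Y n ω) with hV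
    set W : Ω → I × ℝ := fun ω => (T m ω, Y m ω) with hW
    have hmV : Measurable V :=
      (Finset.measurable_sum _ fun n _ => hm.comp
        ((hTY.measurable_T n).prodMk (hTY.measurable_Z n))).prodMk
        (Finset.measurable_sum _ fun n _ => hTY.measurable_Y n)
    have hmW : Measurable W := (hTY.measurable_T m).prodMk (hTY.measurable_Y m)
    let Φ : (ℝ × ℝ) × (I × ℝ) → ℂ := fun q => Complex.exp (q.1.1 * Complex.I) *
      (Complex.exp (f (q.2.1, q.1.2 + q.2.2) * Complex.I) *
        tailExp (charKernel f) (q.1.2 + q.2.2))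
    have hΦ : Measurable Φ := by
      have h1 : Measurable fun q : (ℝ × ℝ) × (I × ℝ) => q.1.2 + q.2.2 := by fun_prop
      refine Measurable.mul (by fun_prop) (Measurable.mul ?_ (hc.measurable.comp h1))
      exact (measurable_cexp_test hm).comp
        ((measurable_fst.comp measurable_snd).prodMk h1)
    have e1 : ∀ ω, Complex.exp ((∑ n ∈ Finset.range (m + 1), f (T n ω, Z Y n ω) : ℝ) * Complex.I) *
        tailExp (charKernel f) (∑ n ∈ Finset.range (m + 1), Y n ω) = Φ (V ω, W ω) := by
      intro ω
      have hZ : Z Y m ω = ∑ n ∈ Finset.range m, Y n ω + Y m ω := Finset.sum_range_succ _ _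
      simp only [Φ, hV, hW]
      rw [Finset.sum_range_succ, Finset.sum_range_succ, hZ, ← mul_assoc, ← Complex.exp_add]
      congr 2
      push_cast
      ring
    simp only [e1]
    rw [← integral_map (φ := fun ω => (V ω, W ω)) (f := Φ) (hmV.prodMk hmW).aemeasurable
      hΦ.aestronglyMeasurable,
      (indepFun_iff_map_prod_eq_prod_map_map hmV.aemeasurable hmW.aemeasurable).1
        (hTY.indepFun_partial hm m), hTY.law_prod, integral_prod]
    · simp only [Φ, integral_const_mul, hf.integral_step]
      rw [integral_map hmV.aemeasurable]
      · exact ih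
      · exact (Measurable.mul (by fun_prop)
          (hc.measurable.comp measurable_snd)).aestronglyMeasurable
    · have := Measure.isProbabilityMeasure_map (μ := P) hmV.aemeasurable
      refine Integrable.of_bound (C := Real.exp (∫ u, ‖charKernel f u‖))
        hΦ.aestronglyMeasurable (Eventually.of_forall fun q => ?_)
      simp only [Φ]
      rw [norm_mul, norm_mul, Complex.norm_exp_ofReal_mul_I, Complex.norm_exp_ofReal_mul_I, one_mul,
        one_mul]
      exact norm_tailExp_le hk _

omit mΩ in
lemma IsTest.finite_support (hf : IsTest f) {ω : Ω}
    (hω : Tendsto (fun n => Z Y n ω) atTop atTop) :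
    ∃ m₀ : ℕ, ∀ n, m₀ ≤ n → f (T n ω, Z Y n ω) = 0 := by
  obtain ⟨R, hR⟩ := hf.bounded_support
  obtain ⟨m₀, hm₀⟩ := eventually_atTop.1 (hω.eventually_gt_atTop R)
  exact ⟨m₀, fun n hn => hR _ fun h => absurd h.2 (not_le.2 (hm₀ n hn))⟩

/-- The characteristic functional of the point process. -/
lemma IsDriving.charFunctional (hTY : IsDriving P T Y) (hf : IsTest f) :
    ∫ ω, Complex.exp ((∑' n, f (T n ω, Z Y n ω) : ℝ) * Complex.I) ∂P =
      tailExp (charKernel f) 0 := by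
  have hk := hf.integrable_charKernel
  have hc := continuous_tailExp hk
  obtain ⟨R, hR⟩ := hf.bounded_support
  -- The kernel vanishes beyond the mark bound `R`, so the compensating factor equals `1` once the
  -- arrival times have passed `R`.
  have htail : ∀ x, R ≤ x → tailExp (charKernel f) x = 1 := by
    intro x hx
    have : ∀ u ∈ Ioi x, charKernel f u = 0 := by
      intro u hu
      have h0 : ∀ t : I, f (t, u) = 0 := fun t =>
        hR (t, u) fun h => absurd h.2 (not_le.2 (hx.trans_lt hu))
      simp [charKernel, h0]
    rw [tailExp, setIntegral_congr_fun measurableSet_Ioi this]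
    simp
  have hlim : Tendsto (fun m : ℕ =>
      ∫ ω, Complex.exp ((∑ n ∈ Finset.range m, f (T n ω, Z Y n ω) : ℝ) * Complex.I) *
      tailExp (charKernel f) (∑ n ∈ Finset.range m, Y n ω) ∂P) atTop
      (𝓝 (∫ ω, Complex.exp ((∑' n, f (T n ω, Z Y n ω) : ℝ) * Complex.I) ∂P)) := by
    refine tendsto_integral_of_dominated_convergence
      (fun _ => Real.exp (∫ u, ‖charKernel f u‖)) (fun m => ?_) (integrable_const _)
      (fun m => Eventually.of_forall fun ω => ?_) ?_
    · refine Measurable.aestronglyMeasurable (Measurable.mul ?_ (hc.measurable.comp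
        (Finset.measurable_sum _ fun n _ => hTY.measurable_Y n)))
      have : Measurable fun ω => ∑ n ∈ Finset.range m, f (T n ω, Z Y n ω) :=
        Finset.measurable_sum _ fun n _ => hf.measurable.comp
          ((hTY.measurable_T n).prodMk (hTY.measurable_Z n))
      fun_prop
    · rw [norm_mul, Complex.norm_exp_ofReal_mul_I, one_mul]
      exact norm_tailExp_le hk _
    · filter_upwards [hTY.ae_tendsto_Z] with ω hω
      obtain ⟨m₀, hm₀⟩ := hf.finite_support (T := T) hω
      have h1 : ∀ᶠ m in atTop, R ≤ ∑ n ∈ Finset.range (m + 1), Y n ω :=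
        hω.eventually_ge_atTop R
      rw [← tendsto_add_atTop_iff_nat 1]
      refine tendsto_const_nhds.congr' ?_
      filter_upwards [h1, eventually_ge_atTop m₀] with m hm hmm
      rw [htail _ hm, mul_one, tsum_eq_sum (s := Finset.range (m + 1))]
      intro n hn
      refine hm₀ n ?_
      simp only [Finset.mem_range, not_lt] at hn
      omega
  simp only [hTY.integral_partial hf] at hlim
  exact tendsto_nhds_unique hlim tendsto_const_nhds

lemma IsDriving.charFunctional_add (hTY : IsDriving P T Y) (hf : IsTest f) (hg : IsTest g)
    (h : ∀ p, f p = 0 ∨ g p = 0) :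
    ∫ ω, Complex.exp ((∑' n, (f (T n ω, Z Y n ω) + g (T n ω, Z Y n ω)) : ℝ) * Complex.I) ∂P =
      (∫ ω, Complex.exp ((∑' n, f (T n ω, Z Y n ω) : ℝ) * Complex.I) ∂P) *
      ∫ ω, Complex.exp ((∑' n, g (T n ω, Z Y n ω) : ℝ) * Complex.I) ∂P := by
  rw [hTY.charFunctional hf, hTY.charFunctional hg, hTY.charFunctional (hf.add hg), tailExp,
    tailExp, tailExp, ← Complex.exp_add, ← integral_add hf.integrable_charKernel.integrableOn
      hg.integrable_charKernel.integrableOn]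
  congr 2
  ext z
  exact charKernel_add hf hg h z

end CharFunctional

/-! ### Independence of the point process on disjoint sets -/

section Restriction

/-- Indices of the bounded observations of the point process. -/
abbrev ObsIndex : Type := {A : Set (I × ℝ) // MeasurableSet A} × ℕ

/-- The part of an observation set that lies in `C`. -/
def cell (C : Set (I × ℝ)) (i : ObsIndex) : Set (I × ℝ) := C ∩ i.1 ∩ {p | p.2 ≤ i.2}

lemma measurableSet_cell {C : Set (I × ℝ)} (hC : MeasurableSet C) (i : ObsIndex) :
    MeasurableSet (cell C i) :=
  (hC.inter i.1.2).inter (measurableSet_le measurable_snd measurable_const)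

lemma isTest_cell {C : Set (I × ℝ)} (hC : MeasurableSet C) (hC0 : ∀ p ∈ C, 0 ≤ p.2)
    (i : ObsIndex) : IsTest ((cell C i).indicator fun _ => (1 : ℝ)) := by
  refine ⟨measurable_const.indicator (measurableSet_cell hC i), i.2, fun p hp => ?_⟩
  exact indicator_of_notMem (fun h => hp ⟨hC0 p h.1.1, h.2⟩) _

lemma IsTest.const_mul {f : I × ℝ → ℝ} (hf : IsTest f) (c : ℝ) : IsTest fun p => c * f p := by
  obtain ⟨R, hR⟩ := hf.bounded_support
  exact ⟨hf.measurable.const_mul c, R, fun p hp => by rw [hR p hp, mul_zero]⟩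

lemma isTest_sum {ι : Type*} (s : Finset ι) {f : ι → I × ℝ → ℝ} (hf : ∀ i, IsTest (f i)) :
    IsTest fun p => ∑ i ∈ s, f i p := by
  classical
  induction s using Finset.induction_on with
  | empty => exact ⟨by simp, 0, by simp⟩
  | insert a s ha ih =>
    simp only [Finset.sum_insert ha]
    exact (hf a).add ih

variable {Ω : Type*} [mΩ : MeasurableSpace Ω] {P : Measure Ω} [IsProbabilityMeasure P]
  {T : ℕ → Ω → I} {Y : ℕ → Ω → ℝ}

omit mΩ in
lemma N_apply (ω : Ω) {B : Set (I × ℝ)} (hB : MeasurableSet B) :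
    N T Y ω B = ∑' n, B.indicator 1 (T n ω, Z Y n ω) := by
  rw [N, Measure.sum_apply _ hB]
  simp only [Measure.dirac_apply' _ hB]

omit mΩ in
lemma N_apply_toReal {ω : Ω} (hω : Tendsto (fun n => Z Y n ω) atTop atTop) {B : Set (I × ℝ)}
    (hB : MeasurableSet B) (hBt : IsTest (B.indicator fun _ => (1 : ℝ))) :
    N T Y ω B ≠ ∞ ∧ (N T Y ω B).toReal = ∑' n, B.indicator (fun _ => (1 : ℝ)) (T n ω, Z Y n ω) := by
  classical
  obtain ⟨m₀, hm₀⟩ := hBt.finite_support (T := T) hω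
  have h1 : ∀ n ∉ Finset.range m₀, (T n ω, Z Y n ω) ∉ B := by
    intro n hn hmem
    have := hm₀ n (by simpa using hn)
    rw [indicator_of_mem hmem] at this
    exact one_ne_zero this
  have h2 : N T Y ω B = ∑ n ∈ Finset.range m₀, B.indicator 1 (T n ω, Z Y n ω) := by
    rw [N_apply ω hB, tsum_eq_sum]
    exact fun n hn => indicator_of_notMem (h1 n hn) _
  have h3 : ∀ n, B.indicator (1 : I × ℝ → ℝ≥0∞) (T n ω, Z Y n ω) ≠ ∞ := fun n => by
    by_cases h : (T n ω, Z Y n ω) ∈ B <;> simp [h]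
  constructor
  · rw [h2]
    exact ENNReal.sum_ne_top.2 fun n _ => h3 n
  · rw [h2, ENNReal.toReal_sum fun n _ => h3 n, tsum_eq_sum (s := Finset.range m₀)]
    · refine Finset.sum_congr rfl fun n _ => ?_
      by_cases h : (T n ω, Z Y n ω) ∈ B <;> simp [h]
    · exact fun n hn => indicator_of_notMem (h1 n hn) _

/-- The test function representing a linear functional of finitely many observations. -/
noncomputable def obsTest (C : Set (I × ℝ)) (J : Finset ObsIndex) (ℓ : StrongDual ℝ (J → ℝ))
    (p : I × ℝ) : ℝ :=
  ∑ j : J, ℓ (Pi.single j 1) * (cell C j).indicator (fun _ => (1 : ℝ)) p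

lemma isTest_obsTest {C : Set (I × ℝ)} (hC : MeasurableSet C) (hC0 : ∀ p ∈ C, 0 ≤ p.2)
    (J : Finset ObsIndex) (ℓ : StrongDual ℝ (J → ℝ)) : IsTest (obsTest C J ℓ) :=
  isTest_sum _ fun j => (isTest_cell hC hC0 j).const_mul _

lemma obsTest_eq_zero {C : Set (I × ℝ)} (J : Finset ObsIndex) (ℓ : StrongDual ℝ (J → ℝ))
    {p : I × ℝ} (hp : p ∉ C) : obsTest C J ℓ p = 0 :=
  Finset.sum_eq_zero fun j _ => by
    rw [indicator_of_notMem fun h => hp h.1.1, mul_zero]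

omit mΩ in
lemma IsTest.summable {f : I × ℝ → ℝ} (hf : IsTest f) {ω : Ω}
    (hω : Tendsto (fun n => Z Y n ω) atTop atTop) : Summable fun n => f (T n ω, Z Y n ω) := by
  obtain ⟨m₀, hm₀⟩ := hf.finite_support (T := T) hω
  exact summable_of_ne_finset_zero (s := Finset.range m₀) fun n hn => hm₀ n (by simpa using hn)

omit mΩ in
lemma apply_obs_eq {C : Set (I × ℝ)} (hC : MeasurableSet C) (hC0 : ∀ p ∈ C, 0 ≤ p.2)
    (J : Finset ObsIndex) (ℓ : StrongDual ℝ (J → ℝ)) {ω : Ω}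
    (hω : Tendsto (fun n => Z Y n ω) atTop atTop) :
    ℓ (fun j : J => (N T Y ω (cell C j)).toReal) = ∑' n, obsTest C J ℓ (T n ω, Z Y n ω) := by
  classical
  have h1 : ∀ v : J → ℝ, ℓ v = ∑ j, ℓ (Pi.single j 1) * v j := by
    intro v
    conv_lhs => rw [pi_eq_sum_univ' v]
    rw [map_sum]
    refine Finset.sum_congr rfl fun j _ => ?_
    rw [map_smul, smul_eq_mul, mul_comm]
  unfold obsTest
  have h2 : ∀ j ∈ (Finset.univ : Finset J), Summable fun n =>
      ℓ (Pi.single j 1) * (cell C j).indicator (fun _ => (1 : ℝ)) (T n ω, Z Y n ω) := fun j _ =>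
    ((isTest_cell hC hC0 j).const_mul _).summable hω
  rw [h1, Summable.tsum_finsetSum h2]
  refine Finset.sum_congr rfl fun j _ => ?_
  rw [(N_apply_toReal hω (measurableSet_cell hC j) (isTest_cell hC hC0 j)).2, tsum_mul_left]

variable (hTY : IsDriving P T Y)
include hTY

omit [IsProbabilityMeasure P] in
lemma IsDriving.measurable_obs {C : Set (I × ℝ)} (hC : MeasurableSet C) (i : ObsIndex) :
    Measurable fun ω => N T Y ω (cell C i) :=
  measurable_N_apply hTY.measurable_T hTY.measurable_Y (measurableSet_cell hC i)

/-- A linear functional of the counts is the sum of a test function over the points. For disjoint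
`C` and `D` the two test functions are never both nonzero, so the joint characteristic function
factors. Bounded marks keep the counts almost surely finite, hence representable as reals. -/
lemma IsDriving.indepFun_obs_toReal {C D : Set (I × ℝ)} (hC : MeasurableSet C)
    (hC0 : ∀ p ∈ C, 0 ≤ p.2) (hD : MeasurableSet D) (hD0 : ∀ p ∈ D, 0 ≤ p.2) (hCD : Disjoint C D)
    (J J' : Finset ObsIndex) :
    IndepFun (fun ω (j : J) => (N T Y ω (cell C j)).toReal)
      (fun ω (j : J') => (N T Y ω (cell D j)).toReal) P := by
  have hmC : Measurable fun ω (j : J) => (N T Y ω (cell C j)).toReal :=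
    measurable_pi_lambda _ fun j => (hTY.measurable_obs hC j).ennreal_toReal
  have hmD : Measurable fun ω (j : J') => (N T Y ω (cell D j)).toReal :=
    measurable_pi_lambda _ fun j => (hTY.measurable_obs hD j).ennreal_toReal
  rw [indepFun_iff_charFunDual_prod hmC.aemeasurable hmD.aemeasurable]
  intro ℓ
  set ℓ₁ := ℓ.comp (.inl ℝ (J → ℝ) (J' → ℝ)) with hℓ₁
  set ℓ₂ := ℓ.comp (.inr ℝ (J → ℝ) (J' → ℝ)) with hℓ₂
  have hsplit : ∀ x y, ℓ (x, y) = ℓ₁ x + ℓ₂ y := by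
    intro x y
    rw [hℓ₁, hℓ₂, ContinuousLinearMap.comp_apply, ContinuousLinearMap.comp_apply,
      ContinuousLinearMap.inl_apply, ContinuousLinearMap.inr_apply, ← map_add]
    simp
  rw [charFunDual_apply, charFunDual_apply, charFunDual_apply,
    integral_map (hmC.prodMk hmD).aemeasurable (by fun_prop),
    integral_map hmC.aemeasurable (by fun_prop), integral_map hmD.aemeasurable (by fun_prop)]
  have t1 := isTest_obsTest hC hC0 J ℓ₁
  have t2 := isTest_obsTest hD hD0 J' ℓ₂
  have key := hTY.charFunctional_add t1 t2 fun p => by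
    by_cases hp : p ∈ C
    · exact Or.inr (obsTest_eq_zero J' ℓ₂ fun h => Set.disjoint_left.1 hCD hp h)
    · exact Or.inl (obsTest_eq_zero J ℓ₁ hp)
  have hZ := hTY.ae_tendsto_Z
  convert key using 1
  · refine integral_congr_ae ?_
    filter_upwards [hZ] with ω hω
    rw [hsplit, apply_obs_eq hC hC0 J ℓ₁ hω, apply_obs_eq hD hD0 J' ℓ₂ hω,
      (t1.summable hω).tsum_add (t2.summable hω)]
  · congr 1
    · refine integral_congr_ae ?_
      filter_upwards [hZ] with ω hω
      rw [apply_obs_eq hC hC0 J ℓ₁ hω]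
    · refine integral_congr_ae ?_
      filter_upwards [hZ] with ω hω
      rw [apply_obs_eq hD hD0 J' ℓ₂ hω]

lemma IsDriving.indepFun_obs {C D : Set (I × ℝ)} (hC : MeasurableSet C)
    (hC0 : ∀ p ∈ C, 0 ≤ p.2) (hD : MeasurableSet D) (hD0 : ∀ p ∈ D, 0 ≤ p.2)
    (hCD : Disjoint C D) :
    IndepFun (fun ω (i : ObsIndex) => N T Y ω (cell C i))
      (fun ω (i : ObsIndex) => N T Y ω (cell D i)) P := by
  refine IndepFun.process_indepFun_process₀ (fun i => (hTY.measurable_obs hC i).aemeasurable)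
    (fun i => (hTY.measurable_obs hD i).aemeasurable) fun J J' => ?_
  have hm : ∀ J : Finset ObsIndex, Measurable fun (v : J → ℝ) j => ENNReal.ofReal (v j) := fun J =>
    measurable_pi_lambda _ fun j => (measurable_pi_apply j).ennreal_ofReal
  refine ((hTY.indepFun_obs_toReal hC hC0 hD hD0 hCD J J').comp (hm J) (hm J')).congr ?_ ?_
  · filter_upwards [hTY.ae_tendsto_Z] with ω hω
    ext j
    exact ENNReal.ofReal_toReal
      (N_apply_toReal hω (measurableSet_cell hC j) (isTest_cell hC hC0 j)).1
  · filter_upwards [hTY.ae_tendsto_Z] with ω hω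
    ext j
    exact ENNReal.ofReal_toReal
      (N_apply_toReal hω (measurableSet_cell hD j) (isTest_cell hD hD0 j)).1

omit [IsProbabilityMeasure P] hTY mΩ in
-- The counts with mark at most `R` increase to the full count, so the bounded observations
-- determine the restricted measure.
lemma comap_restrict_le {C : Set (I × ℝ)} :
    MeasurableSpace.comap (fun ω => (N T Y ω).restrict C) inferInstance ≤
      MeasurableSpace.comap (fun ω (i : ObsIndex) => N T Y ω (cell C i)) inferInstance := by
  rw [← measurable_iff_comap_le]
  refine Measure.measurable_of_measurable_coe _ fun A hA => ?_
  have h : (fun ω => (N T Y ω).restrict C A) =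
      fun ω => ⨆ R : ℕ, N T Y ω (cell C (⟨A, hA⟩, R)) := by
    ext ω
    rw [Measure.restrict_apply hA, ← Monotone.measure_iUnion]
    · congr 1
      ext p
      simp only [cell, mem_inter_iff, mem_iUnion, mem_ofPred_eq]
      constructor
      · rintro ⟨h1, h2⟩
        obtain ⟨R, hR⟩ := exists_nat_ge p.2
        exact ⟨R, ⟨h2, h1⟩, hR⟩
      · rintro ⟨R, ⟨h1, h2⟩, -⟩
        exact ⟨h2, h1⟩
    · intro R R' hR p hp
      have h1 : p.2 ≤ (R : ℝ) := hp.2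
      exact ⟨hp.1, h1.trans (Nat.cast_le.2 hR)⟩
  rw [h]
  exact Measurable.iSup fun R => (measurable_pi_apply ((⟨A, hA⟩, R) : ObsIndex)).comp
    (comap_measurable (fun ω (i : ObsIndex) => N T Y ω (cell C i)))

/-- The restrictions of the point process to disjoint sets are independent. -/
lemma IsDriving.indepFun_restrict {C D : Set (I × ℝ)} (hC : MeasurableSet C)
    (hC0 : ∀ p ∈ C, 0 ≤ p.2) (hD : MeasurableSet D) (hD0 : ∀ p ∈ D, 0 ≤ p.2)
    (hCD : Disjoint C D) :
    IndepFun (fun ω => (N T Y ω).restrict C) (fun ω => (N T Y ω).restrict D) P :=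
  (IndepFun_iff_Indep _ _ _).2 (indep_of_indep_of_le_left (indep_of_indep_of_le_right
    ((IndepFun_iff_Indep _ _ _).1 (hTY.indepFun_obs hC hC0 hD hD0 hCD)) comap_restrict_le)
    comap_restrict_le)

omit [IsProbabilityMeasure P] in
lemma IsDriving.filt_le (t : I) :
    filt T Y hTY.measurable_T hTY.measurable_Y t ≤
      MeasurableSpace.comap (fun ω => (N T Y ω).restrict (Iic t ×ˢ Ici 0)) inferInstance := by
  refine iSup₂_le fun A hA => ?_
  rw [← measurable_iff_comap_le]
  have h : (fun ω => N T Y ω A) = fun ω => (N T Y ω).restrict (Iic t ×ˢ Ici 0) A := by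
    ext ω
    rw [Measure.restrict_apply hA.1, inter_eq_left.2 hA.2]
  rw [h]
  exact (Measure.measurable_coe hA.1).comp (comap_measurable _)

omit [IsProbabilityMeasure P] in
lemma IsDriving.measurable_restrict_filt (t : I) {C : Set (I × ℝ)} (hC : MeasurableSet C)
    (hCt : C ⊆ Iic t ×ˢ Ici 0) :
    Measurable[filt T Y hTY.measurable_T hTY.measurable_Y t] fun ω => (N T Y ω).restrict C := by
  refine Measure.measurable_of_measurable_coe _ fun A hA => ?_
  simp only [Measure.restrict_apply hA]
  refine measurable_iff_comap_le.2 ?_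
  exact le_iSup₂_of_le (A ∩ C) ⟨hA.inter hC, inter_subset_right.trans hCt⟩ le_rfl

lemma IsDriving.indep_filt_future (s : I) :
    Indep (filt T Y hTY.measurable_T hTY.measurable_Y s)
      (MeasurableSpace.comap (fun ω => (N T Y ω).restrict (slab s 1)) inferInstance) P := by
  have h := hTY.indepFun_restrict (C := Iic s ×ˢ Ici 0) (D := slab s 1)
    (measurableSet_Iic.prod measurableSet_Ici) (fun p hp => hp.2) (measurableSet_slab _ _)
    (fun p hp => hp.2) (Set.disjoint_left.2 fun p h1 h2 =>
      absurd (show (p.1 : ℝ) ≤ s from h1.1) (not_le.2 h2.1.1))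
  exact indep_of_indep_of_le_left ((IndepFun_iff_Indep _ _ _).1 h) (hTY.filt_le s)

omit [IsProbabilityMeasure P] in
lemma IsDriving.measurable_N : Measurable fun ω => N T Y ω :=
  Measure.measurable_of_measurable_coe _ fun _ hA =>
    measurable_N_apply hTY.measurable_T hTY.measurable_Y hA

end Restriction

/-! ### Measurability of the flow -/

section FlowMeasurable

/-- The largest multiple of `2⁻ⁿ` below `x`. -/
noncomputable def dyadicFloor (n : ℕ) (x : ℝ≥0) : ℝ≥0 := (⌊x * 2 ^ n⌋₊ : ℝ≥0) / 2 ^ n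

lemma dyadicFloor_le (n : ℕ) (x : ℝ≥0) : dyadicFloor n x ≤ x := by
  rw [dyadicFloor, div_le_iff₀ (by positivity)]
  exact Nat.floor_le (by positivity)

lemma monotone_dyadicFloor (x : ℝ≥0) : Monotone fun n => dyadicFloor n x := by
  refine monotone_nat_of_le_succ fun n => ?_
  rw [dyadicFloor, dyadicFloor, div_le_div_iff₀ (by positivity) (by positivity), pow_succ,
    ← mul_assoc, mul_right_comm]
  refine mul_le_mul_of_nonneg_right ?_ (by positivity)
  have h : ⌊x * 2 ^ n⌋₊ * 2 ≤ ⌊x * 2 ^ n * 2⌋₊ := by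
    refine Nat.le_floor ?_
    push_cast
    exact mul_le_mul_of_nonneg_right (Nat.floor_le (by positivity)) (by positivity)
  rw [← mul_assoc]
  exact_mod_cast h

lemma tendsto_dyadicFloor (x : ℝ≥0) : Tendsto (fun n => dyadicFloor n x) atTop (𝓝 x) := by
  rw [← NNReal.tendsto_coe]
  have h1 : Tendsto (fun n : ℕ => (x : ℝ) - (1 / 2) ^ n) atTop (𝓝 (x - 0)) :=
    tendsto_const_nhds.sub (tendsto_pow_atTop_nhds_zero_of_lt_one (by norm_num) (by norm_num))
  rw [sub_zero] at h1
  refine tendsto_of_tendsto_of_tendsto_of_le_of_le h1 tendsto_const_nhds (fun n => ?_)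
    fun n => NNReal.coe_le_coe.2 (dyadicFloor_le n x)
  have h2 : (x : ℝ) * 2 ^ n < ⌊x * 2 ^ n⌋₊ + 1 := by
    have := Nat.lt_floor_add_one (x * 2 ^ n)
    exact_mod_cast this
  simp only [dyadicFloor, NNReal.coe_div, NNReal.coe_natCast, NNReal.coe_pow, NNReal.coe_ofNat]
  rw [le_div_iff₀ (by positivity), sub_mul, ← mul_pow]
  norm_num
  linarith

/-- The measure is itself a variable and need not be σ-finite. Rounding `x` down to dyadics leaves
countably many integrands, each measurable in the measure, and monotone convergence recovers the
integral for every measure. -/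
lemma measurable_lintegral_of_monotone {F : ℝ≥0 → I × ℝ → ℝ≥0∞} (hF : ∀ x, Measurable (F x))
    (hmono : ∀ p, Monotone fun x => F x p) (hcont : ∀ p, Continuous fun x => F x p) :
    Measurable fun q : ℝ≥0 × Measure (I × ℝ) => ∫⁻ p, F q.1 p ∂q.2 := by
  have h1 : ∀ q : ℝ≥0 × Measure (I × ℝ), ∫⁻ p, F q.1 p ∂q.2 =
      ⨆ n, ∫⁻ p, F (dyadicFloor n q.1) p ∂q.2 := by
    intro q
    rw [← lintegral_iSup (fun n => hF _)
      fun m n hmn p => hmono p (monotone_dyadicFloor q.1 hmn)]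
    congr 1
    ext p
    exact (iSup_eq_of_tendsto (fun m n hmn => hmono p (monotone_dyadicFloor q.1 hmn))
      (((hcont p).tendsto _).comp (tendsto_dyadicFloor q.1))).symm
  simp only [h1]
  refine Measurable.iSup fun n => ?_
  have h2 : Measurable fun q : ℕ × Measure (I × ℝ) => ∫⁻ p, F ((q.1 : ℝ≥0) / 2 ^ n) p ∂q.2 :=
    measurable_from_prod_countable_right fun k =>
      Measure.measurable_lintegral (hF ((k : ℝ≥0) / 2 ^ n))
  have h3 : Measurable fun q : ℝ≥0 × Measure (I × ℝ) => (⌊q.1 * 2 ^ n⌋₊, q.2) :=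
    (Nat.measurable_floor.comp (measurable_fst.mul_const _)).prodMk measurable_snd
  exact h2.comp h3

variable {γ : ℝ≥0 → ℝ} {ε : ℝ} {K : ℝ≥0}

lemma measurable_G (β : ℝ) : Measurable (G β) := by unfold G; fun_prop

lemma HypWith.measurable_jumpIncr (hγ : HypWith γ ε K) (a b : ℝ) :
    Measurable fun q : ℝ≥0 × Measure (I × ℝ) => jumpIncr γ q.2 a b q.1 := by
  unfold jumpIncr
  refine Measurable.ennreal_toNNReal ?_
  simp only [← lintegral_indicator (measurableSet_slab a b)]
  refine measurable_lintegral_of_monotone (F := fun x => (slab a b).indicator fun p =>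
    ENNReal.ofReal (G (γ x) p.2)) (fun x => ?_) (fun p => ?_) fun p => ?_
  · exact (((measurable_G _).comp measurable_snd).ennreal_ofReal).indicator (measurableSet_slab a b)
  · intro x y hxy
    by_cases hp : p ∈ slab a b
    · simp only [hp, indicator_of_mem]
      exact ENNReal.ofReal_le_ofReal (G_mono (hγ.pos.trans_le (hγ.bounds x).1) (hγ.mono hxy) hp.2)
    · simp [hp]
  · by_cases hp : p ∈ slab a b
    · simp only [hp, indicator_of_mem]
      refine ENNReal.continuous_ofReal.comp ?_
      unfold G
      have hz : (1 + p.2 : ℝ) ≠ 0 := by linarith [hp.2]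
      refine Continuous.rpow continuous_const (Continuous.div continuous_const
        hγ.lipschitz.continuous fun x => (hγ.pos.trans_le (hγ.bounds x).1).ne') fun x => Or.inl hz
    · simp [hp, continuous_const]

lemma HypWith.measurable_euler (hγ : HypWith γ ε K) (s δ : ℝ) (j : ℕ) :
    Measurable fun q : ℝ≥0 × Measure (I × ℝ) => euler γ q.2 s δ q.1 j := by
  induction j with
  | zero => exact measurable_fst
  | succ j ih => exact ih.add ((hγ.measurable_jumpIncr _ _).comp (ih.prodMk measurable_snd))

lemma HypWith.measurable_flow (hγ : HypWith γ ε K) (s t : ℝ) :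
    Measurable fun q : ℝ≥0 × Measure (I × ℝ) => flow γ q.2 s t q.1 :=
  (Measurable.limsup fun _ => (hγ.measurable_euler _ _ _).coe_nnreal_ennreal).ennreal_toNNReal

lemma HypWith.measurable_flow_comp {α : Type*} [MeasurableSpace α] (hγ : HypWith γ ε K) (s t : ℝ)
    {f : α → ℝ≥0} {g : α → Measure (I × ℝ)} (hf : Measurable f) (hg : Measurable g) :
    Measurable fun a => flow γ (g a) s t (f a) := by
  have h1 : Measurable fun a => (f a, g a) := hf.prodMk hg
  have h2 := hγ.measurable_flow s t
  have h3 := Measurable.comp h2 h1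
  exact h3

lemma HypWith.measurable_flow_right (hγ : HypWith γ ε K) (s t : ℝ) (x : ℝ≥0) :
    Measurable fun ν : Measure (I × ℝ) => flow γ ν s t x :=
  hγ.measurable_flow_comp s t (f := fun _ => x) (g := fun ν => ν) measurable_const measurable_id

lemma flow_self (γ : ℝ≥0 → ℝ) (ν : Measure (I × ℝ)) (s : ℝ) (x : ℝ≥0) : flow γ ν s s x = x := by
  have h0 : slab s s = ∅ := by
    ext p
    simp only [slab, mem_ofPred_eq, mem_empty_iff_false, iff_false, not_and]
    intro h
    exact absurd h.1 (not_lt.2 h.2)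
  have h : ∀ j, euler γ ν s 0 x j = x := by
    intro j
    induction j with
    | zero => rfl
    | succ j ih => simp [euler, ih, jumpIncr, h0]
  simp [flow, h]

end FlowMeasurable

/-! ### Stationarity -/

section Stationarity

/-- Rotation of the unit interval by `-s`. -/
noncomputable def rot (s u : I) : I :=
  -- The strict inequality fits the left-open slabs: `s` itself goes to `1`, and `(s, s + t]` goes
  -- onto `(0, t]`.
  ⟨if s < u then (u : ℝ) - s else u + 1 - s, by
    split_ifs with h
    · have h' : (s : ℝ) < u := h
      exact ⟨by linarith, by linarith [u.2.2, s.2.1]⟩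
    · have h' : (u : ℝ) ≤ s := not_lt.1 h
      exact ⟨by linarith [u.2.1, s.2.2], by linarith⟩⟩

lemma measurable_rot (s : I) : Measurable (rot s) := by
  refine Measurable.subtype_mk (Measurable.ite measurableSet_Ioi ?_ ?_) <;> fun_prop

lemma map_rot (s : I) : (volume : Measure I).map (rot s) = volume := by
  have := Measure.isProbabilityMeasure_map (μ := (volume : Measure I))
    (measurable_rot s).aemeasurable
  refine Measure.ext_of_Iic _ _ fun c => ?_
  rw [Measure.map_apply (measurable_rot s) measurableSet_Iic, unitInterval.volume_Iic]
  rcases lt_or_ge (c : ℝ) (1 - s) with hc | hc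
  · have hmem : (s : ℝ) + c ∈ I := ⟨add_nonneg s.2.1 c.2.1, by linarith⟩
    have h : rot s ⁻¹' Iic c = Ioc s ⟨s + c, hmem⟩ := by
      ext u
      simp only [mem_preimage, mem_Iic, rot, mem_Ioc, ← Subtype.coe_le_coe]
      split_ifs with h
      · simp only [h, true_and]
        constructor <;> intro h' <;> linarith
      · simp only [h, false_and, iff_false, not_le]
        linarith [u.2.1]
    rw [h, unitInterval.volume_Ioc]
    simp
  · have hmem : (s : ℝ) + c - 1 ∈ I := ⟨by linarith, by linarith [s.2.2, c.2.2]⟩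
    have h : rot s ⁻¹' Iic c = Ioi s ∪ Iic ⟨s + c - 1, hmem⟩ := by
      ext u
      simp only [mem_preimage, mem_Iic, rot, mem_union, mem_Ioi, ← Subtype.coe_le_coe]
      split_ifs with h
      · simp only [h, true_or, iff_true]
        linarith [u.2.2]
      · simp only [h, false_or]
        constructor <;> intro h' <;> linarith
    rw [h, measure_union _ measurableSet_Iic, unitInterval.volume_Ioi, unitInterval.volume_Iic,
      ← ENNReal.ofReal_add (by linarith [s.2.2]) hmem.1]
    · congr 1
      ring
    · refine Set.disjoint_left.2 fun u hu hu' => ?_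
      have h1 : (s : ℝ) < u := hu
      have h2 : (u : ℝ) ≤ s + c - 1 := hu'
      linarith [c.2.2]

variable {Ω Ω' : Type*} [mΩ : MeasurableSpace Ω] [MeasurableSpace Ω'] {P : Measure Ω}
  {P' : Measure Ω'} [IsProbabilityMeasure P] [IsProbabilityMeasure P']
  {T : ℕ → Ω → I} {Y : ℕ → Ω → ℝ} {T' : ℕ → Ω' → I} {Y' : ℕ → Ω' → ℝ}

omit [IsProbabilityMeasure P] in
lemma IsDriving.rot (hTY : IsDriving P T Y) (s : I) :
    IsDriving P (fun n ω => PoissonSDE.rot s (T n ω)) Y where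
  measurable_T n := (measurable_rot s).comp (hTY.measurable_T n)
  measurable_Y := hTY.measurable_Y
  law_T n := by
    have h := Measure.map_map (μ := P) (measurable_rot s) (hTY.measurable_T n)
    rw [hTY.law_T, map_rot] at h
    exact h.symm
  law_Y := hTY.law_Y
  indep_T := hTY.indep_T.comp (fun _ => PoissonSDE.rot s) fun _ => measurable_rot s
  indep_Y := hTY.indep_Y
  indep := hTY.indep.comp (φ := fun (v : ℕ → I) n => PoissonSDE.rot s (v n))
    (measurable_pi_lambda _ fun n => (measurable_rot s).comp (measurable_pi_apply n)) measurable_id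

lemma IsDriving.law_sequences (hTY : IsDriving P T Y) :
    P.map (fun ω => ((fun n => T n ω), (fun n => Y n ω))) =
      (Measure.infinitePi fun _ : ℕ => (volume : Measure I)).prod
        (Measure.infinitePi fun _ : ℕ => expMeasure 1) := by
  rw [(indepFun_iff_map_prod_eq_prod_map_map
      (measurable_pi_lambda _ hTY.measurable_T).aemeasurable
      (measurable_pi_lambda _ hTY.measurable_Y).aemeasurable).1 hTY.indep,
    (iIndepFun_iff_map_fun_eq_infinitePi_map hTY.measurable_T).1 hTY.indep_T,
    (iIndepFun_iff_map_fun_eq_infinitePi_map hTY.measurable_Y).1 hTY.indep_Y]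
  simp only [hTY.law_T, hTY.law_Y]

/-- The law of the point process does not depend on the driving sequences. -/
lemma IsDriving.law_N_eq (hTY : IsDriving P T Y) (hTY' : IsDriving P' T' Y') :
    P.map (fun ω => N T Y ω) = P'.map (fun ω => N T' Y' ω) := by
  let 𝒩 : (ℕ → I) × (ℕ → ℝ) → Measure (I × ℝ) :=
    N (fun n q => q.1 n) (fun n q => q.2 n)
  have h𝒩 : Measurable 𝒩 := Measure.measurable_of_measurable_coe _ fun A hA =>
    measurable_N_apply (fun n => (measurable_pi_apply n).comp measurable_fst)
      (fun n => (measurable_pi_apply n).comp measurable_snd) hA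
  have h1 := Measure.map_map (μ := P) h𝒩 ((measurable_pi_lambda _ hTY.measurable_T).prodMk
    (measurable_pi_lambda _ hTY.measurable_Y))
  have h2 := Measure.map_map (μ := P') h𝒩 ((measurable_pi_lambda _ hTY'.measurable_T).prodMk
    (measurable_pi_lambda _ hTY'.measurable_Y))
  rw [hTY.law_sequences] at h1
  rw [hTY'.law_sequences] at h2
  exact h1.symm.trans h2

omit mΩ in
lemma euler_rot {ω : Ω} (hω : ∀ n, 0 < T n ω) (γ : ℝ≥0 → ℝ) (s : I) {t δ : ℝ} (hst : s + t ≤ 1)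
    (hδ : 0 ≤ δ) (x : ℝ≥0) {m : ℕ} (hm : m * δ ≤ t) :
    euler γ (N (fun n ω => rot s (T n ω)) Y ω) 0 δ x m = euler γ (N T Y ω) s δ x m := by
  induction m with
  | zero => rfl
  | succ m ih =>
    push_cast at hm
    rw [euler, euler, ih (by linarith), jumpIncr, jumpIncr,
      setLIntegral_N _ (measurableSet_slab _ _), setLIntegral_N _ (measurableSet_slab _ _)]
    congr 3
    ext n
    -- Positivity of `T n ω` matters: time `0` would be rotated to `1 - s`, which lies in `(0, t]`
    -- when `s + t = 1`.
    have hiff : (rot s (T n ω), Z Y n ω) ∈ slab (0 + m * δ) (0 + (m + 1) * δ) ↔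
        (T n ω, Z Y n ω) ∈ slab (s + m * δ) (s + (m + 1) * δ) := by
      have hpos : (0 : ℝ) < T n ω := hω n
      have hmδ : 0 ≤ m * δ := by positivity
      simp only [slab, mem_ofPred_eq, rot, zero_add]
      refine and_congr_left fun _ => ?_
      split_ifs with h
      · have h' : (s : ℝ) < T n ω := h
        constructor <;> rintro ⟨h1, h2⟩ <;> exact ⟨by linarith, by linarith⟩
      · have h' : (T n ω : ℝ) ≤ s := not_lt.1 h
        constructor <;> rintro ⟨h1, h2⟩ <;> exact ⟨by linarith, by linarith⟩
    by_cases h : (T n ω, Z Y n ω) ∈ slab (s + m * δ) (s + (m + 1) * δ)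
    · rw [indicator_of_mem h, indicator_of_mem (hiff.2 h)]
    · rw [indicator_of_notMem h, indicator_of_notMem (mt hiff.1 h)]

omit mΩ in
lemma flow_rot {ω : Ω} (hω : ∀ n, 0 < T n ω) (γ : ℝ≥0 → ℝ) (s : I) {t : ℝ} (ht : 0 ≤ t)
    (hst : s + t ≤ 1) (x : ℝ≥0) :
    flow γ (N (fun n ω => rot s (T n ω)) Y ω) 0 t x = flow γ (N T Y ω) s (s + t) x := by
  unfold flow
  congr 2
  ext m
  rw [sub_zero, add_sub_cancel_left, euler_rot hω γ s hst (by positivity)]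
  push_cast
  exact le_of_eq (by field_simp)

variable {γ : ℝ≥0 → ℝ} {ε : ℝ} {K : ℝ≥0}

/-- Rotated times together with the same marks are again driving sequences, so they give a point
process of the same law; the rotation carries the flow over `(s, s + t]` to the flow over `(0, t]`.
-/
lemma IsDriving.law_flow_shift (hTY : IsDriving P T Y) (hγ : HypWith γ ε K) (s : I) {t : ℝ}
    (ht : 0 ≤ t) (hst : s + t ≤ 1) (x : ℝ≥0) {B : Set ℝ≥0} (hB : MeasurableSet B) :
    P {ω | flow γ (N T Y ω) s (s + t) x ∈ B} = P {ω | flow γ (N T Y ω) 0 t x ∈ B} := by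
  have h1 : P {ω | flow γ (N T Y ω) s (s + t) x ∈ B} =
      P {ω | flow γ (N (fun n ω => PoissonSDE.rot s (T n ω)) Y ω) 0 t x ∈ B} := by
    refine measure_congr ?_
    filter_upwards [hTY.ae_T_pos] with ω hω
    exact congrArg (· ∈ B) (flow_rot hω γ s ht hst x).symm
  have hm : Measurable fun ν : Measure (I × ℝ) => flow γ ν 0 t x :=
    hγ.measurable_flow_right 0 t x
  have h2 := DFunLike.congr_fun (hTY.law_N_eq (hTY.rot s)) ((fun ν => flow γ ν 0 t x) ⁻¹' B)
  rw [Measure.map_apply hTY.measurable_N (hm hB),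
    Measure.map_apply (hTY.rot s).measurable_N (hm hB)] at h2
  rw [h1]
  exact h2.symm

end Stationarity

/-! ### The Markov property at fixed times -/

section Markov

variable {Ω : Type*} [mΩ : MeasurableSpace Ω] {P : Measure Ω} [IsProbabilityMeasure P]
  {T : ℕ → Ω → I} {Y : ℕ → Ω → ℝ} {γ : ℝ≥0 → ℝ} {ε : ℝ} {K : ℝ≥0}

/-- The transition kernels of the flow when the point process has law `μ`. -/
noncomputable def pathKernel (γ : ℝ≥0 → ℝ) (μ : Measure (Measure (I × ℝ))) (t : ℝ) :
    Kernel ℝ≥0 ℝ≥0 :=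
  Kernel.map (Kernel.id ×ₖ Kernel.const ℝ≥0 μ) fun q => flow γ q.2 0 t q.1

lemma IsDriving.pathKernel_eq (hTY : IsDriving P T Y) (hγ : HypWith γ ε K) (t : ℝ) (x : ℝ≥0) :
    pathKernel γ (P.map (N T Y)) t x = P.map fun ω => flow γ (N T Y ω) 0 t x := by
  have := Measure.isProbabilityMeasure_map (μ := P) hTY.measurable_N.aemeasurable
  rw [pathKernel, Kernel.map_apply _ (hγ.measurable_flow 0 t), Kernel.prod_apply, Kernel.id_apply,
    Kernel.const_apply, Measure.dirac_prod, Measure.map_map (hγ.measurable_flow 0 t) (by fun_prop),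
    Measure.map_map (g := (fun q : ℝ≥0 × Measure (I × ℝ) => flow γ q.2 0 t q.1) ∘ Prod.mk x)
      (hγ.measurable_flow_right 0 t x) hTY.measurable_N]
  rfl

omit [IsProbabilityMeasure P] in
lemma IsDriving.measurable_flow (hTY : IsDriving P T Y) (hγ : HypWith γ ε K) (s t : ℝ) (x : ℝ≥0) :
    Measurable fun ω => flow γ (N T Y ω) s t x :=
  hγ.measurable_flow_comp s t (f := fun _ => x) (g := N T Y) measurable_const hTY.measurable_N

omit [IsProbabilityMeasure P] in
lemma IsDriving.measurable_flow_filt (hTY : IsDriving P T Y) (hγ : HypWith γ ε K) (t : I)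
    (x : ℝ≥0) : Measurable[filt T Y hTY.measurable_T hTY.measurable_Y t]
      fun ω => flow γ (N T Y ω) 0 t x := by
  have h1 : (fun ω => flow γ (N T Y ω) 0 t x) =
      fun ω => flow γ ((N T Y ω).restrict (slab 0 t)) 0 t x := by
    ext1 ω
    rw [flow_restrict t.2.1 x subset_rfl]
  rw [h1]
  have h2 : Measurable fun ν : Measure (I × ℝ) => flow γ ν 0 t x :=
    hγ.measurable_flow_right 0 t x
  exact h2.comp (hTY.measurable_restrict_filt t (measurableSet_slab _ _)
    fun p hp => ⟨hp.1.2, hp.2⟩)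

lemma measurable_indicator_one_prodMk {α β : Type*} {m : MeasurableSpace α} [MeasurableSpace β]
    {A : Set α} {f : α → β} (hA : MeasurableSet A) (hf : Measurable f) :
    Measurable fun a => (A.indicator (1 : α → ℝ≥0∞) a, f a) :=
  (measurable_one.indicator hA).prodMk hf

/-- The Markov property of the flow at a fixed time. -/
lemma IsDriving.markov (hTY : IsDriving P T Y) (hγ : HypWith γ ε K) (s : I) {t : ℝ}
    (ht : 0 ≤ t) (hst : s + t ≤ 1) {ξ : Ω → ℝ≥0}
    (hξ : Measurable[filt T Y hTY.measurable_T hTY.measurable_Y s] ξ) {A : Set Ω}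
    (hA : MeasurableSet[filt T Y hTY.measurable_T hTY.measurable_Y s] A) {B : Set ℝ≥0}
    (hB : MeasurableSet B) :
    P (A ∩ {ω | flow γ (N T Y ω) s (s + t) (ξ ω) ∈ B}) =
      ∫⁻ ω in A, pathKernel γ (P.map (N T Y)) t (ξ ω) B ∂P := by
  have hle := (filt T Y hTY.measurable_T hTY.measurable_Y).le s
  -- The indicator of `A` travels with `ξ`, so one independence statement covers the restriction to
  -- `A` as well.
  set V : Ω → ℝ≥0∞ × ℝ≥0 := fun ω => (A.indicator 1 ω, ξ ω) with hV
  set ν : Ω → Measure (I × ℝ) := fun ω => (N T Y ω).restrict (slab s 1) with hν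
  have hmV' : Measurable[filt T Y hTY.measurable_T hTY.measurable_Y s] V :=
    measurable_indicator_one_prodMk hA hξ
  have hmV : Measurable V := hmV'.mono hle le_rfl
  have hmν : Measurable ν := Measure.measurable_of_measurable_coe _ fun B hB => by
    simp only [hν, Measure.restrict_apply hB]
    exact measurable_N_apply hTY.measurable_T hTY.measurable_Y (hB.inter (measurableSet_slab _ _))
  have hind : IndepFun V ν P := (IndepFun_iff_Indep _ _ _).2
    (indep_of_indep_of_le_left (hTY.indep_filt_future s) hmV'.comap_le)
  have hlaw := (indepFun_iff_map_prod_eq_prod_map_map hmV.aemeasurable hmν.aemeasurable).1 hind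
  have hsub : slab s (s + t) ⊆ slab s 1 := fun p hp => ⟨⟨hp.1.1, hp.1.2.trans hst⟩, hp.2⟩
  have hflow : ∀ ω x, flow γ (ν ω) s (s + t) x = flow γ (N T Y ω) s (s + t) x := fun ω x =>
    flow_restrict (by linarith) x hsub
  let Φ : (ℝ≥0∞ × ℝ≥0) × Measure (I × ℝ) → ℝ≥0∞ := fun q =>
    q.1.1 * B.indicator 1 (flow γ q.2 s (s + t) q.1.2)
  have hΦ : Measurable Φ := by
    refine (measurable_fst.comp measurable_fst).mul ((measurable_one.indicator hB).comp ?_)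
    exact hγ.measurable_flow_comp s (s + t)
      (f := fun q : (ℝ≥0∞ × ℝ≥0) × Measure (I × ℝ) => q.1.2) (g := fun q => q.2)
      (measurable_snd.comp measurable_fst) measurable_snd
  have hmA := hle A hA
  have hmξ : Measurable ξ := hξ.mono hle le_rfl
  have hmf : Measurable fun ω => flow γ (N T Y ω) s (s + t) (ξ ω) :=
    hγ.measurable_flow_comp s (s + t) (f := ξ) (g := N T Y) hmξ hTY.measurable_N
  -- Stationarity enters here: from a fixed starting point, the flow over `(s, s + t]` has the law
  -- of the kernel for duration `t`.
  have hk : ∀ x, ∫⁻ v, B.indicator 1 (flow γ v s (s + t) x) ∂(P.map ν) =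
      pathKernel γ (P.map (N T Y)) t x B := by
    intro x
    have hm : Measurable fun v : Measure (I × ℝ) => flow γ v s (s + t) x :=
      hγ.measurable_flow_right _ _ x
    have hm' : Measurable fun v => B.indicator (1 : ℝ≥0 → ℝ≥0∞) (flow γ v s (s + t) x) :=
      (measurable_one.indicator hB).comp hm
    rw [lintegral_map hm' hmν, hTY.pathKernel_eq hγ,
      Measure.map_apply (hTY.measurable_flow hγ 0 t x) hB]
    simp only [hflow]
    have e : (fun ω => B.indicator (1 : ℝ≥0 → ℝ≥0∞) (flow γ (N T Y ω) s (s + t) x)) =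
        {ω | flow γ (N T Y ω) s (s + t) x ∈ B}.indicator 1 := rfl
    have hmS : MeasurableSet {ω | flow γ (N T Y ω) s (s + t) x ∈ B} :=
      hTY.measurable_flow hγ _ _ x hB
    rw [e, lintegral_indicator_one hmS]
    exact hTY.law_flow_shift hγ s ht hst x hB
  have h1 : P (A ∩ {ω | flow γ (N T Y ω) s (s + t) (ξ ω) ∈ B}) = ∫⁻ ω, Φ (V ω, ν ω) ∂P := by
    have hmS : MeasurableSet {ω | flow γ (N T Y ω) s (s + t) (ξ ω) ∈ B} := hmf hB
    rw [← lintegral_indicator_one (hmA.inter hmS)]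
    congr 1
    ext ω
    simp only [Φ, hV, hflow]
    by_cases h1 : ω ∈ A <;> by_cases h2 : flow γ (N T Y ω) s (s + t) (ξ ω) ∈ B <;>
      simp [h1, h2, indicator]
  have := Measure.isProbabilityMeasure_map (μ := P) hmν.aemeasurable
  have hkm : Measurable fun v : ℝ≥0∞ × ℝ≥0 => v.1 * pathKernel γ (P.map (N T Y)) t v.2 B :=
    measurable_fst.mul ((Kernel.measurable_coe _ hB).comp measurable_snd)
  rw [h1, ← lintegral_map (f := Φ) (g := fun ω => (V ω, ν ω)) hΦ (hmV.prodMk hmν), hlaw,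
    lintegral_prod _ hΦ.aemeasurable]
  have h2 : ∀ v : ℝ≥0∞ × ℝ≥0, ∫⁻ y, Φ (v, y) ∂(P.map ν) =
      v.1 * pathKernel γ (P.map (N T Y)) t v.2 B := by
    intro v
    have hm : Measurable fun w : Measure (I × ℝ) => flow γ w s (s + t) v.2 :=
      hγ.measurable_flow_right _ _ v.2
    have hm' : Measurable fun w => B.indicator (1 : ℝ≥0 → ℝ≥0∞) (flow γ w s (s + t) v.2) :=
      (measurable_one.indicator hB).comp hm
    simp only [Φ]
    rw [lintegral_const_mul _ hm', hk]
  simp only [h2]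
  rw [lintegral_map hkm hmV, ← lintegral_indicator hmA]
  congr 1
  ext ω
  by_cases h : ω ∈ A <;> simp [hV, h]

end Markov

/-! ### The transition semigroup -/

section Extension

variable {M : Type*} [Monoid M] {k : ℝ≥0 → M}

/-- Extension to all times of a family defined on `[0,1]`. -/
noncomputable def extendUnit (k : ℝ≥0 → M) (t : ℝ≥0) : M :=
  -- The noise covers only `[0, 1]`, so longer times are cut into equal pieces of length at most
  -- `1`; the added `1` keeps the number of pieces positive at `t = 0`.
  k (t / (⌈t⌉₊ + 1 : ℕ)) ^ (⌈t⌉₊ + 1)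

lemma pow_eq_of_add (h0 : k 0 = 1) (hadd : ∀ s t, s + t ≤ 1 → k (s + t) = k s * k t) (m : ℕ)
    {a : ℝ≥0} (ha : m * a ≤ 1) : k a ^ m = k (m * a) := by
  induction m with
  | zero => simp [h0]
  | succ m ih =>
    push_cast at ha ⊢
    rw [add_mul, one_mul] at ha ⊢
    rw [hadd _ _ ha, pow_succ, ih (le_self_add.trans ha)]

/-- Both sides agree with the power for the common refinement into `m * n` pieces. -/
lemma pow_div_eq_of_add (h0 : k 0 = 1) (hadd : ∀ s t, s + t ≤ 1 → k (s + t) = k s * k t) {t : ℝ≥0}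
    {m n : ℕ} (hm : 0 < m) (hn : 0 < n) (htm : t ≤ m) (htn : t ≤ n) :
    k (t / m) ^ m = k (t / n) ^ n := by
  have key : ∀ {m n : ℕ}, 0 < m → 0 < n → t ≤ m → k (t / m) ^ m = k (t / (m * n)) ^ (n * m) := by
    intro m n hm hn htm
    have hm' : (m : ℝ≥0) ≠ 0 := by exact_mod_cast hm.ne'
    have hn' : (n : ℝ≥0) ≠ 0 := by exact_mod_cast hn.ne'
    have h : (n : ℝ≥0) * (t / (m * n)) = t / m := by field_simp
    have h' : (n : ℝ≥0) * (t / (m * n)) ≤ 1 := by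
      rw [h]
      exact div_le_one_of_le₀ htm zero_le
    rw [pow_mul, pow_eq_of_add h0 hadd n h', h]
  rw [key hm hn htm, key hn hm htn, mul_comm n m, mul_comm (n : ℝ≥0)]

lemma extendUnit_eq_pow (h0 : k 0 = 1) (hadd : ∀ s t, s + t ≤ 1 → k (s + t) = k s * k t) {t : ℝ≥0}
    {n : ℕ} (hn : 0 < n) (htn : t ≤ n) : extendUnit k t = k (t / n) ^ n :=
  pow_div_eq_of_add h0 hadd (Nat.succ_pos _) hn
    ((Nat.le_ceil t).trans (by exact_mod_cast Nat.le_succ _)) htn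

lemma extendUnit_of_le_one (h0 : k 0 = 1) (hadd : ∀ s t, s + t ≤ 1 → k (s + t) = k s * k t)
    {t : ℝ≥0} (ht : t ≤ 1) : extendUnit k t = k t := by
  rw [extendUnit_eq_pow h0 hadd one_pos (by simpa using ht)]
  simp

/-- Both times are cut into the same number of pieces. The factors of the two kinds commute because
addition of times does, so the power of the product splits. -/
lemma extendUnit_add (h0 : k 0 = 1) (hadd : ∀ s t, s + t ≤ 1 → k (s + t) = k s * k t)
    (s t : ℝ≥0) : extendUnit k (s + t) = extendUnit k s * extendUnit k t := by
  set n := ⌈s + t⌉₊ + 1 with hn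
  have hle : s + t ≤ n := (Nat.le_ceil _).trans (by exact_mod_cast Nat.le_succ _)
  have hn0 : 0 < n := Nat.succ_pos _
  have h1 : s / n + t / n ≤ 1 := by
    rw [← add_div]
    exact div_le_one_of_le₀ hle zero_le
  have hcomm : Commute (k (s / n)) (k (t / n)) := by
    have h2 := hadd _ _ h1
    rw [add_comm, hadd _ _ (by rwa [add_comm])] at h2
    exact h2.symm
  rw [extendUnit_eq_pow h0 hadd hn0 hle, extendUnit_eq_pow h0 hadd hn0 (le_self_add.trans hle),
    extendUnit_eq_pow h0 hadd hn0 (le_add_self.trans hle), add_div, hadd _ _ h1, hcomm.mul_pow]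

end Extension

/-! ### Chapman-Kolmogorov equations and first moments. -/

section Semigroup

variable {Ω : Type*} [mΩ : MeasurableSpace Ω] {P : Measure Ω} [IsProbabilityMeasure P]
  {T : ℕ → Ω → I} {Y : ℕ → Ω → ℝ} {γ : ℝ≥0 → ℝ} {ε : ℝ} {K : ℝ≥0}

lemma IsDriving.isMarkovKernel_pathKernel (hTY : IsDriving P T Y) (hγ : HypWith γ ε K) (t : ℝ) :
    IsMarkovKernel (pathKernel γ (P.map (N T Y)) t) := by
  have := Measure.isProbabilityMeasure_map (μ := P) hTY.measurable_N.aemeasurable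
  exact Kernel.IsMarkovKernel.map _ (hγ.measurable_flow 0 t)

lemma IsDriving.pathKernel_zero (hTY : IsDriving P T Y) (hγ : HypWith γ ε K) :
    pathKernel γ (P.map (N T Y)) 0 = Kernel.id := by
  ext1 x
  rw [hTY.pathKernel_eq hγ]
  simp only [flow_self, Measure.map_const, measure_univ, one_smul, Kernel.id_apply]

lemma IsDriving.lintegral_pathKernel (hTY : IsDriving P T Y) (hγ : HypWith γ ε K) (t : ℝ) (x : ℝ≥0)
    {f : ℝ≥0 → ℝ≥0∞} (hf : Measurable f) :
    ∫⁻ y, f y ∂(pathKernel γ (P.map (N T Y)) t x) = ∫⁻ ω, f (flow γ (N T Y ω) 0 t x) ∂P := by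
  rw [hTY.pathKernel_eq hγ, lintegral_map hf (hTY.measurable_flow hγ 0 t x)]

/-- The Markov property of the process started at `x` at time `0`. -/
lemma IsDriving.markov_flow (hTY : IsDriving P T Y) (hγ : HypWith γ ε K) (s : I) {t : ℝ}
    (ht : 0 ≤ t) (hst : s + t ≤ 1) (x : ℝ≥0) {A : Set Ω}
    (hA : MeasurableSet[filt T Y hTY.measurable_T hTY.measurable_Y s] A) {B : Set ℝ≥0}
    (hB : MeasurableSet B) :
    P (A ∩ {ω | flow γ (N T Y ω) 0 (s + t) x ∈ B}) =
      ∫⁻ ω in A, pathKernel γ (P.map (N T Y)) t (flow γ (N T Y ω) 0 s x) B ∂P := by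
  rw [← hTY.markov hγ s ht hst (hTY.measurable_flow_filt hγ s x) hA hB]
  refine measure_congr ?_
  filter_upwards [hTY.ae_goodPath hγ.pos] with ω hω
  have h := flow_flow hγ hω x s.2.1 (le_add_of_nonneg_right ht : (s : ℝ) ≤ s + t)
  exact congrArg (fun y => ω ∈ A ∧ y ∈ B) h.symm

lemma IsDriving.markov_flow_lintegral (hTY : IsDriving P T Y) (hγ : HypWith γ ε K) (s : I) {t : ℝ}
    (ht : 0 ≤ t) (hst : s + t ≤ 1) (x : ℝ≥0) {A : Set Ω}
    (hA : MeasurableSet[filt T Y hTY.measurable_T hTY.measurable_Y s] A) {f : ℝ≥0 → ℝ≥0∞}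
    (hf : Measurable f) :
    ∫⁻ ω in A, f (flow γ (N T Y ω) 0 (s + t) x) ∂P =
      ∫⁻ ω in A, ∫⁻ y, f y ∂(pathKernel γ (P.map (N T Y)) t (flow γ (N T Y ω) 0 s x)) ∂P := by
  have hmA := (filt T Y hTY.measurable_T hTY.measurable_Y).le s A hA
  have hm := hTY.measurable_flow hγ 0 (s + t) x
  have hk : Measurable fun ω => pathKernel γ (P.map (N T Y)) t (flow γ (N T Y ω) 0 s x) :=
    (Kernel.measurable _).comp (hTY.measurable_flow hγ 0 s x)
  have h : (P.restrict A).map (fun ω => flow γ (N T Y ω) 0 (s + t) x) =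
      (P.restrict A).bind fun ω => pathKernel γ (P.map (N T Y)) t (flow γ (N T Y ω) 0 s x) := by
    ext B hB
    rw [Measure.map_apply hm hB, Measure.bind_apply hB hk.aemeasurable,
      Measure.restrict_apply (hm hB), inter_comm]
    exact hTY.markov_flow hγ s ht hst x hA hB
  rw [← lintegral_map hf hm, h, Measure.lintegral_bind hk.aemeasurable hf.aemeasurable]

lemma IsDriving.pathKernel_add (hTY : IsDriving P T Y) (hγ : HypWith γ ε K) {s t : ℝ} (hs : 0 ≤ s)
    (ht : 0 ≤ t) (hst : s + t ≤ 1) :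
    pathKernel γ (P.map (N T Y)) (s + t) =
      pathKernel γ (P.map (N T Y)) t ∘ₖ pathKernel γ (P.map (N T Y)) s := by
  ext x B hB
  have h := hTY.markov_flow hγ ⟨s, hs, by linarith⟩ ht hst x MeasurableSet.univ hB
  rw [Kernel.comp_apply' _ _ _ hB, hTY.lintegral_pathKernel hγ s x (Kernel.measurable_coe _ hB),
    hTY.pathKernel_eq hγ, Measure.map_apply (hTY.measurable_flow hγ 0 (s + t) x) hB]
  rw [univ_inter, Measure.restrict_univ] at h
  exact h

/-- The transition semigroup. -/
noncomputable def transition (γ : ℝ≥0 → ℝ) (μ : Measure (Measure (I × ℝ))) :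
    ℝ≥0 → Kernel ℝ≥0 ℝ≥0 :=
  extendUnit fun t => pathKernel γ μ t

lemma IsDriving.pathKernel_mul (hTY : IsDriving P T Y) (hγ : HypWith γ ε K) (s t : ℝ≥0)
    (hst : s + t ≤ 1) : pathKernel γ (P.map (N T Y)) ((s + t : ℝ≥0) : ℝ) =
      pathKernel γ (P.map (N T Y)) s * pathKernel γ (P.map (N T Y)) t := by
  -- In a product of kernels the right factor acts first, whereas `pathKernel_add` lets the duration
  -- `s` act first; hence the exchange.
  rw [add_comm, NNReal.coe_add, hTY.pathKernel_add hγ t.coe_nonneg s.coe_nonneg (by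
    rw [add_comm]; exact_mod_cast hst)]
  rfl

lemma IsDriving.pathKernel_coe_zero (hTY : IsDriving P T Y) (hγ : HypWith γ ε K) :
    pathKernel γ (P.map (N T Y)) ((0 : ℝ≥0) : ℝ) = 1 :=
  hTY.pathKernel_zero hγ

lemma IsDriving.transition_of_le_one (hTY : IsDriving P T Y) (hγ : HypWith γ ε K) {t : ℝ≥0}
    (ht : t ≤ 1) : transition γ (P.map (N T Y)) t = pathKernel γ (P.map (N T Y)) t :=
  extendUnit_of_le_one (hTY.pathKernel_coe_zero hγ) (hTY.pathKernel_mul hγ) ht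

lemma isMarkovKernel_pow {α : Type*} [MeasurableSpace α] (κ : Kernel α α) [IsMarkovKernel κ]
    (n : ℕ) : IsMarkovKernel (κ ^ n) := by
  induction n with
  | zero => exact inferInstanceAs (IsMarkovKernel (Kernel.id : Kernel α α))
  | succ n ih =>
    rw [pow_succ]
    exact inferInstanceAs (IsMarkovKernel ((κ ^ n) ∘ₖ κ))

lemma IsDriving.isMarkovSemigroup (hTY : IsDriving P T Y) (hγ : HypWith γ ε K) :
    IsMarkovSemigroup (transition γ (P.map (N T Y))) where
  markov t := by
    have := hTY.isMarkovKernel_pathKernel hγ (t / (⌈t⌉₊ + 1 : ℕ) : ℝ≥0)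
    exact isMarkovKernel_pow _ _
  zero := by
    rw [hTY.transition_of_le_one hγ zero_le_one]
    exact hTY.pathKernel_zero hγ
  add s t := by
    rw [add_comm]
    exact extendUnit_add (hTY.pathKernel_coe_zero hγ) (hTY.pathKernel_mul hγ) t s

/-! ### Integrability -/

/-- The constant is the mean of `∑ wt ε (Z n)`, which bounds the total growth of every path whatever
the starting point. Hence powers of the kernels also have finite first moments. -/
lemma IsDriving.exists_lintegral_pathKernel_le (hTY : IsDriving P T Y) (hγ : HypWith γ ε K) :
    ∃ C : ℝ≥0, ∀ t : ℝ, 0 ≤ t → ∀ x : ℝ≥0,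
      ∫⁻ y, (y : ℝ≥0∞) ∂(pathKernel γ (P.map (N T Y)) t x) ≤ x + C := by
  have hC := hTY.tsum_lintegral_wt_lt_top hγ.pos
  refine ⟨(∑' n, ∫⁻ ω, ENNReal.ofReal (wt ε (Z Y n ω)) ∂P).toNNReal, fun t ht x => ?_⟩
  have hm : ∀ n, AEMeasurable (fun ω => ENNReal.ofReal (wt ε (Z Y n ω))) P := fun n =>
    ((measurable_wt.comp (hTY.measurable_Z n)).ennreal_ofReal).aemeasurable
  rw [hTY.lintegral_pathKernel hγ t x measurable_coe_nnreal_ennreal, ENNReal.coe_toNNReal hC.ne,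
    ← lintegral_tsum hm]
  have h1 : ∀ᵐ ω ∂P, (flow γ (N T Y ω) 0 t x : ℝ≥0∞) ≤
      x + ∑' n, ENNReal.ofReal (wt ε (Z Y n ω)) := by
    filter_upwards [hTY.ae_goodPath hγ.pos] with ω hω
    have h2 := flow_le hγ hω ht x
    have h3 : isum (fun n => wt ε (marks Y ω n)) (win (times T ω) 0 t) ≤
        ∑' n, wt ε (marks Y ω n) :=
      Summable.tsum_le_tsum (fun n => Set.indicator_le_self' (fun _ _ => wt_nonneg (hω.nonneg _)) _)
        (hω.summable.indicator _) hω.summable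
    change _ ≤ _ + ∑' n, ENNReal.ofReal (wt ε (marks Y ω n))
    rw [← ENNReal.ofReal_tsum_of_nonneg (fun n => wt_nonneg (hω.nonneg n)) hω.summable,
      ← ENNReal.ofReal_coe_nnreal, ← ENNReal.ofReal_coe_nnreal (p := x),
      ← ENNReal.ofReal_add x.coe_nonneg (tsum_nonneg fun n => wt_nonneg (hω.nonneg n))]
    exact ENNReal.ofReal_le_ofReal (h2.trans (by gcongr))
  refine (lintegral_mono_ae h1).trans_eq ?_
  rw [lintegral_add_left measurable_const]
  simp

lemma lintegral_pow_le {κ : Kernel ℝ≥0 ℝ≥0} [IsMarkovKernel κ] {C : ℝ≥0}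
    (h : ∀ x, ∫⁻ y, (y : ℝ≥0∞) ∂(κ x) ≤ x + C) (n : ℕ) (x : ℝ≥0) :
    ∫⁻ y, (y : ℝ≥0∞) ∂((κ ^ n) x) ≤ x + n * C := by
  induction n generalizing x with
  | zero =>
    have : (κ ^ 0) x = Measure.dirac x := Kernel.id_apply x
    rw [this, lintegral_dirac' _ measurable_coe_nnreal_ennreal]
    simp
  | succ n ih =>
    have e : (κ ^ (n + 1)) x = ((κ ^ n) ∘ₖ κ) x := by rw [pow_succ]; rfl
    rw [e, Kernel.lintegral_comp _ _ _ measurable_coe_nnreal_ennreal]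
    calc ∫⁻ b, ∫⁻ c, (c : ℝ≥0∞) ∂((κ ^ n) b) ∂(κ x) ≤ ∫⁻ b, ((b : ℝ≥0∞) + n * C) ∂(κ x) :=
          lintegral_mono fun b => ih b
      _ ≤ x + C + n * C := by
          rw [lintegral_add_left measurable_coe_nnreal_ennreal, lintegral_const, measure_univ,
            mul_one]
          gcongr
          exact h x
      _ = _ := by push_cast; ring

lemma integrable_of_lipschitz {μ : Measure ℝ≥0} [IsFiniteMeasure μ]
    (hμ : ∫⁻ y, (y : ℝ≥0∞) ∂μ < ∞) {φ : ℝ≥0 → ℝ} {L : ℝ≥0} (hφ : LipschitzWith L φ) :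
    Integrable φ μ := by
  have h1 : Integrable (fun y : ℝ≥0 => (y : ℝ)) μ := by
    refine ⟨by fun_prop, ?_⟩
    simpa [HasFiniteIntegral] using hμ
  refine ((h1.const_mul (L : ℝ)).add (integrable_const |φ 0|)).mono'
    hφ.continuous.aestronglyMeasurable (Eventually.of_forall fun y => ?_)
  have h2 := hφ.dist_le_mul y 0
  rw [Real.dist_eq, NNReal.dist_eq, NNReal.coe_zero, sub_zero, abs_of_nonneg y.coe_nonneg] at h2
  have h3 := abs_sub_abs_le_abs_sub (φ y) (φ 0)
  simp only [Pi.add_apply, Real.norm_eq_abs]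
  linarith

lemma IsDriving.integrable_transition (hTY : IsDriving P T Y) (hγ : HypWith γ ε K) {φ : ℝ≥0 → ℝ}
    {L : ℝ≥0} (hφ : LipschitzWith L φ) (t y : ℝ≥0) :
    Integrable φ (transition γ (P.map (N T Y)) t y) := by
  obtain ⟨C, hC⟩ := hTY.exists_lintegral_pathKernel_le hγ
  have := hTY.isMarkovKernel_pathKernel hγ (t / (⌈t⌉₊ + 1 : ℕ) : ℝ≥0)
  have := (hTY.isMarkovSemigroup hγ).markov t
  have h : ∫⁻ x, (x : ℝ≥0∞) ∂(transition γ (P.map (N T Y)) t y) ≤ _ :=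
    lintegral_pow_le (hC _ (NNReal.coe_nonneg _)) _ y
  refine integrable_of_lipschitz (h.trans_lt ?_) hφ
  exact ENNReal.add_lt_top.2 ⟨ENNReal.coe_lt_top,
    ENNReal.mul_lt_top (ENNReal.natCast_lt_top _) ENNReal.coe_lt_top⟩

end Semigroup

/-! ### The generator -/

section FirstJump

variable {τ : ℕ → ℝ} {b : ℕ → ℝ → ℝ} {h : ℕ → ℝ} {L : ℝ}

/-- The indices of a set that are not the smallest one. -/
def laterIndices (W : Set ℕ) : Set ℕ := {n | n ∈ W ∧ ∃ m < n, m ∈ W}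

/-- Over a short time the solution is governed by its point of smallest index. -/
lemma IsJumpField.abs_sub_isum_le (hb : IsJumpField b h L) (hh : ∀ n, h n ≤ 1) (x t : ℝ)
    {f : ℝ → ℝ} {C : ℝ} (hC : 0 ≤ C) (hf : ∀ x y, |f x - f y| ≤ C * |x - y|) :
    |f (value τ b 0 x t) - f x - isum (fun n => f (x + b n x) - f x) (win τ 0 t)| ≤
      C * (L + 2) * isum h (laterIndices (win τ 0 t)) := by
  classical
  set W := win τ 0 t with hW
  set S := laterIndices W with hS
  have hL := hb.const_nonneg
  have hR : 0 ≤ isum h S := isum_nonneg fun n _ => hb.h_nonneg n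
  set a := leftSol τ b 0 x with ha
  have hv : value τ b 0 x t = x + isum (fun m => b m (a m)) W := rfl
  rcases W.eq_empty_or_nonempty with hE | hne
  · rw [hv, hE, isum_empty, isum_empty]
    simp only [add_zero, sub_self, abs_zero]
    positivity
  -- The point of smallest index is singled out rather than the earliest, since the times may be
  -- dense and have no first element. All other points together can move its left limit away from
  -- `x` by at most `isum h S`.
  have hmem : sInf W ∈ W := Nat.sInf_mem hne
  set n₀ := sInf W with hn₀
  have hS' : ∀ n, n ∈ S ↔ n ∈ W ∧ n ≠ n₀ := by
    intro n
    constructor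
    · rintro ⟨h1, m, hm, hmW⟩
      exact ⟨h1, ((Nat.sInf_le hmW).trans_lt hm).ne'⟩
    · rintro ⟨h1, h2⟩
      exact ⟨h1, n₀, lt_of_le_of_ne (Nat.sInf_le h1) h2.symm, hmem⟩
  have hWS : W = {n₀} ∪ S := by
    ext n
    simp only [mem_union, mem_singleton_iff, hS']
    by_cases hn : n = n₀
    · simp [hn, hmem]
    · simp [hn]
  have hdisj : Disjoint {n₀} S := Set.disjoint_singleton_left.2 fun hn => ((hS' _).1 hn).2 rfl
  have hsingle : ∀ u : ℕ → ℝ, isum u {n₀} = u n₀ := fun u => by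
    rw [isum, tsum_eq_single n₀ fun n hn => by simp [hn]]
    simp
  have hsplit : ∀ {u : ℕ → ℝ}, Summable u → isum u W = u n₀ + isum u S := fun hu => by
    rw [hWS, isum_union hu hdisj, hsingle]
  have hfs : Summable fun n => f (x + b n x) - f x := by
    refine Summable.of_norm_bounded (hb.summable.mul_left C) fun n => ?_
    refine (hf _ _).trans (mul_le_mul_of_nonneg_left ?_ hC)
    rw [add_sub_cancel_left, abs_of_nonneg (hb.nonneg n x)]
    exact hb.le n x
  have h1 : |a n₀ - x| ≤ isum h S := by
    have e : a n₀ = x + isum (fun m => b m (a m)) (winLeft τ 0 (τ n₀)) :=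
      hb.isLeftSol_leftSol τ 0 x n₀
    rw [e, add_sub_cancel_left, abs_of_nonneg (hb.isum_apply_nonneg _ _)]
    refine (hb.isum_apply_le _ _).trans (isum_mono_set hb.summable hb.h_nonneg fun n hn => ?_)
    refine (hS' n).2 ⟨⟨hn.1, hn.2.le.trans hmem.2⟩, ?_⟩
    rintro rfl
    exact lt_irrefl _ hn.2
  have h2 : |b n₀ (a n₀) - b n₀ x| ≤ L * isum h S := by
    refine (hb.lip _ _ _).trans ?_
    have := mul_le_mul_of_nonneg_left (hh n₀) hL
    rw [mul_one] at this
    exact mul_le_mul this h1 (abs_nonneg _) hL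
  have h3 : |value τ b 0 x t - (x + b n₀ x)| ≤ (L + 1) * isum h S := by
    rw [hv, hsplit (hb.summable_apply a)]
    have h4 : 0 ≤ isum (fun m => b m (a m)) S := hb.isum_apply_nonneg _ _
    have h5 : isum (fun m => b m (a m)) S ≤ isum h S := hb.isum_apply_le _ _
    rw [show x + (b n₀ (a n₀) + isum (fun m => b m (a m)) S) - (x + b n₀ x) =
      (b n₀ (a n₀) - b n₀ x) + isum (fun m => b m (a m)) S by ring]
    refine (abs_add_le _ _).trans ?_
    rw [abs_of_nonneg h4]
    linarith
  have h6 : |isum (fun n => f (x + b n x) - f x) S| ≤ C * isum h S := by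
    have := abs_isum_sub_le (A := S) hfs (v := fun _ => 0) summable_zero (hb.summable.mul_left C)
      fun n _ => by
        rw [sub_zero]
        refine (hf _ _).trans (mul_le_mul_of_nonneg_left ?_ hC)
        rw [add_sub_cancel_left, abs_of_nonneg (hb.nonneg n x)]
        exact hb.le n x
    rw [isum_mul_left] at this
    simpa [isum] using this
  rw [hsplit hfs]
  have h7 := (hf (value τ b 0 x t) (x + b n₀ x)).trans (mul_le_mul_of_nonneg_left h3 hC)
  rw [show f (value τ b 0 x t) - f x -
    (f (x + b n₀ x) - f x + isum (fun n => f (x + b n x) - f x) S) =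
    (f (value τ b 0 x t) - f (x + b n₀ x)) - isum (fun n => f (x + b n x) - f x) S by ring]
  refine (abs_sub _ _).trans ?_
  nlinarith

end FirstJump

/-! ### From marks to jump sizes. -/

section ChangeOfVariables

/-- The substitution `z = u^(-β) - 1` inverts `u = G β z` and maps `(0, 1)` onto `(0, ∞)`; the
density `β * u^(-1 - β)` of the generator is its Jacobian. -/
lemma setIntegral_G {β : ℝ} (hβ : 0 < β) (g : ℝ → ℝ) :
    ∫ z in Ioi (0 : ℝ), g (G β z) = ∫ u in (0 : ℝ)..1, g u * (β * u ^ (-1 - β)) := by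
  have himg : (fun u : ℝ => u ^ (-β) - 1) '' Ioo 0 1 = Ioi 0 := by
    ext z
    simp only [mem_image, mem_Ioo, mem_Ioi]
    constructor
    · rintro ⟨u, ⟨h0, h1⟩, rfl⟩
      have := Real.one_lt_rpow_of_pos_of_lt_one_of_neg h0 h1 (neg_lt_zero.2 hβ)
      linarith
    · intro hz
      refine ⟨(1 + z) ^ (-1 / β), ⟨Real.rpow_pos_of_pos (by linarith) _,
        Real.rpow_lt_one_of_one_lt_of_neg (by linarith)
          (div_neg_of_neg_of_pos (by norm_num) hβ)⟩, ?_⟩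
      rw [← Real.rpow_mul (by linarith), show -1 / β * -β = 1 by field_simp, Real.rpow_one]
      ring
  have hinj : InjOn (fun u : ℝ => u ^ (-β) - 1) (Ioo 0 1) := by
    intro u hu v hv huv
    have h1 : u ^ (-β) = v ^ (-β) := by simpa using huv
    exact Real.rpow_left_injOn (neg_ne_zero.2 hβ.ne') hu.1.le hv.1.le h1
  have hder : ∀ u ∈ Ioo (0 : ℝ) 1,
      HasDerivWithinAt (fun u : ℝ => u ^ (-β) - 1) (-β * u ^ (-β - 1)) (Ioo 0 1) u := fun u hu =>
    ((Real.hasDerivAt_rpow_const (Or.inl hu.1.ne')).sub_const 1).hasDerivWithinAt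
  have h := integral_image_eq_integral_abs_deriv_smul measurableSet_Ioo hder hinj
    (fun z => g (G β z))
  rw [himg] at h
  rw [h, intervalIntegral.integral_of_le zero_le_one, integral_Ioc_eq_integral_Ioo]
  refine setIntegral_congr_fun measurableSet_Ioo fun u hu => ?_
  have hu0 : 0 < u := hu.1
  have hG : G β (u ^ (-β) - 1) = u := by
    rw [G, add_sub_cancel, ← Real.rpow_mul hu0.le, show -β * (-1 / β) = 1 by field_simp,
      Real.rpow_one]
  have habs : |-β * u ^ (-β - 1)| = β * u ^ (-1 - β) := by
    rw [abs_mul, abs_neg, abs_of_pos hβ, abs_of_pos (Real.rpow_pos_of_pos hu0 _)]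
    congr 2
    ring
  simp only [hG, habs, smul_eq_mul]
  ring

end ChangeOfVariables

/-! ### Short-time expansion of the semigroup. -/

section Generator

variable {Ω : Type*} [mΩ : MeasurableSpace Ω] {P : Measure Ω} [IsProbabilityMeasure P]
  {T : ℕ → Ω → I} {Y : ℕ → Ω → ℝ} {γ : ℝ≥0 → ℝ} {ε : ℝ} {K : ℝ≥0}

/-- Expected weight of the `n`-th point. -/
noncomputable def meanWt (P : Measure Ω) (Y : ℕ → Ω → ℝ) (ε : ℝ) (n : ℕ) : ℝ :=
  (∫⁻ ω, ENNReal.ofReal (wt ε (Z Y n ω)) ∂P).toReal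

omit [IsProbabilityMeasure P] in
lemma meanWt_nonneg (n : ℕ) : 0 ≤ meanWt P Y ε n := ENNReal.toReal_nonneg

lemma IsDriving.summable_meanWt (hTY : IsDriving P T Y) (hε : 0 < ε) :
    Summable (meanWt P Y ε) :=
  ENNReal.summable_toReal (hTY.tsum_lintegral_wt_lt_top hε).ne

lemma IsDriving.ofReal_meanWt (hTY : IsDriving P T Y) (hε : 0 < ε) (n : ℕ) :
    ENNReal.ofReal (meanWt P Y ε n) = ∫⁻ ω, ENNReal.ofReal (wt ε (Z Y n ω)) ∂P :=
  ENNReal.ofReal_toReal (ENNReal.ne_top_of_tsum_ne_top (hTY.tsum_lintegral_wt_lt_top hε).ne n)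

omit [IsProbabilityMeasure P] in
lemma IsDriving.indepFun_T_Z (hTY : IsDriving P T Y) (n : ℕ) :
    IndepFun (fun ω m => T m ω) (Z Y n) P :=
  hTY.indep.comp (φ := id) (ψ := fun v : ℕ → ℝ => ∑ i ∈ Finset.range (n + 1), v i) measurable_id
    (Finset.measurable_sum _ fun i _ => measurable_pi_apply i)

omit [IsProbabilityMeasure P] in
lemma IsDriving.measure_T_le (hTY : IsDriving P T Y) (n : ℕ) {t : ℝ} (h0 : 0 ≤ t) (h1 : t ≤ 1) :
    P {ω | (T n ω : ℝ) ≤ t} = ENNReal.ofReal t := by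
  have h := hTY.measure_T_preimage n (s := Iic (⟨t, h0, h1⟩ : I)) measurableSet_Iic
  rw [unitInterval.volume_Iic] at h
  exact h

omit [IsProbabilityMeasure P] in
-- The event requires `T n ≤ t`, of probability `t`. It also requires `T m ≤ t` for one of the `n`
-- smaller indices, and each such pair costs `t ^ 2` by independence.
lemma IsDriving.measure_laterIndices_le (hTY : IsDriving P T Y) (n : ℕ) {t : ℝ} (h0 : 0 ≤ t)
    (h1 : t ≤ 1) : P {ω | n ∈ laterIndices (win (times T ω) 0 t)} ≤
      ENNReal.ofReal (t * min 1 (n * t)) := by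
  have hle : ∀ {ω k}, k ∈ win (times T ω) 0 t → (T k ω : ℝ) ≤ t := fun h => h.2
  rw [mul_min_of_nonneg _ _ h0, mul_one, ENNReal.ofReal_min]
  refine le_min ?_ ?_
  · rw [← hTY.measure_T_le n h0 h1]
    exact measure_mono fun ω hω => hle hω.1
  · have hsub : {ω | n ∈ laterIndices (win (times T ω) 0 t)} ⊆
        ⋃ m ∈ Finset.range n, {ω | (T n ω : ℝ) ≤ t} ∩ {ω | (T m ω : ℝ) ≤ t} := by
      rintro ω ⟨h2, m, hm, h3⟩
      simp only [mem_iUnion, Finset.mem_range]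
      exact ⟨m, hm, hle h2, hle h3⟩
    refine (measure_mono hsub).trans ((measure_biUnion_finset_le _ _).trans ?_)
    have hone : ∀ m ∈ Finset.range n, P ({ω | (T n ω : ℝ) ≤ t} ∩ {ω | (T m ω : ℝ) ≤ t}) =
        ENNReal.ofReal (t * t) := by
      intro m hm
      have hind := hTY.indep_T.indepFun (Finset.mem_range.1 hm).ne'
      have := hind.measure_inter_preimage_eq_mul (Iic (⟨t, h0, h1⟩ : I)) (Iic (⟨t, h0, h1⟩ : I))
        measurableSet_Iic measurableSet_Iic
      rw [hTY.measure_T_preimage n measurableSet_Iic, hTY.measure_T_preimage m measurableSet_Iic,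
        unitInterval.volume_Iic, ← ENNReal.ofReal_mul h0] at this
      exact this
    rw [Finset.sum_congr rfl hone, Finset.sum_const, Finset.card_range, nsmul_eq_mul,
      ← ENNReal.ofReal_natCast, ← ENNReal.ofReal_mul (Nat.cast_nonneg n)]
    exact ENNReal.ofReal_le_ofReal (le_of_eq (by ring))

/-- Membership in the later indices depends only on the times, which are independent of the marks,
so the expectation of each term factors. The remaining series tends to `0` with `t` by dominated
convergence, which makes the whole bound `o(t)`. -/
lemma IsDriving.lintegral_laterIndices_le (hTY : IsDriving P T Y) (hε : 0 < ε) {t : ℝ} (h0 : 0 ≤ t)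
    (h1 : t ≤ 1) :
    ∫⁻ ω, ENNReal.ofReal (isum (fun n => wt ε (marks Y ω n))
      (laterIndices (win (times T ω) 0 t))) ∂P ≤
      ENNReal.ofReal (t * ∑' n, meanWt P Y ε n * min 1 (n * t)) := by
  have hsum : Summable fun n : ℕ => meanWt P Y ε n * min 1 (n * t) :=
    Summable.of_nonneg_of_le (fun n => mul_nonneg (meanWt_nonneg n) (by positivity))
      (fun n => mul_le_of_le_one_right (meanWt_nonneg n) (min_le_left _ _))
      (hTY.summable_meanWt hε)
  let E : ℕ → Set (ℕ → I) := fun n => {v | n ∈ laterIndices (win (fun k => (v k : ℝ)) 0 t)}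
  have hE : ∀ n, MeasurableSet (E n) := by
    intro n
    have hw : ∀ k, MeasurableSet {v : ℕ → I | k ∈ win (fun k => (v k : ℝ)) 0 t} := fun k => by
      have hm : Measurable fun v : ℕ → I => (v k : ℝ) := by fun_prop
      exact (measurableSet_lt measurable_const hm).inter (measurableSet_le hm measurable_const)
    have : E n = {v : ℕ → I | n ∈ win (fun k => (v k : ℝ)) 0 t} ∩
        ⋃ m ∈ Finset.range n, {v : ℕ → I | m ∈ win (fun k => (v k : ℝ)) 0 t} := by
      ext v
      simp [E, laterIndices]
    rw [this]
    exact (hw n).inter (Finset.measurableSet_biUnion _ fun m _ => hw m)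
  have hmT : Measurable fun ω m => T m ω := measurable_pi_lambda _ hTY.measurable_T
  have hmw : ∀ n, Measurable fun ω => ENNReal.ofReal (wt ε (Z Y n ω)) := fun n =>
    (measurable_wt.comp (hTY.measurable_Z n)).ennreal_ofReal
  have hmE : ∀ n, Measurable fun ω => (E n).indicator (1 : (ℕ → I) → ℝ≥0∞) fun m => T m ω :=
    fun n => (measurable_one.indicator (hE n)).comp hmT
  have hmp : ∀ n, AEMeasurable (fun ω => (E n).indicator (1 : (ℕ → I) → ℝ≥0∞) (fun m => T m ω) *
      ENNReal.ofReal (wt ε (Z Y n ω))) P := fun n => ((hmE n).mul (hmw n)).aemeasurable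
  have h2 : ∀ᵐ ω ∂P, ENNReal.ofReal (isum (fun n => wt ε (marks Y ω n))
      (laterIndices (win (times T ω) 0 t))) =
      ∑' n, (E n).indicator (1 : (ℕ → I) → ℝ≥0∞) (fun m => T m ω) *
        ENNReal.ofReal (wt ε (Z Y n ω)) := by
    filter_upwards [hTY.ae_goodPath hε] with ω hω
    rw [isum, ENNReal.ofReal_tsum_of_nonneg
      (fun n => indicator_nonneg (fun n _ => wt_nonneg (hω.nonneg n)) n) (hω.summable.indicator _)]
    congr 1
    ext n
    have hiff : (fun m => T m ω) ∈ E n ↔ n ∈ laterIndices (win (times T ω) 0 t) := Iff.rfl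
    by_cases hn : n ∈ laterIndices (win (times T ω) 0 t)
    · rw [indicator_of_mem hn, indicator_of_mem (hiff.2 hn), Pi.one_apply, one_mul]
      rfl
    · rw [indicator_of_notMem hn, indicator_of_notMem (mt hiff.1 hn), zero_mul, ENNReal.ofReal_zero]
  rw [lintegral_congr_ae h2, lintegral_tsum hmp,
    ← tsum_mul_left, ENNReal.ofReal_tsum_of_nonneg (fun n => mul_nonneg h0
      (mul_nonneg (meanWt_nonneg n) (by positivity))) (hsum.mul_left t)]
  refine ENNReal.tsum_le_tsum fun n => ?_
  have hind : IndepFun (fun ω => (E n).indicator (1 : (ℕ → I) → ℝ≥0∞) fun m => T m ω)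
      (fun ω => ENNReal.ofReal (wt ε (Z Y n ω))) P :=
    (hTY.indepFun_T_Z n).comp (measurable_one.indicator (hE n)) measurable_wt.ennreal_ofReal
  have h3 := lintegral_mul_eq_lintegral_mul_lintegral_of_indepFun (hmE n) (hmw n) hind
  simp only [Pi.mul_apply] at h3
  rw [h3, ← hTY.ofReal_meanWt hε]
  have h4 : ∫⁻ ω, (E n).indicator (1 : (ℕ → I) → ℝ≥0∞) (fun m => T m ω) ∂P =
      P {ω | n ∈ laterIndices (win (times T ω) 0 t)} :=
    lintegral_indicator_one (hmT (hE n))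
  rw [h4, show t * (meanWt P Y ε n * min 1 (n * t)) = t * min 1 (n * t) * meanWt P Y ε n by ring,
    ENNReal.ofReal_mul (by positivity)]
  gcongr
  exact hTY.measure_laterIndices_le n h0 h1

lemma IsDriving.integrable_wt (hTY : IsDriving P T Y) (hε : 0 < ε) (n : ℕ) :
    Integrable (fun ω => wt ε (Z Y n ω)) P := by
  refine ⟨(measurable_wt.comp (hTY.measurable_Z n)).aestronglyMeasurable, ?_⟩
  rw [hasFiniteIntegral_iff_ofReal]
  · rw [← hTY.ofReal_meanWt hε n]
    exact ENNReal.ofReal_lt_top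
  · filter_upwards [hTY.ae_Z_nonneg] with ω hω
    exact wt_nonneg (hω n)

omit [IsProbabilityMeasure P] in
lemma IsDriving.integral_wt (hTY : IsDriving P T Y) (n : ℕ) :
    ∫ ω, wt ε (Z Y n ω) ∂P = meanWt P Y ε n := by
  rw [meanWt, integral_eq_lintegral_of_nonneg_ae]
  · filter_upwards [hTY.ae_Z_nonneg] with ω hω
    exact wt_nonneg (hω n)
  · exact (measurable_wt.comp (hTY.measurable_Z n)).aestronglyMeasurable

lemma IsDriving.integrable_tsum_wt (hTY : IsDriving P T Y) (hε : 0 < ε) :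
    Integrable (fun ω => ∑' n, wt ε (Z Y n ω)) P := by
  refine ⟨(Measurable.tsum fun n => measurable_wt.comp (hTY.measurable_Z n)).aestronglyMeasurable,
    ?_⟩
  rw [hasFiniteIntegral_iff_ofReal]
  · have hm : ∀ n, AEMeasurable (fun ω => ENNReal.ofReal (wt ε (Z Y n ω))) P := fun n =>
      ((measurable_wt.comp (hTY.measurable_Z n)).ennreal_ofReal).aemeasurable
    have h : ∀ᵐ ω ∂P, ENNReal.ofReal (∑' n, wt ε (Z Y n ω)) =
        ∑' n, ENNReal.ofReal (wt ε (Z Y n ω)) := by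
      filter_upwards [hTY.ae_goodPath hε] with ω hω
      exact ENNReal.ofReal_tsum_of_nonneg (fun n => wt_nonneg (hω.nonneg n)) hω.summable
    rw [lintegral_congr_ae h, lintegral_tsum hm]
    exact hTY.tsum_lintegral_wt_lt_top hε
  · filter_upwards [hTY.ae_Z_nonneg] with ω hω
    exact tsum_nonneg fun n => wt_nonneg (hω n)

/-- The compensation formula for the points in a short time interval. -/
lemma IsDriving.integral_isum_win (hTY : IsDriving P T Y) (hε : 0 < ε) {t : ℝ} (h0 : 0 ≤ t)
    (h1 : t ≤ 1) {g : ℝ → ℝ} (hg : Measurable g) {C : ℝ} (hC : ∀ z, 0 ≤ z → |g z| ≤ C * wt ε z) :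
    Integrable (fun ω => isum (fun n => g (Z Y n ω)) (win (times T ω) 0 t)) P ∧
    ∫ ω, isum (fun n => g (Z Y n ω)) (win (times T ω) 0 t) ∂P = t * ∫ z in Ioi 0, g z := by
  set S : Set I := Ioc 0 ⟨t, h0, h1⟩ with hS
  have hmS : MeasurableSet S := measurableSet_Ioc
  set F : ℕ → Ω → ℝ := fun n ω => S.indicator 1 (T n ω) * g (Z Y n ω) with hF
  have hFm : ∀ n, Measurable (F n) := fun n =>
    ((measurable_one.indicator hmS).comp (hTY.measurable_T n)).mul (hg.comp (hTY.measurable_Z n))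
  have hFS : ∀ ω, isum (fun n => g (Z Y n ω)) (win (times T ω) 0 t) = ∑' n, F n ω := by
    intro ω
    rw [isum]
    congr 1
    ext n
    have hiff : T n ω ∈ S ↔ n ∈ win (times T ω) 0 t := Iff.rfl
    by_cases hn : n ∈ win (times T ω) 0 t
    · simp [hF, hn, hiff.2 hn]
    · simp [hF, hn, mt hiff.1 hn]
  have hFle : ∀ᵐ ω ∂P, ∀ n, ‖F n ω‖ ≤ C * wt ε (Z Y n ω) := by
    filter_upwards [hTY.ae_Z_nonneg] with ω hω n
    have hb := hC _ (hω n)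
    by_cases hn : T n ω ∈ S
    · simpa [hF, hn] using hb
    · simpa [hF, hn] using (abs_nonneg _).trans hb
  have hFint : ∀ n, Integrable (F n) P := fun n =>
    ((hTY.integrable_wt hε n).const_mul C).mono' (hFm n).aestronglyMeasurable
      (hFle.mono fun ω hω => hω n)
  have hFsum : Summable fun n => ∫ ω, ‖F n ω‖ ∂P := by
    refine Summable.of_nonneg_of_le (fun n => integral_nonneg fun ω => norm_nonneg _) (fun n => ?_)
      ((hTY.summable_meanWt hε).mul_left C)
    rw [← hTY.integral_wt, ← integral_const_mul]
    exact integral_mono_ae (hFint n).norm ((hTY.integrable_wt hε n).const_mul C)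
      (hFle.mono fun ω hω => hω n)
  have hsum := hasSum_integral_of_summable_integral_norm hFint hFsum
  have hmean : ∀ n, ∫ ω, F n ω ∂P = t * ∫ ω, g (Z Y n ω) ∂P := by
    intro n
    have hind : IndepFun (T n) (Z Y n) P :=
      (hTY.indepFun_T_Z n).comp (φ := fun v : ℕ → I => v n) (ψ := id) (measurable_pi_apply n)
        measurable_id
    have h2 := hind.integral_fun_comp_mul_comp (hTY.measurable_T n).aemeasurable
      (hTY.measurable_Z n).aemeasurable (f := S.indicator (1 : I → ℝ)) (g := g)
      (measurable_one.indicator hmS).aestronglyMeasurable hg.aestronglyMeasurable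
    have h3 : ∫ ω, S.indicator (1 : I → ℝ) (T n ω) ∂P = t := by
      have h4 : (fun ω => S.indicator (1 : I → ℝ) (T n ω)) = (T n ⁻¹' S).indicator 1 := rfl
      rw [h4, integral_indicator_one (hTY.measurable_T n hmS), Measure.real,
        hTY.measure_T_preimage n hmS, hS, unitInterval.volume_Ioc]
      simp [h0]
    rw [h3] at h2
    exact h2
  have hgint : Integrable g (Measure.sum fun n => P.map (Z Y n)) := by
    rw [hTY.sum_law_Z]
    have hw : Integrable (wt ε) (volume.restrict (Ioi 0)) := by
      refine ⟨measurable_wt.aestronglyMeasurable, ?_⟩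
      rw [hasFiniteIntegral_iff_ofReal]
      · exact lintegral_wt_lt_top hε
      · filter_upwards [ae_restrict_mem measurableSet_Ioi] with z hz
        exact wt_nonneg (le_of_lt hz)
    refine (hw.const_mul C).mono' hg.aestronglyMeasurable ?_
    filter_upwards [ae_restrict_mem measurableSet_Ioi] with z hz
    exact hC z (le_of_lt hz)
  -- Since the laws of the `Z n` superpose to Lebesgue measure, the means of `g (Z n)` add up to the
  -- integral of `g`.
  have hsum2 := (hasSum_integral_measure hgint).mul_left t
  rw [hTY.sum_law_Z] at hsum2
  simp only [integral_map (hTY.measurable_Z _).aemeasurable hg.aestronglyMeasurable, ← hmean]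
    at hsum2
  simp only [hFS]
  refine ⟨?_, hsum.unique hsum2⟩
  refine ((hTY.integrable_tsum_wt hε).const_mul C).mono'
    (Measurable.tsum hFm).aestronglyMeasurable ?_
  filter_upwards [hFle, hTY.ae_goodPath hε] with ω hω hgood
  rw [← tsum_mul_left]
  exact tsum_of_norm_bounded (hgood.summable.mul_left C).hasSum hω

variable {φ : ℝ≥0 → ℝ} {L : ℝ≥0}

lemma abs_toNNReal_sub_le (hφ : LipschitzWith L φ) (u v : ℝ) :
    |φ u.toNNReal - φ v.toNNReal| ≤ L * |u - v| := by
  have := hφ.dist_le_mul u.toNNReal v.toNNReal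
  rw [Real.dist_eq, NNReal.dist_eq] at this
  refine this.trans (mul_le_mul_of_nonneg_left ?_ L.2)
  simp only [Real.coe_toNNReal']
  exact abs_max_sub_max_le_abs u v 0

/-- The sum of separate increments has mean exactly `t * gen γ φ y`; the rest is the pathwise error
carried by the later indices. The bound is free of `y`, hence the uniformity of the generator limit.
-/
lemma IsDriving.abs_integral_sub_le (hTY : IsDriving P T Y) (hγ : HypWith γ ε K)
    (hφ : LipschitzWith L φ) {t : ℝ≥0} (h1 : t ≤ 1) (y : ℝ≥0) :
    |(∫ x, φ x ∂(transition γ (P.map (N T Y)) t y)) - φ y - t * gen γ φ y| ≤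
      L * (2 / ε ^ 3 * K + 2) * (t * ∑' n, meanWt P Y ε n * min 1 (n * (t : ℝ))) := by
  have h1' : (t : ℝ) ≤ 1 := by exact_mod_cast h1
  have hβ := hγ.bounds y
  have hβ0 : 0 < γ y := hγ.pos.trans_le hβ.1
  have hφm : Measurable φ := hφ.continuous.measurable
  set f : ℝ → ℝ := fun u => φ u.toNNReal with hf
  set g : ℝ → ℝ := fun z => f (y + G (γ y) z) - f y with hg
  have hgm : Measurable g := by
    have := measurable_G (γ y)
    fun_prop
  have hgle : ∀ z, 0 ≤ z → |g z| ≤ L * wt ε z := by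
    intro z hz
    refine (abs_toNNReal_sub_le hφ _ _).trans (mul_le_mul_of_nonneg_left ?_ L.2)
    rw [add_sub_cancel_left, abs_of_pos (G_pos hz)]
    exact G_le_wt hγ.pos hβ hz
  obtain ⟨hSint, hSmean⟩ := hTY.integral_isum_win hγ.pos t.coe_nonneg h1' hgm hgle
  have hgen : ∫ z in Ioi 0, g z = gen γ φ y := by
    rw [gen, ← setIntegral_G hβ0 (fun u => φ (y + u.toNNReal) - φ y)]
    refine setIntegral_congr_fun measurableSet_Ioi fun z hz => ?_
    have hGz : 0 ≤ G (γ y) z := (G_pos (le_of_lt hz)).le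
    simp only [hg, hf, Real.toNNReal_add y.coe_nonneg hGz, Real.toNNReal_coe]
  have hXm := hTY.measurable_flow hγ 0 t y
  have hφint₀ := hTY.integrable_transition hγ hφ t y
  rw [hTY.transition_of_le_one hγ h1, hTY.pathKernel_eq hγ] at hφint₀ ⊢
  rw [integrable_map_measure hφm.aestronglyMeasurable hXm.aemeasurable] at hφint₀
  rw [integral_map hXm.aemeasurable hφm.aestronglyMeasurable]
  set D : Ω → ℝ := fun ω => φ (flow γ (N T Y ω) 0 t y) - φ y -
    isum (fun n => g (Z Y n ω)) (win (times T ω) 0 t) with hD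
  have hDint : (∫ ω, φ (flow γ (N T Y ω) 0 t y) ∂P) - φ y - t * gen γ φ y = ∫ ω, D ω ∂P := by
    have hφint : Integrable (fun ω => φ (flow γ (N T Y ω) 0 t y)) P := hφint₀
    have hφint_sub : Integrable (fun ω => φ (flow γ (N T Y ω) 0 t y) - φ y) P :=
      hφint.sub (integrable_const _)
    simp only [hD]
    rw [integral_sub hφint_sub hSint,
      integral_sub hφint (integrable_const _), hSmean, hgen]
    simp
  have hC : (0 : ℝ) ≤ L * (2 / ε ^ 3 * K + 2) := by have := hγ.pos; positivity
  have hDle : ∀ᵐ ω ∂P, ENNReal.ofReal ‖D ω‖ ≤ ENNReal.ofReal (L * (2 / ε ^ 3 * K + 2)) *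
      ENNReal.ofReal (isum (fun n => wt ε (marks Y ω n)) (laterIndices (win (times T ω) 0 t))) := by
    filter_upwards [hTY.ae_goodPath hγ.pos] with ω hω
    have hb := field_of_good hγ hω
    have h2 := hb.abs_sub_isum_le (τ := times T ω) (fun n => wt_le_one hγ.pos (hω.nonneg n)) y t
      L.coe_nonneg (abs_toNNReal_sub_le hφ)
    rw [← coe_flow hγ hω t.coe_nonneg] at h2
    rw [← ENNReal.ofReal_mul hC]
    refine ENNReal.ofReal_le_ofReal (le_trans (le_of_eq ?_) h2)
    simp only [Real.toNNReal_coe, hD, hg, hf, coeff, Real.norm_eq_abs]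
    rfl
  rw [hDint, ← Real.norm_eq_abs]
  refine (norm_integral_le_lintegral_norm D).trans ?_
  have hsum : 0 ≤ (t : ℝ) * ∑' n, meanWt P Y ε n * min 1 (n * (t : ℝ)) :=
    mul_nonneg t.coe_nonneg (tsum_nonneg fun n => mul_nonneg (meanWt_nonneg n) (by positivity))
  refine ENNReal.toReal_le_of_le_ofReal (mul_nonneg hC hsum) ?_
  refine (lintegral_mono_ae hDle).trans ?_
  rw [lintegral_const_mul' _ _ ENNReal.ofReal_ne_top, ENNReal.ofReal_mul hC]
  gcongr
  exact hTY.lintegral_laterIndices_le hγ.pos t.coe_nonneg h1'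

lemma IsDriving.tendsto_tsum_meanWt (hTY : IsDriving P T Y) (hε : 0 < ε) :
    Tendsto (fun t : ℝ≥0 => ∑' n, meanWt P Y ε n * min 1 (n * (t : ℝ))) (𝓝[>] 0) (𝓝 0) := by
  have h : Tendsto (fun t : ℝ≥0 => ∑' n, meanWt P Y ε n * min 1 (n * (t : ℝ))) (𝓝[>] 0)
      (𝓝 (∑' n : ℕ, (0 : ℝ))) := by
    refine tendsto_tsum_of_dominated_convergence (hTY.summable_meanWt hε) (fun n => ?_)
      (Eventually.of_forall fun t n => ?_)
    · have hc : Continuous fun t : ℝ≥0 => meanWt P Y ε n * min 1 (n * (t : ℝ)) := by fun_prop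
      have := hc.tendsto 0
      simp only [NNReal.coe_zero, mul_zero, min_eq_right zero_le_one] at this
      exact this.mono_left nhdsWithin_le_nhds
    · rw [Real.norm_eq_abs, abs_of_nonneg (mul_nonneg (meanWt_nonneg n) (by positivity))]
      exact mul_le_of_le_one_right (meanWt_nonneg n) (min_le_left _ _)
  simpa using h

lemma IsDriving.hasGeneratorOnLipschitz (hTY : IsDriving P T Y) (hγ : HypWith γ ε K) :
    HasGeneratorOnLipschitz (transition γ (P.map (N T Y))) (gen γ) := by
  rintro φ ⟨L, hφ⟩
  refine ⟨hTY.integrable_transition hγ hφ, ?_⟩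
  rw [Metric.tendstoUniformly_iff]
  intro e he
  have h1 := (hTY.tendsto_tsum_meanWt hγ.pos).const_mul ((L : ℝ) * (2 / ε ^ 3 * K + 2))
  rw [mul_zero] at h1
  have hlt : ∀ᶠ t : ℝ≥0 in 𝓝[>] 0, t ≤ 1 :=
    mem_nhdsWithin_of_mem_nhds (Iic_mem_nhds zero_lt_one)
  filter_upwards [h1.eventually (gt_mem_nhds he), hlt, self_mem_nhdsWithin] with t ht ht1 ht0 y
  have ht0' : (0 : ℝ) < t := ht0
  have h2 := hTY.abs_integral_sub_le hγ hφ ht1 y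
  rw [dist_comm, Real.dist_eq]
  refine lt_of_le_of_lt ?_ ht
  rw [div_sub' ht0'.ne', abs_div, abs_of_pos ht0', div_le_iff₀ ht0']
  linarith

end Generator

/-! ### The strong Markov property -/

section Grid

/-- The `j`-th dyadic point of order `n`, capped at `c`. -/
noncomputable def grid (c : I) (n j : ℕ) : I :=
  ⟨min (j / 2 ^ n) c, le_min (by positivity) c.2.1, (min_le_right _ _).trans c.2.2⟩

/-- The index of the first dyadic point of order `n` above `u`. -/
noncomputable def gridIndex (n : ℕ) (u : I) : ℕ := ⌈(u : ℝ) * 2 ^ n⌉₊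

lemma measurable_gridIndex (n : ℕ) : Measurable (gridIndex n) :=
  Nat.measurable_ceil.comp (measurable_subtype_coe.mul_const _)

lemma grid_mono (c : I) (n : ℕ) : Monotone (grid c n) := fun i j hij => by
  refine Subtype.coe_le_coe.1 (min_le_min_right _ ?_)
  have : (i : ℝ) ≤ j := by exact_mod_cast hij
  gcongr

lemma gridIndex_le_iff {c u : I} (hu : u ≤ c) (n j : ℕ) : gridIndex n u ≤ j ↔ u ≤ grid c n j := by
  have hu' : (u : ℝ) ≤ c := hu
  rw [gridIndex, Nat.ceil_le, ← le_div_iff₀ (by positivity), ← Subtype.coe_le_coe, grid]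
  exact ⟨fun h => le_min h hu', fun h => h.trans (min_le_left _ _)⟩

lemma le_grid_gridIndex {c u : I} (hu : u ≤ c) (n : ℕ) : u ≤ grid c n (gridIndex n u) :=
  (gridIndex_le_iff hu n _).1 le_rfl

lemma tendsto_grid {c u : I} (hu : u ≤ c) :
    Tendsto (fun n => (grid c n (gridIndex n u) : ℝ)) atTop (𝓝[≥] u) := by
  refine tendsto_nhdsWithin_iff.2 ⟨?_, Eventually.of_forall fun n => le_grid_gridIndex hu n⟩
  have h1 : Tendsto (fun n : ℕ => (u : ℝ) + (1 / 2) ^ n) atTop (𝓝 (u + 0)) :=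
    tendsto_const_nhds.add (tendsto_pow_atTop_nhds_zero_of_lt_one (by norm_num) (by norm_num))
  rw [add_zero] at h1
  refine tendsto_of_tendsto_of_tendsto_of_le_of_le tendsto_const_nhds h1
    (fun n => le_grid_gridIndex hu n) fun n => (min_le_left _ _).trans ?_
  have h2 : ((gridIndex n u : ℕ) : ℝ) < u * 2 ^ n + 1 :=
    Nat.ceil_lt_add_one (mul_nonneg u.2.1 (by positivity))
  rw [div_le_iff₀ (by positivity), add_mul, ← mul_pow]
  norm_num
  exact h2.le

end Grid

/-! ### Passage from fixed times to stopping times. -/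

section StrongMarkov

variable {Ω : Type*} [mΩ : MeasurableSpace Ω] {P : Measure Ω} [IsProbabilityMeasure P]
  {T : ℕ → Ω → I} {Y : ℕ → Ω → ℝ} {γ : ℝ≥0 → ℝ} {ε : ℝ} {K : ℝ≥0}

/-- The Feller property of the transition kernels. -/
lemma IsDriving.continuous_lintegral_pathKernel (hTY : IsDriving P T Y) (hγ : HypWith γ ε K)
    {t : ℝ} (ht : 0 ≤ t) (f : BoundedContinuousFunction ℝ≥0 ℝ≥0) :
    Continuous fun x => ∫⁻ y, (f y : ℝ≥0∞) ∂(pathKernel γ (P.map (N T Y)) t x) := by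
  have hf : Measurable fun y => (f y : ℝ≥0∞) := f.continuous.measurable.coe_nnreal_ennreal
  simp only [hTY.lintegral_pathKernel hγ t _ hf]
  refine continuous_iff_seqContinuous.2 fun u x hu => ?_
  refine tendsto_lintegral_of_dominated_convergence (fun _ => (nndist f 0 : ℝ≥0∞))
    (fun n => hf.comp (hTY.measurable_flow hγ 0 t (u n)))
    (fun n => Eventually.of_forall fun ω =>
      ENNReal.coe_le_coe.2 (BoundedContinuousFunction.NNReal.upper_bound f _)) (by simp) ?_
  filter_upwards [hTY.ae_goodPath hγ.pos] with ω hω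
  exact ENNReal.tendsto_coe.2 ((f.continuous.tendsto _).comp
    (((continuous_flow hγ hω ht).tendsto x).comp hu))

variable {τ : Ω → I}

lemma measurable_of_isStoppingTime {ℱ : Filtration I mΩ}
    (hτ : IsStoppingTime ℱ fun ω => (τ ω : WithTop I)) : Measurable τ := by
  refine measurable_of_Iic fun i => ?_
  have h := ℱ.le i _ (hτ i)
  simp only [WithTop.coe_le_coe] at h
  exact h

/-- On `A` the cap `c` is never below `τ`, so the capped grid point detects the index correctly:
index `j` means that `τ` lies below the `j`-th grid point and below no earlier one. The event is
thus known at that grid time. -/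
lemma measurableSet_inter_gridIndex {ℱ : Filtration I mΩ}
    (hτ : IsStoppingTime ℱ fun ω => (τ ω : WithTop I)) {A : Set Ω}
    (hA : MeasurableSet[hτ.measurableSpace] A) {c : I} (hc : ∀ ω ∈ A, τ ω ≤ c) (n j : ℕ) :
    MeasurableSet[ℱ (grid c n j)] (A ∩ {ω | gridIndex n (τ ω) = j}) := by
  have hB : ∀ i, MeasurableSet[ℱ (grid c n i)] (A ∩ {ω | τ ω ≤ grid c n i}) := fun i => by
    have h := ((hτ.measurableSet A).1 hA).2 (grid c n i)
    simp only [WithTop.coe_le_coe] at h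
    exact h
  have e : A ∩ {ω | gridIndex n (τ ω) = j} = (A ∩ {ω | τ ω ≤ grid c n j}) \
      ⋃ i ∈ Finset.range j, A ∩ {ω | τ ω ≤ grid c n i} := by
    ext ω
    simp only [mem_inter_iff, mem_ofPred_eq, Set.mem_sdiff, mem_iUnion, Finset.mem_range, not_exists,
      exists_prop, not_and]
    constructor
    · rintro ⟨h1, h2⟩
      refine ⟨⟨h1, (gridIndex_le_iff (hc ω h1) n j).1 h2.le⟩, fun i hi _ h3 => ?_⟩
      exact absurd ((gridIndex_le_iff (hc ω h1) n i).2 h3) (not_le.2 (h2 ▸ hi))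
    · rintro ⟨⟨h1, h2⟩, h3⟩
      refine ⟨h1, le_antisymm ((gridIndex_le_iff (hc ω h1) n j).2 h2) (not_lt.1 fun h4 => ?_)⟩
      exact h3 _ h4 h1 (le_grid_gridIndex (hc ω h1) n)
  rw [e]
  exact (hB j).diff (Finset.measurableSet_biUnion _ fun i hi =>
    ℱ.mono (grid_mono c n (Finset.mem_range.1 hi).le) _ (hB i))

/-- The Markov property at a stopping time with values in a grid. -/
lemma IsDriving.markov_grid (hTY : IsDriving P T Y) (hγ : HypWith γ ε K)
    (hτ : IsStoppingTime (filt T Y hTY.measurable_T hTY.measurable_Y)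
      fun ω => (τ ω : WithTop I)) {A : Set Ω} (hA : MeasurableSet[hτ.measurableSpace] A) {t : ℝ}
    (ht : 0 ≤ t) {c : I} (hct : (c : ℝ) + t ≤ 1) (hc : ∀ ω ∈ A, τ ω ≤ c) (n : ℕ)
    {f : ℝ≥0 → ℝ≥0∞} (hf : Measurable f) :
    ∫⁻ ω in A, f (flow γ (N T Y ω) 0 (grid c n (gridIndex n (τ ω)) + t) 0) ∂P =
      ∫⁻ ω in A, ∫⁻ y, f y ∂(pathKernel γ (P.map (N T Y)) t
        (flow γ (N T Y ω) 0 (grid c n (gridIndex n (τ ω))) 0)) ∂P := by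
  have hAj := measurableSet_inter_gridIndex hτ hA hc n
  have hmA : ∀ j, MeasurableSet (A ∩ {ω | gridIndex n (τ ω) = j}) := fun j =>
    (filt T Y hTY.measurable_T hTY.measurable_Y).le _ _ (hAj j)
  have hU : A = ⋃ j, A ∩ {ω | gridIndex n (τ ω) = j} := by
    ext ω
    simp
  have hd : Pairwise (Function.onFun Disjoint fun j => A ∩ {ω | gridIndex n (τ ω) = j}) :=
    fun i j hij => Set.disjoint_left.2 fun ω h1 h2 => hij (h1.2.symm.trans h2.2)
  rw [hU, lintegral_iUnion hmA hd, lintegral_iUnion hmA hd]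
  congr 1
  ext j
  have hg : (grid c n j : ℝ) + t ≤ 1 := by
    have : (grid c n j : ℝ) ≤ c := min_le_right _ _
    linarith
  have h := hTY.markov_flow_lintegral hγ (grid c n j) ht hg 0 (hAj j) hf
  refine (setLIntegral_congr_fun (hmA j) fun ω hω => ?_).trans
    (h.trans (setLIntegral_congr_fun (hmA j) fun ω hω => ?_))
  · have : gridIndex n (τ ω) = j := hω.2
    simp only [this]
  · have : gridIndex n (τ ω) = j := hω.2
    simp only [this]

omit [IsProbabilityMeasure P] in
lemma IsDriving.measurable_flow_grid (hTY : IsDriving P T Y) (hγ : HypWith γ ε K)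
    (hτ : Measurable τ) (c : I) (n : ℕ) (t : ℝ) :
    Measurable fun ω => flow γ (N T Y ω) 0 (grid c n (gridIndex n (τ ω)) + t) 0 := by
  have h1 : Measurable fun q : ℕ × Ω => flow γ (N T Y q.2) 0 (grid c n q.1 + t) 0 :=
    measurable_from_prod_countable_right fun j => hTY.measurable_flow hγ 0 (grid c n j + t) 0
  have h2 : Measurable fun ω => (gridIndex n (τ ω), ω) :=
    ((measurable_gridIndex n).comp hτ).prodMk measurable_id
  have h3 := Measurable.comp h1 h2
  exact h3

lemma IsDriving.ae_tendsto_flow_grid (hTY : IsDriving P T Y) (hγ : HypWith γ ε K) {A : Set Ω}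
    (hmA : MeasurableSet A) {c : I} (hc : ∀ ω ∈ A, τ ω ≤ c) {t : ℝ} (ht : 0 ≤ t) :
    ∀ᵐ ω ∂(P.restrict A), Tendsto
      (fun n => flow γ (N T Y ω) 0 (grid c n (gridIndex n (τ ω)) + t) 0) atTop
      (𝓝 (flow γ (N T Y ω) 0 (τ ω + t) 0)) := by
  filter_upwards [ae_restrict_of_ae (hTY.ae_goodPath hγ.pos), ae_restrict_mem hmA] with ω hω hA
  refine (continuousWithinAt_flow hγ hω (add_nonneg (τ ω).2.1 ht) 0).comp ?_
  obtain ⟨h1, h2⟩ := tendsto_nhdsWithin_iff.1 (tendsto_grid (hc ω hA))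
  exact tendsto_nhdsWithin_iff.2 ⟨h1.add_const t, h2.mono fun n hn => add_le_add_left hn t⟩

/-- The strong Markov property of the process started from `0`. -/
lemma IsDriving.strongMarkov (hTY : IsDriving P T Y) (hγ : HypWith γ ε K)
    (hτ : IsStoppingTime (filt T Y hTY.measurable_T hTY.measurable_Y)
      fun ω => (τ ω : WithTop I)) {A : Set Ω} (hA : MeasurableSet[hτ.measurableSpace] A) {t : ℝ}
    (ht : 0 ≤ t) {c : I} (hct : (c : ℝ) + t ≤ 1) (hc : ∀ ω ∈ A, τ ω ≤ c) {B : Set ℝ≥0}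
    (hB : MeasurableSet B) :
    P (A ∩ {ω | flow γ (N T Y ω) 0 (τ ω + t) 0 ∈ B}) =
      ∫⁻ ω in A, pathKernel γ (P.map (N T Y)) t (flow γ (N T Y ω) 0 (τ ω) 0) B ∂P := by
  have hmA : MeasurableSet A := hτ.measurableSpace_le A hA
  have hmτ := measurable_of_isStoppingTime hτ
  have hmX := hTY.measurable_flow_grid hγ hmτ c
  have hlim : ∀ {r : ℝ}, 0 ≤ r → _ := fun {r} hr =>
    hTY.ae_tendsto_flow_grid hγ hmA hc (t := r) hr
  -- The process at the random time is an almost sure limit of its values at countably valued grid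
  -- times, so joint measurability in time and path is not required.
  have hX : ∀ {r : ℝ}, 0 ≤ r →
      AEMeasurable (fun ω => flow γ (N T Y ω) 0 (τ ω + r) 0) (P.restrict A) := fun {r} hr =>
    aemeasurable_of_tendsto_metrizable_ae' (fun n => (hmX n r).aemeasurable) (hlim hr)
  have hX0 : AEMeasurable (fun ω => flow γ (N T Y ω) 0 (τ ω) 0) (P.restrict A) := by
    simpa using hX le_rfl
  have hk : AEMeasurable
      (fun ω => pathKernel γ (P.map (N T Y)) t (flow γ (N T Y ω) 0 (τ ω) 0)) (P.restrict A) :=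
    (Kernel.measurable _).comp_aemeasurable hX0
  have key : (P.restrict A).map (fun ω => flow γ (N T Y ω) 0 (τ ω + t) 0) =
      (P.restrict A).bind fun ω => pathKernel γ (P.map (N T Y)) t (flow γ (N T Y ω) 0 (τ ω) 0) := by
    -- Bounded continuous functions determine finite measures. For these, both sides of the grid
    -- identity converge: the left by right continuity of the paths, the right by right continuity
    -- and the Feller property.
    refine ext_of_forall_lintegral_eq_of_IsFiniteMeasure fun f => ?_
    have hf : Measurable fun y => (f y : ℝ≥0∞) := f.continuous.measurable.coe_nnreal_ennreal
    rw [lintegral_map' hf.aemeasurable (hX ht), Measure.lintegral_bind hk hf.aemeasurable]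
    have hfb : ∀ y, (f y : ℝ≥0∞) ≤ (nndist f 0 : ℝ≥0∞) := fun y =>
      ENNReal.coe_le_coe.2 (BoundedContinuousFunction.NNReal.upper_bound f _)
    have hfin : ∫⁻ _ in A, (nndist f 0 : ℝ≥0∞) ∂P ≠ ∞ := by
      rw [setLIntegral_const]
      exact ENNReal.mul_ne_top ENNReal.coe_ne_top (measure_ne_top _ _)
    have h1 := tendsto_lintegral_of_dominated_convergence (fun _ => (nndist f 0 : ℝ≥0∞))
      (fun n => hf.comp (hmX n t)) (fun n => Eventually.of_forall fun ω => hfb _) hfin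
      ((hlim ht).mono fun ω hω => ENNReal.tendsto_coe.2 ((f.continuous.tendsto _).comp hω))
    have hF := hTY.continuous_lintegral_pathKernel hγ ht f
    have hmk := hTY.isMarkovKernel_pathKernel hγ t
    have h2 := tendsto_lintegral_of_dominated_convergence (fun _ => (nndist f 0 : ℝ≥0∞))
      (fun n => hF.measurable.comp (hmX n 0)) (fun n => Eventually.of_forall fun ω => by
        refine (lintegral_mono hfb).trans ?_
        simp) hfin
      ((hlim le_rfl).mono fun ω hω => (hF.tendsto _).comp hω)
    simp only [Function.comp_def, add_zero] at h1 h2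
    simp only [hTY.markov_grid hγ hτ hA ht hct hc _ hf] at h1
    exact tendsto_nhds_unique h1 h2
  have h := DFunLike.congr_fun key B
  rw [Measure.map_apply_of_aemeasurable (hX ht) hB, Measure.bind_apply hB hk,
    Measure.restrict_apply' hmA, inter_comm] at h
  exact h

lemma IsDriving.isStrongMarkov (hTY : IsDriving P T Y) (hγ : HypWith γ ε K) :
    IsStrongMarkov P (filt T Y hTY.measurable_T hTY.measurable_Y)
      (fun t ω => flow γ (N T Y ω) 0 t 0) (transition γ (P.map (N T Y))) := by
  intro τ hτ t A hA hle B hB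
  rcases le_or_gt t 1 with ht | ht
  · have ht' : (t : ℝ) ≤ 1 := by exact_mod_cast ht
    -- The cap `1 - t` keeps all grid times, shifted by `t`, inside `[0, 1]`.
    have h := hTY.strongMarkov hγ hτ hA t.coe_nonneg
      (c := ⟨1 - t, sub_nonneg.2 ht', sub_le_self _ t.coe_nonneg⟩) (by simp)
      (fun ω hω => by
        have := hle ω hω
        exact Subtype.coe_le_coe.1 (by simp only; linarith)) hB
    rw [hTY.transition_of_le_one hγ ht, ← h]
    congr 1
    ext ω
    refine and_congr_right fun hω => ?_
    have hmem : (τ ω : ℝ) + t ∈ Icc (0 : ℝ) 1 := ⟨add_nonneg (τ ω).2.1 t.coe_nonneg, hle ω hω⟩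
    simp only [mem_ofPred_eq, projIcc_of_mem _ hmem]
  · have hE : A = ∅ := eq_empty_of_forall_notMem fun ω hω => by
      have h1 := hle ω hω
      have h2 : (1 : ℝ) < t := by exact_mod_cast ht
      linarith [(τ ω).2.1]
    simp [hE]

end StrongMarkov

end PoissonSDE

open PoissonSDE in
theorem proposition1 {Ω : Type*} [mΩ : MeasurableSpace Ω] (P : Measure Ω) [IsProbabilityMeasure P]
    (T : ℕ → Ω → I) (Y : ℕ → Ω → ℝ) (hTY : IsDriving P T Y)
    (γ : ℝ≥0 → ℝ) (hγ : Hyp γ) :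
    ∃ M : I → Ω → ℝ≥0,
      -- existence of a càdlàg adapted solution
      Adapted (filt T Y hTY.measurable_T hTY.measurable_Y) M ∧
      IsCadlagSolution γ P T Y M ∧
      -- uniqueness up to indistinguishability, among all càdlàg solutions
      (∀ M' : I → Ω → ℝ≥0, IsCadlagSolution γ P T Y M' → ∀ᵐ ω ∂P, ∀ t, M' t ω = M t ω) ∧
      -- strong Markov process with the given generator
      (∃ κ : ℝ≥0 → Kernel ℝ≥0 ℝ≥0, IsMarkovSemigroup κ ∧ HasGeneratorOnLipschitz κ (gen γ) ∧
        IsStrongMarkov P (filt T Y hTY.measurable_T hTY.measurable_Y) M κ) ∧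
      -- the paths are increasing
      (∀ᵐ ω ∂P, StrictMono fun t => M t ω) ∧
      -- the jump times
      (∀ᵐ ω ∂P, jumpTimes (fun t => M t ω) = range (fun n => T n ω) ∧
        (jumpTimes fun t => M t ω).Countable ∧ Dense (jumpTimes fun t => M t ω)) := by
  obtain ⟨⟨ε, hε, hb⟩, ⟨K, hK⟩, hmono⟩ := hγ
  have hγ : HypWith γ ε K := ⟨hε, hb, hK, hmono.monotone⟩
  have hgood := hTY.ae_goodPath hε
  -- The candidate is defined for every `ω` as a functional of the noise up to `t`, so it is adapted
  -- without null sets; the equation and the path properties then hold on the almost sure set of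
  -- good paths.
  refine ⟨fun t ω => flow γ (N T Y ω) 0 t 0, fun t => hTY.measurable_flow_filt hγ t 0, ?_, ?_,
    ⟨transition γ (P.map (N T Y)), hTY.isMarkovSemigroup hγ, hTY.hasGeneratorOnLipschitz hγ,
      hTY.isStrongMarkov hγ⟩, ?_, ?_⟩
  · filter_upwards [hgood] with ω hω
    exact ⟨isCadlag_flow hγ hω, solvesPath_flow hγ hω⟩
  · intro M' hM'
    filter_upwards [hgood, hM'] with ω hω h t
    exact eq_flow_of_solvesPath hγ hω h.2 t
  · filter_upwards [hgood] with ω hω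
    exact strictMono_flow hγ hω
  · filter_upwards [hgood] with ω hω
    rw [jumpTimes_flow hγ hω]
    exact ⟨rfl, countable_range _, hω.dense⟩
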